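/- Let $\Omega\subset\mathbb{C}^n$ be a domain (not necessarily bounded) and let $1\le q<n$. Write $d^c=i(\bar\partial-\partial)$ and $\omega=dd^c|z|^2$. Let $\{T_j\}_{j\in J}$ be a family of closed positive currents of bidegree $(n-q,n-q)$ in $\Omega$ such that $$\int_\Omega T_j\wedge\omega^q>0\qquad\text{for all } j\in J.$$ Assume that every Borel set $E\subset\Omega$ with $\int_E T_j\wedge\omega^q=0$ for all $j\in J$ has Lebesgue measure $0$. Let $u$ be a plurisubharmonic function on $\Omega$ and, for each $j\in J$ and each positive integer $k$, let $u_{jk}$ be a bounded plurisubharmonic function on $\Omega$ such that, for each $j$, the sequence $(u_{jk})_k$ decreases pointwise to $u$ on $\Omega$ as $k\to\infty$. Suppose that $$\lim_{k\to\infty}\int_\Omega T_j\wedge(dd^cu_{jk})^q=0\qquad\text{for all } j\in J,$$ where $T_j\wedge(dd^cu_{jk})^q$ is the positive measure of Bedford and Taylor, obtained by applying $q$ times the operation $S\mapsto dd^cu_{jk}\wedge S:=dd^c(u_{jk}S)$ to $T_j$. Then $u$ is maximal in $\Omega$: for every open set $G$ that is relatively compact in $\Omega$ and every upper semicontinuous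 function $v$ on $\overline G$ that is plurisubharmonic in $G$ and satisfies $v\le u$ on $\partial G$, one has $v\le u$ in $G$. -/

import Mathlib

open scoped Distributions

noncomputable section

namespace Pluri

open MeasureTheory Filter Topology

/-- The space `ℂⁿ`. (Only its topology, linear structure and Lebesgue measure are used.) -/
abbrev Cn (n : ℕ) : Type := Fin n → ℂ

/-! ### Plurisubharmonic and maximal plurisubharmonic functions -/

/-- `u` is plurisubharmonic on the open set `U ⊆ ℂⁿ`: it takes values in `[-∞, ∞)`, is upper
semicontinuous, and satisfies the sub-mean value inequality on the boundary of every closed disc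
`{z + ζ w : |ζ| ≤ 1}` in a complex line which is contained in `U`.
The mean over the circle of the function `u` (bounded above, possibly `-∞` somewhere) is the limit
(infimum) of the means of the truncations `max (u, -N)`. The function which is identically `-∞` is
allowed. -/
structure PSHOn {n : ℕ} (U : Set (Cn n)) (u : Cn n → EReal) : Prop where
  ne_top : ∀ z ∈ U, u z ≠ ⊤
  usc : UpperSemicontinuousOn u U
  le_average : ∀ z ∈ U, ∀ w : Cn n, (∀ ζ : ℂ, ‖ζ‖ ≤ 1 → z + ζ • w ∈ U) →
    ∀ N : ℕ, u z ≤ ((Real.circleAverage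
      (fun ζ : ℂ => (max (u (z + ζ • w)) (((-(N : ℝ)) : ℝ) : EReal)).toReal) 0 1 : ℝ) : EReal)

/-- `u` is a maximal plurisubharmonic function on `Ω`. -/
def IsMaximalPSH {n : ℕ} (Ω : Set (Cn n)) (u : Cn n → EReal) : Prop :=
  PSHOn Ω u ∧
    ∀ G : Set (Cn n), IsOpen G → IsCompact (closure G) → closure G ⊆ Ω →
      ∀ v : Cn n → EReal, UpperSemicontinuousOn v (closure G) → PSHOn G v →
        (∀ z ∈ frontier G, v z ≤ u z) → ∀ z ∈ G, v z ≤ u z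

/-! ### Exterior forms -/

/-- Real alternating `m`-forms on the real vector space underlying `ℂⁿ`. -/
abbrev Form (n m : ℕ) : Type := Cn n [⋀^Fin m]→L[ℝ] ℝ

/-- The wedge product `l₁ ∧ ⋯ ∧ l_m` of real linear forms, `(v₁, …, v_m) ↦ det (l_j (v_i))`. -/
def wedgeOne {n m : ℕ} (l : Fin m → (Cn n →L[ℝ] ℝ)) : Form n m :=
  { (Matrix.detRowAlternating (R := ℝ) (n := Fin m)).compLinearMap
      (LinearMap.pi fun j => (l j : Cn n →ₗ[ℝ] ℝ)) with
    cont := by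
      change Continuous fun v : Fin m → Cn n => Matrix.det (Matrix.of fun i j => l j (v i))
      refine Continuous.matrix_det ?_
      refine continuous_matrix fun i j => ?_
      exact (l j).continuous.comp (continuous_apply i) }

/-- For complex linear forms `α₁, …, α_p` (that is, `(1,0)`-covectors), the real `(p,p)`-covector
`Re α₁ ∧ Im α₁ ∧ ⋯ ∧ Re α_p ∧ Im α_p`. Since `i α ∧ ᾱ = 2 Re α ∧ Im α`, it is equal to
`2⁻ᵖ (i α₁ ∧ ᾱ₁) ∧ ⋯ ∧ (i α_p ∧ ᾱ_p)`. -/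
def elementaryForm {n p : ℕ} (α : Fin p → (Cn n →L[ℂ] ℂ)) : Form n (2 * p) :=
  wedgeOne fun k : Fin (2 * p) =>
    if (k : ℕ) % 2 = 0 then
      Complex.reCLM.comp ((α ⟨(k : ℕ) / 2, by omega⟩).restrictScalars ℝ)
    else
      Complex.imCLM.comp ((α ⟨(k : ℕ) / 2, by omega⟩).restrictScalars ℝ)

/-- The form `ω^q`, where `ω = dd^c |z|² = 2i ∑_j dz_j ∧ dz̄_j = ∑_j 4 dx_j ∧ dy_j`, expanded:
`ω^q = ∑_{j₁, …, j_q} 4^q dx_{j₁} ∧ dy_{j₁} ∧ ⋯ ∧ dx_{j_q} ∧ dy_{j_q}`. -/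
def omegaPow (n q : ℕ) : Form n (2 * q) :=
  ∑ I : Fin q → Fin n, (4 : ℝ) ^ q •
    elementaryForm fun k => (ContinuousLinearMap.proj (I k) : Cn n →L[ℂ] ℂ)

/-- The action of a complex scalar `c` on `m`-forms, `(c^* φ)(v₁, …, v_m) = φ (c v₁, …, c v_m)`.
A covector of type `(r,s)` is multiplied by `c^r c̄^s`. -/
def pull {n m : ℕ} (c : ℂ) (φ : Form n m) : Form n m :=
  φ.compContinuousLinearMap ((c • ContinuousLinearMap.id ℂ (Cn n)).restrictScalars ℝ)

/-- The operator `d^c = i (∂̄ - ∂)` on differential forms, written as `J⁻¹ d J`, where `J` is the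
action of `i`. Indeed, on forms of type `(r,s)` the operator `J` is the multiplication by
`i^(r-s)`. -/
def dc {n m : ℕ} (φ : Cn n → Form n m) : Cn n → Form n (m + 1) :=
  fun x => pull (-Complex.I) (extDeriv (fun y => pull Complex.I (φ y)) x)

/-- The operator `dd^c = 2i ∂∂̄` on differential forms. -/
def ddc {n m : ℕ} (φ : Cn n → Form n m) : Cn n → Form n (m + 2) :=
  extDeriv (dc φ)

/-! ### Currents -/

/-- Test forms of degree `m` on `Ω`: smooth real `m`-forms with compact support in `Ω`. -/
abbrev TestForm {n : ℕ} (Ω : TopologicalSpace.Opens (Cn n)) (m : ℕ) : Type := 𝓓(Ω, Form n m)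

/-- Real currents of dimension `m` (degree `2n - m`) on `Ω`: continuous linear functionals on the
space of test forms of degree `m`. (Positive currents are real, so they are given by their values
on real test forms.) -/
abbrev Current {n : ℕ} (Ω : TopologicalSpace.Opens (Cn n)) (m : ℕ) : Type :=
  TestForm Ω m →L[ℝ] ℝ

variable {n : ℕ} {Ω : TopologicalSpace.Opens (Cn n)}

/-- The test form `χ β`, for a test function `χ` and a form `β` with constant coefficients. -/
def smulForm {m : ℕ} (χ : 𝓓(Ω, ℝ)) (β : Form n m) : TestForm Ω m :=
  TestFunction.postcompCLM (ContinuousLinearMap.toSpanSingleton ℝ β) χ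

/-- The current is closed: `dT = 0`, i.e. `T` vanishes on the differentials of test forms. -/
def IsClosedCurrent : {m : ℕ} → Current Ω m → Prop
  | 0, _ => True
  | m + 1, T => ∀ (φ : TestForm Ω m) (ψ : TestForm Ω (m + 1)),
      (∀ x, ψ x = extDeriv φ x) → T ψ = 0

/-- The current `T` of dimension `2p` has bidimension `(p,p)`, i.e. bidegree `(n-p, n-p)`:
it sees only the `(p,p)`-components of test forms. As the rotation by `e^{iθ}` multiplies the
`(r,s)`-component of a form by `e^{i(r-s)θ}`, this says that `T` does not change if test forms are
rotated (pointwise, on covectors). -/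
def IsBidim {p : ℕ} (T : Current Ω (2 * p)) : Prop :=
  ∀ (θ : ℝ) (φ ψ : TestForm Ω (2 * p)),
    (∀ x, ψ x = pull (Complex.exp (θ * Complex.I)) (φ x)) → T ψ = T φ

/-- The current `T` of bidimension `(p,p)` is positive: `T ∧ i α₁ ∧ ᾱ₁ ∧ ⋯ ∧ i α_p ∧ ᾱ_p` is a
positive distribution for all `(1,0)`-forms `α₁, …, α_p` with constant coefficients. -/
def IsPositive {p : ℕ} (T : Current Ω (2 * p)) : Prop :=
  ∀ (α : Fin p → (Cn n →L[ℂ] ℂ)) (χ : 𝓓(Ω, ℝ)), (∀ x, 0 ≤ χ x) →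
    0 ≤ T (smulForm χ (elementaryForm α))

/-- Closed positive currents of bidimension `(p,p)`, i.e. of bidegree `(n-p, n-p)`. -/
structure IsClosedPositive {p : ℕ} (T : Current Ω (2 * p)) : Prop where
  bidim : IsBidim T
  positive : IsPositive T
  closed : IsClosedCurrent T

/-! ### Measures given by positive distributions -/

/-- The measure `μ` on `Ω` (a measure on `ℂⁿ` that does not charge the complement of `Ω`) is
a Radon measure on `Ω` and represents the functional `L` on test functions. -/
structure IsRepresentingMeasure (L : 𝓓(Ω, ℝ) → ℝ) (μ : Measure (Cn n)) : Prop where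
  compl_eq_zero : μ (Ω : Set (Cn n))ᶜ = 0
  lt_top_of_isCompact : ∀ K : Set (Cn n), IsCompact K → K ⊆ Ω → μ K < ⊤
  integral_eq : ∀ χ : 𝓓(Ω, ℝ), ∫ x, χ x ∂μ = L χ

open Classical in
/-- The Radon measure on `Ω` given by a positive distribution `L`; it exists and is unique by the
Riesz representation theorem. -/
def measureOf (L : 𝓓(Ω, ℝ) → ℝ) : Measure (Cn n) :=
  if h : ∃ μ, IsRepresentingMeasure L μ then h.choose else 0

/-- The measure `T ∧ ω^q` of a positive current `T` of bidimension `(q,q)`. -/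
def traceMeasure {q : ℕ} (T : Current Ω (2 * q)) : Measure (Cn n) :=
  measureOf fun χ => T (smulForm χ (omegaPow n q))

/-- The measure given by a positive current of bidimension `(0,0)`. -/
def zeroDimMeasure (S : Current Ω 0) : Measure (Cn n) :=
  measureOf fun χ => S (smulForm χ (ContinuousAlternatingMap.constOfIsEmpty ℝ (Cn n) (Fin 0) 1))

/-! ### The product `T ∧ (dd^c u)^q` of Bedford and Taylor -/

/-- The current `T` is represented by integration: `T φ = ∫ ⟨τ (x), φ (x)⟩ dμ(x)`, where `μ` is a
measure and (the coordinates of) `τ` are locally `μ`-integrable on `Ω`. So `T` has measure coefficients, as every positive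
current does. -/
structure IsRepresentedBy {m : ℕ} (T : Current Ω m) (μ : Measure (Cn n))
    (τ : Cn n → (Form n m →L[ℝ] ℝ)) : Prop where
  locallyIntegrable : ∀ β : Form n m, LocallyIntegrableOn (fun x => τ x β) (Ω : Set (Cn n)) μ
  eq_integral : ∀ φ : TestForm Ω m, T φ = ∫ x, τ x (φ x) ∂μ

/-- `S = dd^c u ∧ T := dd^c (u T)`, where `T` is a current with measure coefficients and `u` is
a locally bounded Borel function: if `T = τ μ`, then `u T = u τ μ`, so that
`S φ = (u T) (dd^c φ) = ∫ u ⟨τ, dd^c φ⟩ dμ`. (This does not depend on the choice of `μ` and `τ`.) -/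
def IsDDcWedge {m : ℕ} (u : Cn n → ℝ) (T : Current Ω (m + 2)) (S : Current Ω m) : Prop :=
  ∃ (μ : Measure (Cn n)) (τ : Cn n → (Form n (m + 2) →L[ℝ] ℝ)), IsRepresentedBy T μ τ ∧
    ∀ φ : TestForm Ω m, S φ = ∫ x, u x * τ x (ddc φ x) ∂μ

open Classical in
/-- The current `dd^c u ∧ T = dd^c (u T)`. -/
def ddcWedge {m : ℕ} (u : Cn n → ℝ) (T : Current Ω (m + 2)) : Current Ω m :=
  if h : ∃ S, IsDDcWedge u T S then h.choose else 0

/-- The current `T ∧ (dd^c u)^p` of dimension `0`, for `T` of dimension `2p`, obtained by applying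
`p` times the operation `T ↦ dd^c u ∧ T`. -/
def ddcPowWedge (u : Cn n → ℝ) : (p : ℕ) → Current Ω (2 * p) → Current Ω 0
  | 0, T => T
  | p + 1, T => ddcPowWedge u p (ddcWedge (m := 2 * p) u T)

/-- The measure `T ∧ (dd^c u)^p`, for a closed positive current `T` of bidimension `(p,p)` and
a bounded plurisubharmonic function `u`. -/
def mongeAmpereMeasure {p : ℕ} (T : Current Ω (2 * p)) (u : Cn n → ℝ) : Measure (Cn n) :=
  zeroDimMeasure (ddcPowWedge u p T)

end Pluri

end

/-! The theorem follows from an inequality of Chern-Levine-Nirenberg type. Let `G` be relatively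
compact in `Ω`, let `v ≤ u` on the boundary of `G`, and let `|z|² ≤ M` on the closure of `G`. Each
`u_{jk}` lies above `u`, hence above `v` on the boundary, and `lintegral_pow_sub_le` bounds `∫_G ((v
- u_{jk})⁺)^q T_j ∧ ω^q` by `q! M^q ∫_Ω T_j ∧ (dd^c u_{jk})^q`, where `v` is first truncated from
below to make it real valued. The right side tends to zero and the integrand on the left increases
with `k`. So `v ≤ u_{jk}` for all `k`, hence `v ≤ u`, almost everywhere in `G` for each trace
measure (`ae_le_of_mass_tendsto_zero`). Thus `{u < v}` is null for all trace measures, so Lebesgue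
null by hypothesis, and plurisubharmonic functions compared almost everywhere are compared
everywhere (`PSHOn.le_of_ae_le`).

The inequality trades one factor `ω` at a time for a factor `dd^c w`. Let `S` be closed and
positive, `w` smooth plurisubharmonic, and `h ≥ 0` smooth with support near `G`, such that `h + w`
is plurisubharmonic on the support of `h`. Then `dd^c h^{p+1} ≥ (p+1) h^p dd^c h ≥ -(p+1) h^p dd^c
w`. Integrating by parts against `|z|² - M ≤ 0` gives `∫ h^{p+1} S ∧ ω^{p+1} ≤ (p+1) M ∫ h^p S ∧
dd^c w ∧ ω^p` (`powForm_succ_le`), and `contractPow_bound` iterates this.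

For a function `u` that is not smooth, `T ∧ (dd^c u)^q` is a successive weak limit. The
mollifications `w_i` of `u` are therefore chosen one after the other, with different scales
(`exists_regFn_approx`). The function `h_i` is a mollification of `(v - w_i)⁺`; small shifts of `v`
make these functions increase with `i`, as the iteration needs, and a term `η |z|²` added to `w_i`
absorbs the error of mollifying. The whole construction rests on the representation of positive
currents by measures with positive densities (`exists_isPosRep`) and on the fact that `dd^c u ∧ T`
is again closed and positive (`IsClosedPositive.ddcWedge`). -/

open scoped Distributions
noncomputable section
namespace Pluri
open MeasureTheory Filter Topology
set_option maxSynthPendingDepth 3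

/-! ### Exterior algebra: covectors, rotations, and the product `dd^c w ∧ β` in terms of the
Hessian. -/

section FormAlgebra

open ContinuousAlternatingMap hiding sub_apply add_apply smul_apply map_sum sum_apply neg_apply

variable {n m : ℕ}

/-- Provides bases of constant forms, so that test forms split into scalar coefficients and all
linear functionals on forms are continuous. -/
instance finiteDimensional_form (n m : ℕ) : FiniteDimensional ℝ (Form n m) :=
  have : IsNoetherian ℝ (MultilinearMap ℝ (fun _ : Fin m => Cn n) ℝ) :=
    isNoetherian_of_isNoetherianRing_of_finite _ _
  Module.Finite.of_injective
    ((AlternatingMap.toMultilinearMapLM (S := ℝ)).comp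
      (ContinuousAlternatingMap.toAlternatingMapLinear (R := ℝ) (A := ℝ)))
    fun f g h => by
      ext v
      exact congrArg (fun F : MultilinearMap ℝ (fun _ : Fin m => Cn n) ℝ => F v) h

/-- Multiplication by a complex scalar, as a real linear map of `ℂⁿ`. -/
def scalarMap (n : ℕ) (c : ℂ) : Cn n →L[ℝ] Cn n :=
  (c • ContinuousLinearMap.id ℂ (Cn n)).restrictScalars ℝ

@[simp] lemma scalarMap_apply (c : ℂ) (v : Cn n) : scalarMap n c v = c • v := rfl

/-- Alternatization of a bilinear map with values in alternating forms. -/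
def altTwo : (Cn n →L[ℝ] Cn n →L[ℝ] Form n m) →L[ℝ] Form n (m + 2) :=
  (alternatizeUncurryFinCLM ℝ (Cn n) ℝ).comp
    (ContinuousLinearMap.compL ℝ (Cn n) (Cn n →L[ℝ] Form n m) (Form n (m + 1))
      (alternatizeUncurryFinCLM ℝ (Cn n) ℝ))

lemma altTwo_eq (f : Cn n →L[ℝ] Cn n →L[ℝ] Form n m) :
    altTwo f = alternatizeUncurryFin (alternatizeUncurryFinCLM ℝ (Cn n) ℝ ∘L f) := rfl

lemma altTwo_eq_zero_of_symmetric {f : Cn n →L[ℝ] Cn n →L[ℝ] Form n m}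
    (hf : ∀ v w, f v w = f w v) : altTwo f = 0 :=
  alternatizeUncurryFin_alternatizeUncurryFinCLM_comp_of_symmetric hf

/-- Two bilinear maps with the same antisymmetric part have the same alternatization. -/
lemma altTwo_congr {f g : Cn n →L[ℝ] Cn n →L[ℝ] Form n m}
    (h : ∀ v w, f v w - f w v = g v w - g w v) : altTwo f = altTwo g := by
  rw [← sub_eq_zero, ← map_sub]
  refine altTwo_eq_zero_of_symmetric fun v w => ?_
  have := h v w
  rw [sub_apply, sub_apply, sub_apply,
    sub_apply]
  rw [← sub_eq_zero] at this ⊢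
  rw [← this]; abel

/-- The exterior product `l ∧ β` of a covector and a form. -/
def wedgeCovector (l : Cn n →L[ℝ] ℝ) (β : Form n m) : Form n (m + 1) :=
  alternatizeUncurryFin (l.smulRight β)

/-- Twist of a bilinear map: `(v, w) ↦ K (v, -i w)`. -/
def twist {F : Type*} [NormedAddCommGroup F] [NormedSpace ℝ F] :
    (Cn n →L[ℝ] Cn n →L[ℝ] F) →L[ℝ] (Cn n →L[ℝ] Cn n →L[ℝ] F) :=
  ContinuousLinearMap.compL ℝ (Cn n) (Cn n →L[ℝ] F) (Cn n →L[ℝ] F)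
    ((ContinuousLinearMap.compL ℝ (Cn n) (Cn n) F).flip (scalarMap n (-Complex.I)))

@[simp] lemma twist_apply {F : Type*} [NormedAddCommGroup F] [NormedSpace ℝ F]
    (K : Cn n →L[ℝ] Cn n →L[ℝ] F) (v w : Cn n) : twist K v w = K v (-Complex.I • w) := rfl

/-- The bilinear map `(v, w) ↦ H (v, w) β`. -/
def tensorForm : (Cn n →L[ℝ] Cn n →L[ℝ] ℝ) →L[ℝ] Form n m →L[ℝ] Cn n →L[ℝ] Cn n →L[ℝ] Form n m :=
   (((ContinuousLinearMap.compL ℝ (Cn n) (Cn n →L[ℝ] ℝ) (Cn n →L[ℝ] Form n m))).comp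
    (ContinuousLinearMap.smulRightL ℝ (Cn n) (Form n m)).flip).flip

@[simp] lemma tensorForm_apply (H : Cn n →L[ℝ] Cn n →L[ℝ] ℝ) (β : Form n m) (v w : Cn n) :
    tensorForm H β v w = H v w • β := rfl

/-- For the real Hessian `H` of a function `w` at a point, this is `dd^c w ∧ β`. -/
def hessWedge : (Cn n →L[ℝ] Cn n →L[ℝ] ℝ) →L[ℝ] Form n m →L[ℝ] Form n (m + 2) :=
  (ContinuousLinearMap.compL ℝ (Form n m) _ _ (altTwo.comp twist)).comp tensorForm

lemma hessWedge_apply (H : Cn n →L[ℝ] Cn n →L[ℝ] ℝ) (β : Form n m) :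
    hessWedge H β = altTwo (twist (tensorForm H β)) := rfl

lemma pull_apply (c : ℂ) (φ : Form n m) (v : Fin m → Cn n) : pull c φ v = φ fun i => c • v i := rfl

/-- `pull c` as a continuous linear map. -/
def pullCLM (c : ℂ) : Form n m →L[ℝ] Form n m :=
  ContinuousAlternatingMap.compContinuousLinearMapCLM (scalarMap n c)

@[simp] lemma pullCLM_apply (c : ℂ) (φ : Form n m) : pullCLM c φ = pull c φ := rfl

lemma pull_pull (c d : ℂ) (φ : Form n m) : pull c (pull d φ) = pull (d * c) φ := by
  ext v; simp [pull_apply, mul_smul]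

lemma pull_one (φ : Form n m) : pull 1 φ = φ := by
  ext v; simp [pull_apply]

lemma pull_alternatizeUncurryFin (c : ℂ) (f : Cn n →L[ℝ] Form n m) :
    pull c (alternatizeUncurryFin f) =
      alternatizeUncurryFin ((pullCLM c).comp (f.comp (scalarMap n c))) := by
  ext v
  simp only [pull_apply, alternatizeUncurryFin_apply]
  rfl

lemma pull_wedgeCovector (c : ℂ) (l : Cn n →L[ℝ] ℝ) (β : Form n m) :
    pull c (wedgeCovector l β) = wedgeCovector (l.comp (scalarMap n c)) (pull c β) := by
  rw [wedgeCovector, pull_alternatizeUncurryFin, wedgeCovector]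
  congr 1

/-- The pullback of a bilinear map with values in forms. -/
def pullBilin (c : ℂ) (f : Cn n →L[ℝ] Cn n →L[ℝ] Form n m) : Cn n →L[ℝ] Cn n →L[ℝ] Form n m :=
  (ContinuousLinearMap.compL ℝ (Cn n) (Form n m) (Form n m) (pullCLM c)).comp
    (f.bilinearComp (scalarMap n c) (scalarMap n c))

@[simp] lemma pullBilin_apply (c : ℂ) (f : Cn n →L[ℝ] Cn n →L[ℝ] Form n m) (v w : Cn n) :
    pullBilin c f v w = pull c (f (c • v) (c • w)) := rfl

lemma pull_altTwo (c : ℂ) (f : Cn n →L[ℝ] Cn n →L[ℝ] Form n m) :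
    pull c (altTwo f) = altTwo (pullBilin c f) := by
  rw [altTwo_eq, pull_alternatizeUncurryFin, altTwo_eq]
  congr 1
  ext v : 1
  change pull c (alternatizeUncurryFin (f (c • v))) = alternatizeUncurryFin (pullBilin c f v)
  rw [pull_alternatizeUncurryFin]
  rfl

lemma complex_smul_eq (c : ℂ) (v : Cn n) : c • v = c.re • v + c.im • (Complex.I • v) := by
  ext i
  simp only [Pi.smul_apply, Pi.add_apply, smul_eq_mul, Complex.real_smul]
  conv_lhs => rw [← Complex.re_add_im c]
  ring

/-- With `c = a + ib`, the terms with factor `ab` are symmetric in `v, w` and die under alternation;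
the others recombine with the factor `a² + b² = 1`. -/
lemma altTwo_twist_rotate {c : ℂ} (hc : ‖c‖ = 1) {K : Cn n →L[ℝ] Cn n →L[ℝ] Form n m}
    (hK : ∀ v w, K v w = K w v) :
    altTwo ((twist K).bilinearComp (scalarMap n c) (scalarMap n c)) = altTwo (twist K) := by
  have hc' : c.re * c.re + c.im * c.im = 1 := by
    have := Complex.normSq_eq_norm_sq c
    rw [hc, Complex.normSq_apply] at this
    linarith
  refine altTwo_congr fun v w => ?_
  have e : ∀ v w : Cn n, (twist K).bilinearComp (scalarMap n c) (scalarMap n c) v w =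
      -(c.re * c.re) • K v (Complex.I • w) + (c.re * c.im) • K v w
        - (c.re * c.im) • K (Complex.I • v) (Complex.I • w)
        + (c.im * c.im) • K (Complex.I • v) w := by
    intro v w
    have hw : -Complex.I • c • w = -c.re • (Complex.I • w) + c.im • w := by
      ext i
      simp only [Pi.smul_apply, Pi.add_apply, smul_eq_mul, Complex.real_smul]
      conv_lhs => rw [← Complex.re_add_im c]
      push_cast
      linear_combination (- (c.im : ℂ) * w i) * Complex.I_mul_I
    change K (c • v) (-Complex.I • c • w) = _
    rw [hw, complex_smul_eq c v]
    simp only [map_add, map_smul, add_apply, smul_apply]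
    module
  have e' : ∀ v w : Cn n, twist K v w = - K v (Complex.I • w) := by
    intro v w; rw [twist_apply, neg_smul, map_neg]
  rw [e, e, e', e', hK w v, hK (Complex.I • w) (Complex.I • v), hK w (Complex.I • v),
    hK (Complex.I • w) v]
  have h1 : c.im * c.im = 1 - c.re * c.re := by linarith
  rw [h1]
  module

/-- Double alternatization of a twisted symmetric bilinear map commutes with rotations. -/
lemma pull_altTwo_twist {c : ℂ} (hc : ‖c‖ = 1) {K : Cn n →L[ℝ] Cn n →L[ℝ] Form n m}
    (hK : ∀ v w, K v w = K w v) :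
    pull c (altTwo (twist K)) =
      altTwo (twist ((ContinuousLinearMap.compL ℝ (Cn n) (Form n m) (Form n m) (pullCLM c)).comp K)) := by
  rw [pull_altTwo, ← altTwo_twist_rotate hc]
  · rfl
  · intro v w
    exact congrArg (pullCLM c) (hK v w)

/-- `dd^c w` has type `(1,1)`, so a rotation acts only on the other factor. -/
lemma pull_hessWedge {c : ℂ} (hc : ‖c‖ = 1) {H : Cn n →L[ℝ] Cn n →L[ℝ] ℝ}
    (hH : ∀ v w, H v w = H w v) (β : Form n m) :
    pull c (hessWedge H β) = hessWedge H (pull c β) := by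
  rw [hessWedge_apply, pull_altTwo_twist hc fun v w => by simp [hH v w], hessWedge_apply]
  congr 2

lemma altTwo_mul_eq (l k : Cn n →L[ℝ] ℝ) (β : Form n m) :
    altTwo (tensorForm (l.smulRight k) β) = wedgeCovector l (wedgeCovector k β) := by
  rw [altTwo_eq, wedgeCovector]
  congr 1
  ext v : 1
  change alternatizeUncurryFinCLM ℝ (Cn n) ℝ _ = l v • alternatizeUncurryFinCLM ℝ (Cn n) ℝ _
  rw [← map_smul]
  congr 1
  ext w : 1
  change (l v • k) w • β = l v • k w • β
  rw [smul_apply, smul_eq_mul, mul_smul]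

lemma wedgeCovector_comm (l k : Cn n →L[ℝ] ℝ) (β : Form n m) :
    wedgeCovector l (wedgeCovector k β) = -wedgeCovector k (wedgeCovector l β) := by
  rw [eq_neg_iff_add_eq_zero, ← altTwo_mul_eq, ← altTwo_mul_eq, ← map_add]
  refine altTwo_eq_zero_of_symmetric fun v w => ?_
  change (l v • k) w • β + (k v • l) w • β = (l w • k) v • β + (k w • l) v • β
  simp only [smul_apply, smul_eq_mul]
  module

/-- Exterior multiplication by a covector, as a linear map. -/
def wedgeCovectorLM : (Cn n →L[ℝ] ℝ) →L[ℝ] Form n m →L[ℝ] Form n (m + 1) :=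
  (ContinuousLinearMap.compL ℝ (Form n m) _ _ (alternatizeUncurryFinCLM ℝ (Cn n) ℝ)).comp
    (ContinuousLinearMap.smulRightL ℝ (Cn n) (Form n m))

lemma wedgeCovectorLM_apply (l : Cn n →L[ℝ] ℝ) (β : Form n m) :
    wedgeCovectorLM l β = wedgeCovector l β := rfl

/-- The covectors do not depend on the degree `m`, so the same decomposition serves on both sides of
a commutation identity. -/
lemma exists_hessWedge_eq_sum (H : Cn n →L[ℝ] Cn n →L[ℝ] ℝ) :
    ∃ (ι : Type) (_ : Fintype ι) (l k : ι → (Cn n →L[ℝ] ℝ)), ∀ (m : ℕ) (β : Form n m),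
      hessWedge H β = ∑ i, wedgeCovector (l i) (wedgeCovector (k i) β) := by
  let b := Module.finBasis ℝ (Cn n)
  refine ⟨Fin (Module.finrank ℝ (Cn n)), inferInstance,
    fun i => (b.coord i).toContinuousLinearMap, fun i => twist H (b i), fun m β => ?_⟩
  simp_rw [← altTwo_mul_eq]
  rw [← map_sum, hessWedge_apply]
  congr 1
  ext v w : 2
  rw [_root_.sum_apply, _root_.sum_apply]
  change H v (-Complex.I • w) • β = ∑ i, (b.coord i v * H (b i) (-Complex.I • w)) • β
  rw [← Finset.sum_smul]
  congr 1
  conv_lhs => rw [← b.sum_repr v, map_sum, _root_.sum_apply]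
  simp

/-- Two-forms commute: moving a pair of covectors past another pair costs four sign changes. -/
lemma hessWedge_comm (H K : Cn n →L[ℝ] Cn n →L[ℝ] ℝ) (β : Form n m) :
    hessWedge H (hessWedge K β) = hessWedge K (hessWedge H β) := by
  obtain ⟨ι, _, l, k, h⟩ := exists_hessWedge_eq_sum H
  obtain ⟨ι', _, l', k', h'⟩ := exists_hessWedge_eq_sum K
  simp only [h, h', ← wedgeCovectorLM_apply, map_sum]
  rw [Finset.sum_comm]
  refine Finset.sum_congr rfl fun i _ => Finset.sum_congr rfl fun j _ => ?_
  simp only [wedgeCovectorLM_apply]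
  rw [wedgeCovector_comm (k j) (l' i)]
  simp only [← wedgeCovectorLM_apply, map_neg]
  simp only [wedgeCovectorLM_apply]
  rw [wedgeCovector_comm (l j) (l' i), neg_neg, wedgeCovector_comm (k j) (k' i)]
  simp only [← wedgeCovectorLM_apply, map_neg]
  simp only [wedgeCovectorLM_apply]
  rw [wedgeCovector_comm (l j) (k' i)]
  simp only [← wedgeCovectorLM_apply, map_neg, neg_neg]

end FormAlgebra

/-! ### The operators `d`, `d^c` and `dd^c` on form-valued functions. -/

section FormCalculus

open ContinuousAlternatingMap hiding sub_apply add_apply smul_apply map_sum sum_apply neg_apply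

variable {n m : ℕ}

lemma extDeriv_smul_fun {w : Cn n → ℝ} {η : Cn n → Form n m} {x : Cn n}
    (hw : DifferentiableAt ℝ w x) (hη : DifferentiableAt ℝ η x) :
    extDeriv (fun y => w y • η y) x = wedgeCovector (fderiv ℝ w x) (η x) + w x • extDeriv η x := by
  rw [extDeriv, fderiv_fun_smul hw hη, alternatizeUncurryFin_add, alternatizeUncurryFin_smul]
  exact add_comm _ _

lemma extDeriv_wedgeCovector {l : Cn n → (Cn n →L[ℝ] ℝ)} {φ : Cn n → Form n m} {x : Cn n}
    (hl : DifferentiableAt ℝ l x) (hφ : DifferentiableAt ℝ φ x) :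
    extDeriv (fun y => wedgeCovector (l y) (φ y)) x =
      altTwo (tensorForm (fderiv ℝ l x) (φ x)) - wedgeCovector (l x) (extDeriv φ x) := by
  have h := (wedgeCovectorLM (n := n) (m := m)).hasFDerivAt_of_bilinear hl.hasFDerivAt
    hφ.hasFDerivAt
  have h1 : fderiv ℝ (fun y => wedgeCovector (l y) (φ y)) x =
      (alternatizeUncurryFinCLM ℝ (Cn n) ℝ).comp
        (((ContinuousLinearMap.smulRightL ℝ (Cn n) (Form n m)) (l x)).comp (fderiv ℝ φ x)) +
      (alternatizeUncurryFinCLM ℝ (Cn n) ℝ).comp (tensorForm (fderiv ℝ l x) (φ x)) := by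
    exact h.fderiv
  rw [extDeriv, h1, alternatizeUncurryFin_add, sub_eq_add_neg]
  refine (add_comm _ _).trans (congrArg₂ (· + ·) rfl ?_)
  set f : Cn n →L[ℝ] Cn n →L[ℝ] Form n m :=
    ((ContinuousLinearMap.smulRightL ℝ (Cn n) (Form n m)) (l x)).comp (fderiv ℝ φ x) with hf
  -- `l ∧ dφ` alternates the same bilinear map with its arguments exchanged, whence the minus sign
  -- in the Leibniz rule.
  have h2 : wedgeCovector (l x) (extDeriv φ x) = altTwo f.flip := by
    rw [altTwo_eq, wedgeCovector]
    congr 1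
    ext v : 1
    change l x v • alternatizeUncurryFinCLM ℝ (Cn n) ℝ (fderiv ℝ φ x) =
      alternatizeUncurryFinCLM ℝ (Cn n) ℝ (f.flip v)
    rw [← map_smul]
    rfl
  rw [h2, ← altTwo_eq, eq_neg_iff_add_eq_zero, ← map_add]
  refine altTwo_eq_zero_of_symmetric fun v w => ?_
  simp [add_comm]

lemma extDeriv_pull (c : ℂ) {φ : Cn n → Form n m} {x : Cn n} (hφ : DifferentiableAt ℝ φ x) :
    extDeriv (fun y => pull c (φ y)) x = alternatizeUncurryFin ((pullCLM c).comp (fderiv ℝ φ x)) := by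
  rw [extDeriv]
  congr 1
  exact ((pullCLM c).hasFDerivAt.comp x hφ.hasFDerivAt).fderiv

/-- The two actions of `J` cancel on the values of the form; only the direction of differentiation
is turned by `-i`. -/
lemma dc_eq {φ : Cn n → Form n m} {x : Cn n} (hφ : DifferentiableAt ℝ φ x) :
    dc φ x = alternatizeUncurryFin ((fderiv ℝ φ x).comp (scalarMap n (-Complex.I))) := by
  rw [dc, extDeriv_pull _ hφ, pull_alternatizeUncurryFin]
  congr 1
  ext v : 1
  change pull (-Complex.I) (pull Complex.I _) = _
  rw [pull_pull]
  simp [pull_one]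

lemma pull_I_dc {φ : Cn n → Form n m} {x : Cn n} :
    pull Complex.I (dc φ x) = extDeriv (fun y => pull Complex.I (φ y)) x := by
  rw [dc, pull_pull]
  simp [pull_one]

/-- Precomposition with the multiplication by `-i`. -/
def precompNegI {F : Type*} [NormedAddCommGroup F] [NormedSpace ℝ F] :
    (Cn n →L[ℝ] F) →L[ℝ] (Cn n →L[ℝ] F) :=
  (ContinuousLinearMap.compL ℝ (Cn n) (Cn n) F).flip (scalarMap n (-Complex.I))

/-- Puts `dd^c φ` in the same shape as `hessWedge`: the alternated twist of a symmetric second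
derivative. -/
lemma ddc_eq {φ : Cn n → Form n m} (hφ : ContDiff ℝ 2 φ) (x : Cn n) :
    ddc φ x = altTwo (twist (fderiv ℝ (fderiv ℝ φ) x)) := by
  have h0 : dc φ = fun y => (alternatizeUncurryFinCLM ℝ (Cn n) ℝ).comp precompNegI (fderiv ℝ φ y) :=
    funext fun y => dc_eq (hφ.differentiable two_ne_zero y)
  have h1 : DifferentiableAt ℝ (fderiv ℝ φ) x :=
    (hφ.fderiv_right (m := 1) le_rfl).differentiable one_ne_zero x
  rw [ddc, h0, extDeriv, altTwo_eq]
  congr 1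
  exact (((alternatizeUncurryFinCLM ℝ (Cn n) ℝ).comp precompNegI).hasFDerivAt.comp x
    h1.hasFDerivAt).fderiv

lemma snd_fderiv_symm {F : Type*} [NormedAddCommGroup F] [NormedSpace ℝ F] {φ : Cn n → F}
    (hφ : ContDiff ℝ 2 φ) (x v w : Cn n) :
    fderiv ℝ (fderiv ℝ φ) x v w = fderiv ℝ (fderiv ℝ φ) x w v :=
  (hφ.contDiffAt.isSymmSndFDerivAt (by simp)) v w

/-- `d^c d` and `dd^c` place the twist on different arguments of the symmetric second derivative;
the sum of the two is symmetric and has no alternating part. -/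
lemma dc_extDeriv {φ : Cn n → Form n m} (hφ : ContDiff ℝ 2 φ) (x : Cn n) :
    dc (extDeriv φ) x = -ddc φ x := by
  have h1 : DifferentiableAt ℝ (fderiv ℝ φ) x :=
    (hφ.fderiv_right (m := 1) le_rfl).differentiable one_ne_zero x
  have h2 : HasFDerivAt (extDeriv φ) ((alternatizeUncurryFinCLM ℝ (Cn n) ℝ).comp
      (fderiv ℝ (fderiv ℝ φ) x)) x :=
    (alternatizeUncurryFinCLM ℝ (Cn n) ℝ).hasFDerivAt.comp x h1.hasFDerivAt
  rw [dc_eq h2.differentiableAt, h2.fderiv, ddc_eq hφ]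
  have h3 : alternatizeUncurryFin (((alternatizeUncurryFinCLM ℝ (Cn n) ℝ).comp
      (fderiv ℝ (fderiv ℝ φ) x)).comp (scalarMap n (-Complex.I))) =
      altTwo ((fderiv ℝ (fderiv ℝ φ) x).comp (scalarMap n (-Complex.I))) := rfl
  rw [h3, eq_neg_iff_add_eq_zero, ← map_add]
  refine altTwo_eq_zero_of_symmetric fun v w => ?_
  change fderiv ℝ (fderiv ℝ φ) x (-Complex.I • v) w + fderiv ℝ (fderiv ℝ φ) x v (-Complex.I • w) =
    fderiv ℝ (fderiv ℝ φ) x (-Complex.I • w) v + fderiv ℝ (fderiv ℝ φ) x w (-Complex.I • v)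
  rw [snd_fderiv_symm hφ x w, snd_fderiv_symm hφ x _ v, add_comm]

/-- `dd^c d = -d d d^c = 0`. This is what makes `dd^c u ∧ T` closed. -/
lemma ddc_extDeriv {φ : Cn n → Form n m} (hφ : ContDiff ℝ 3 φ) (x : Cn n) :
    ddc (extDeriv φ) x = 0 := by
  have h2 : ContDiff ℝ 2 φ := hφ.of_le (by norm_num)
  have h1 : ContDiff ℝ 2 (dc φ) := by
    have : dc φ = fun y => (alternatizeUncurryFinCLM ℝ (Cn n) ℝ).comp precompNegI (fderiv ℝ φ y) :=
      funext fun y => dc_eq (h2.differentiable two_ne_zero y)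
    rw [this]
    exact (ContinuousLinearMap.contDiff _).comp (hφ.fderiv_right (by norm_num))
  have h0 : dc (extDeriv φ) = fun y => (-1 : ℝ) • extDeriv (dc φ) y := by
    funext y; rw [dc_extDeriv h2 y, neg_one_smul]; rfl
  rw [ddc, h0]
  change extDeriv ((-1 : ℝ) • extDeriv (dc φ)) x = 0
  rw [extDeriv_smul, extDeriv_extDeriv h1 (by simp)]
  simp

end FormCalculus

/-! ### Operators on test forms and integration by parts. -/

section TestForms

open ContinuousAlternatingMap hiding sub_apply add_apply smul_apply map_sum sum_apply neg_apply

variable {n m : ℕ} {Ω : TopologicalSpace.Opens (Cn n)}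

/-- A smooth map which vanishes where a test function vanishes is a test function. -/
def testOf {F F' : Type*} [NormedAddCommGroup F] [NormedSpace ℝ F] [NormedAddCommGroup F']
    [NormedSpace ℝ F'] (φ : 𝓓(Ω, F)) (f : Cn n → F') (hf : ContDiff ℝ (⊤ : ℕ∞) f)
    (h : ∀ x, φ x = 0 → f x = 0) : 𝓓(Ω, F') where
  toFun := f
  contDiff' := hf
  hasCompactSupport' := φ.hasCompactSupport.mono fun x hx hφ => hx (h x hφ)
  tsupport_subset' := (closure_mono (Function.support_subset_iff'.2 fun x hx =>
    h x (by simpa using hx))).trans φ.tsupport_subset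

@[simp] lemma testOf_apply {F F' : Type*} [NormedAddCommGroup F] [NormedSpace ℝ F]
    [NormedAddCommGroup F'] [NormedSpace ℝ F'] (φ : 𝓓(Ω, F)) (f : Cn n → F')
    (hf : ContDiff ℝ (⊤ : ℕ∞) f) (h : ∀ x, φ x = 0 → f x = 0) (x : Cn n) :
    testOf φ f hf h x = f x := rfl

/-- The exterior derivative of test forms. -/
def dTest : TestForm Ω m →L[ℝ] TestForm Ω (m + 1) :=
  (TestFunction.postcompCLM (alternatizeUncurryFinCLM ℝ (Cn n) ℝ)).comp
    (TestFunction.fderivCLM ℝ ⊤ ⊤)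

lemma dTest_apply (φ : TestForm Ω m) (x : Cn n) : dTest φ x = extDeriv φ x := by
  simp [dTest, extDeriv]

/-- The operator `d^c` on test forms. -/
def dcTest : TestForm Ω m →L[ℝ] TestForm Ω (m + 1) :=
  (TestFunction.postcompCLM ((alternatizeUncurryFinCLM ℝ (Cn n) ℝ).comp precompNegI)).comp
    (TestFunction.fderivCLM ℝ ⊤ ⊤)

lemma contDiff_nat {F : Type*} [NormedAddCommGroup F] [NormedSpace ℝ F] {f : Cn n → F}
    (hf : ContDiff ℝ (⊤ : ℕ∞) f) (k : ℕ) : ContDiff ℝ k f :=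
  hf.of_le (by exact_mod_cast le_top)

lemma contDiff_fderiv {F : Type*} [NormedAddCommGroup F] [NormedSpace ℝ F] {f : Cn n → F}
    (hf : ContDiff ℝ (⊤ : ℕ∞) f) : ContDiff ℝ (⊤ : ℕ∞) (fderiv ℝ f) :=
  hf.fderiv_right (by simp)

lemma differentiable_of_smooth {F : Type*} [NormedAddCommGroup F] [NormedSpace ℝ F] {f : Cn n → F}
    (hf : ContDiff ℝ (⊤ : ℕ∞) f) : Differentiable ℝ f :=
  (contDiff_nat hf 1).differentiable one_ne_zero

lemma dcTest_apply (φ : TestForm Ω m) (x : Cn n) : dcTest φ x = dc φ x := by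
  rw [dc_eq (differentiable_of_smooth φ.contDiff x)]
  simp [dcTest]
  rfl

/-- The operator `dd^c` on test forms. -/
def ddcTest : TestForm Ω m →L[ℝ] TestForm Ω (m + 2) :=
  (dTest (m := m + 1)).comp dcTest

lemma ddcTest_apply (φ : TestForm Ω m) (x : Cn n) : ddcTest φ x = ddc φ x := by
  have h : ⇑(dcTest φ) = dc φ := funext fun y => dcTest_apply φ y
  change dTest (dcTest φ) x = _
  rw [dTest_apply, h, ddc]

/-- The rotation of test forms. -/
def pullTest (c : ℂ) : TestForm Ω m →L[ℝ] TestForm Ω m := TestFunction.postcompCLM (pullCLM c)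

lemma pullTest_apply (c : ℂ) (φ : TestForm Ω m) (x : Cn n) : pullTest c φ x = pull c (φ x) := rfl

/-- The product of a smooth function and a test form. -/
def mulTest (w : Cn n → ℝ) (hw : ContDiff ℝ (⊤ : ℕ∞) w) (φ : TestForm Ω m) : TestForm Ω m :=
  testOf φ (fun x => w x • φ x) (hw.smul φ.contDiff) fun x hx => by simp [hx]

lemma mulTest_apply (w : Cn n → ℝ) (hw : ContDiff ℝ (⊤ : ℕ∞) w) (φ : TestForm Ω m) (x : Cn n) :
    mulTest w hw φ x = w x • φ x := rfl

/-- The real Hessian of a function. -/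
abbrev hess (w : Cn n → ℝ) (x : Cn n) : Cn n →L[ℝ] Cn n →L[ℝ] ℝ := fderiv ℝ (fderiv ℝ w) x

/-- The test form `dd^c w ∧ φ`, for a smooth function `w` and a test form `φ`. -/
def hessTest (w : Cn n → ℝ) (hw : ContDiff ℝ (⊤ : ℕ∞) w) (φ : TestForm Ω m) :
    TestForm Ω (m + 2) :=
  testOf φ (fun x => hessWedge (hess w x) (φ x))
    ((hessWedge.contDiff.comp (contDiff_fderiv (contDiff_fderiv hw))).clm_apply φ.contDiff) fun x hx => by simp [hx]

lemma hessTest_apply (w : Cn n → ℝ) (hw : ContDiff ℝ (⊤ : ℕ∞) w) (φ : TestForm Ω m) (x : Cn n) :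
    hessTest w hw φ x = hessWedge (hess w x) (φ x) := rfl

/-- The test form `l ∧ φ`, for a smooth field of covectors and a test form `φ`. -/
def wedgeTest (l : Cn n → (Cn n →L[ℝ] ℝ)) (hl : ContDiff ℝ (⊤ : ℕ∞) l) (φ : TestForm Ω m) :
    TestForm Ω (m + 1) :=
  testOf φ (fun x => wedgeCovectorLM (l x) (φ x))
    ((wedgeCovectorLM.contDiff.comp hl).clm_apply φ.contDiff)
    fun x hx => by simp [hx]

lemma wedgeTest_apply (l : Cn n → (Cn n →L[ℝ] ℝ)) (hl : ContDiff ℝ (⊤ : ℕ∞) l) (φ : TestForm Ω m)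
    (x : Cn n) : wedgeTest l hl φ x = wedgeCovector (l x) (φ x) := rfl

/-- Integration by parts: `T (w dd^c φ) = T (dd^c w ∧ φ)` for a closed functional on test
forms which is invariant under the complex structure. -/
lemma current_ddc_by_parts {T : TestForm Ω (m + 2) →ₗ[ℝ] ℝ} (hT : ∀ ψ : TestForm Ω (m + 1), T (dTest ψ) = 0)
    (hI : ∀ φ, T (pullTest Complex.I φ) = T φ) (w : Cn n → ℝ) (hw : ContDiff ℝ (⊤ : ℕ∞) w)
    (φ : TestForm Ω m) : T (mulTest w hw (ddcTest φ)) = T (hessTest w hw φ) := by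
  have hdw := contDiff_fderiv hw
  have hl : ContDiff ℝ (⊤ : ℕ∞) fun x => precompNegI (fderiv ℝ w x) :=
    (ContinuousLinearMap.contDiff _).comp hdw
  -- The exact forms `d(w d^c φ)` and `d(d^c w ∧ Jφ)` are killed by `T`. They leave the cross terms
  -- `dw ∧ d^c φ` and `-d^c w ∧ d(Jφ)`, and the action of `i`, under which `T` is invariant, carries
  -- the first to the second (`e3`).
  have e1 : dTest (mulTest w hw (dcTest φ)) =
      wedgeTest _ hdw (dcTest φ) + mulTest w hw (ddcTest φ) := by
    ext1 x
    have hdc : ⇑(dcTest φ) = dc φ := funext fun y => dcTest_apply φ y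
    rw [dTest_apply, add_apply, wedgeTest_apply, mulTest_apply, ddcTest_apply, ddc, ← hdc]
    exact extDeriv_smul_fun (differentiable_of_smooth hw x)
      (differentiable_of_smooth (dcTest φ).contDiff x)
  have e2 : ∀ φ : TestForm Ω m, dTest (wedgeTest _ hl φ) =
      hessTest w hw φ - wedgeTest _ hl (dTest φ) := by
    intro φ
    ext1 x
    rw [dTest_apply, sub_apply, wedgeTest_apply, hessTest_apply, dTest_apply, hessWedge_apply]
    have := extDeriv_wedgeCovector (differentiable_of_smooth hl x)
      (differentiable_of_smooth φ.contDiff x)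
    have h3 : fderiv ℝ (fun x => precompNegI (fderiv ℝ w x)) x = twist (hess w x) :=
      ((precompNegI (n := n) (F := ℝ)).hasFDerivAt.comp x (differentiable_of_smooth hdw x).hasFDerivAt).fderiv
    rw [h3] at this
    exact this
  have e3 : pullTest Complex.I (wedgeTest _ hdw (dcTest φ)) =
      -wedgeTest _ hl (dTest (pullTest Complex.I φ)) := by
    ext1 x
    rw [pullTest_apply, wedgeTest_apply, neg_apply, wedgeTest_apply, pull_wedgeCovector,
      dTest_apply, dcTest_apply, pull_I_dc, ← wedgeCovectorLM_apply, ← wedgeCovectorLM_apply,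
      ← _root_.neg_apply, ← map_neg]
    congr 2
    ext v
    simp [precompNegI]
  have e4 : hessTest w hw (pullTest Complex.I φ) = pullTest Complex.I (hessTest w hw φ) := by
    ext1 x
    rw [hessTest_apply, pullTest_apply, pullTest_apply, hessTest_apply, pull_hessWedge (by simp)]
    exact snd_fderiv_symm (contDiff_nat hw 2) x
  have f1 := hT (mulTest w hw (dcTest φ))
  rw [e1, map_add, ← hI, e3, map_neg] at f1
  have f2 := hT (wedgeTest _ hl (pullTest Complex.I φ))
  rw [e2, map_sub, e4, hI] at f2
  linarith

end TestForms

/-! ### Positive forms, Levi forms and powers of `ω`. -/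

section PositiveForms

open ContinuousAlternatingMap hiding sub_apply add_apply smul_apply map_sum sum_apply neg_apply

open scoped ComplexOrder MatrixOrder Matrix.Norms.L2Operator

variable {n m p : ℕ}

lemma wedgeOne_apply (l : Fin m → (Cn n →L[ℝ] ℝ)) (v : Fin m → Cn n) :
    wedgeOne l v = Matrix.det (Matrix.of fun i j => l j (v i)) := rfl

/-- Laplace expansion of the determinant along its first column. -/
lemma wedgeCovector_wedgeOne (l : Cn n →L[ℝ] ℝ) (k : Fin m → (Cn n →L[ℝ] ℝ)) :
    wedgeCovector l (wedgeOne k) = wedgeOne (Fin.cons l k : Fin (m + 1) → (Cn n →L[ℝ] ℝ)) := by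
  ext v
  rw [wedgeCovector, alternatizeUncurryFin_apply, wedgeOne_apply, Matrix.det_succ_column_zero]
  refine Finset.sum_congr rfl fun i _ => ?_
  simp only [ContinuousLinearMap.smulRight_apply, Matrix.of_apply, Fin.cons_zero]
  rw [ContinuousAlternatingMap.smul_apply, wedgeOne_apply, zsmul_eq_mul, smul_eq_mul, mul_assoc]
  push_cast
  rfl

/-- The real part of a complex linear form. -/
def rePart (α : Cn n →L[ℂ] ℂ) : Cn n →L[ℝ] ℝ := Complex.reCLM.comp (α.restrictScalars ℝ)

/-- The imaginary part of a complex linear form. -/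
def imPart (α : Cn n →L[ℂ] ℂ) : Cn n →L[ℝ] ℝ := Complex.imCLM.comp (α.restrictScalars ℝ)

@[simp] lemma rePart_apply (α : Cn n →L[ℂ] ℂ) (v : Cn n) : rePart α v = (α v).re := rfl
@[simp] lemma imPart_apply (α : Cn n →L[ℂ] ℂ) (v : Cn n) : imPart α v = (α v).im := rfl

/-- The recursion that allows induction on `p` for elementary forms. -/
lemma elementaryForm_cons (a : Cn n →L[ℂ] ℂ) (α : Fin p → (Cn n →L[ℂ] ℂ)) :
    elementaryForm (Fin.cons a α : Fin (p + 1) → (Cn n →L[ℂ] ℂ)) =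
      wedgeCovector (rePart a) (wedgeCovector (imPart a) (elementaryForm α)) := by
  rw [elementaryForm, elementaryForm, wedgeCovector_wedgeOne]
  refine Eq.trans ?_ (wedgeCovector_wedgeOne (rePart a) _).symm
  congr 1
  funext k
  refine Fin.cases ?_ (fun k => ?_) k
  · have h0 : ((0 : Fin (2 * p + 1 + 1)) : ℕ) % 2 = 0 := rfl
    have h1 : ∀ h, (⟨((0 : Fin (2 * p + 1 + 1)) : ℕ) / 2, h⟩ : Fin (p + 1)) = 0 :=
      fun _ => Fin.ext (show ((0 : Fin (2 * p + 1 + 1)) : ℕ) / 2 = 0 by simp)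
    refine (if_pos h0).trans ?_
    rw [h1, Fin.cons_zero, Fin.cons_zero]
    rfl
  · refine Fin.cases ?_ (fun k => ?_) k
    · have h0 : ¬ ((Fin.succ 0 : Fin (2 * p + 1 + 1)) : ℕ) % 2 = 0 := by
        change ¬ (1 : ℕ) % 2 = 0
        decide
      have h1 : ∀ h, (⟨((Fin.succ 0 : Fin (2 * p + 1 + 1)) : ℕ) / 2, h⟩ : Fin (p + 1)) = 0 :=
        fun _ => Fin.ext (show ((Fin.succ 0 : Fin (2 * p + 1 + 1)) : ℕ) / 2 = 0 by
          change (1 : ℕ) / 2 = 0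
          decide)
      refine (if_neg h0).trans ?_
      rw [h1, Fin.cons_zero, Fin.cons_succ, Fin.cons_zero]
      rfl
    · have hk : (k : ℕ) < 2 * p := k.2
      have h0 : ((k.succ.succ : Fin (2 * p + 1 + 1)) : ℕ) = (k : ℕ) + 2 := rfl
      have h1 : ((k.succ.succ : Fin (2 * p + 1 + 1)) : ℕ) % 2 = (k : ℕ) % 2 := by omega
      have h2 : ((k.succ.succ : Fin (2 * p + 1 + 1)) : ℕ) / 2 = (k : ℕ) / 2 + 1 := by omega
      have h3 : (Fin.cons a α : Fin (p + 1) → (Cn n →L[ℂ] ℂ))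
          ⟨((k.succ.succ : Fin (2 * p + 1 + 1)) : ℕ) / 2, by omega⟩ =
          α ⟨(k : ℕ) / 2, by omega⟩ := by
        have : (⟨((k.succ.succ : Fin (2 * p + 1 + 1)) : ℕ) / 2, by omega⟩ : Fin (p + 1)) =
            Fin.succ ⟨(k : ℕ) / 2, by omega⟩ := Fin.ext h2
        rw [this, Fin.cons_succ]
      simp only [Fin.cons_succ]
      rw [h3]
      simp only [h1]

/-- The symmetric bilinear form `Re (α (v) conj (α (w)))`. -/
def leviForm (α : Cn n →L[ℂ] ℂ) : Cn n →L[ℝ] Cn n →L[ℝ] ℝ :=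
  (rePart α).smulRight (rePart α) + (imPart α).smulRight (imPart α)

lemma leviForm_apply (α : Cn n →L[ℂ] ℂ) (v w : Cn n) :
    leviForm α v w = (α v).re * (α w).re + (α v).im * (α w).im := by
  simp [leviForm]

/-- The function `|α|²/2` has Hessian `leviForm α`, and `dd^c` of it is `i α ∧ ᾱ = 2 Re α ∧ Im α`.
-/
lemma hessWedge_leviForm (α : Cn n →L[ℂ] ℂ) (β : Form n m) :
    hessWedge (leviForm α) β = (2 : ℝ) • wedgeCovector (rePart α) (wedgeCovector (imPart α) β) := by
  rw [hessWedge_apply, ← altTwo_mul_eq, ← map_smul]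
  refine altTwo_congr fun v w => ?_
  simp only [twist_apply, tensorForm_apply, leviForm_apply, smul_apply,
    ContinuousLinearMap.smulRight_apply, rePart_apply, imPart_apply, map_smul, smul_eq_mul,
    Complex.mul_re, Complex.mul_im, Complex.neg_re, Complex.neg_im, Complex.I_re, Complex.I_im]
  module

/-- The Levi form of a bilinear form is nonnegative. -/
def LeviNonneg (H : Cn n →L[ℝ] Cn n →L[ℝ] ℝ) : Prop :=
  ∀ v, 0 ≤ H v v + H (Complex.I • v) (Complex.I • v)

lemma I_smul_I_smul (v : Cn n) : Complex.I • Complex.I • v = -v := by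
  rw [smul_smul, Complex.I_mul_I, neg_one_smul]

/-- `dd^c` sees only the Levi form. If that vanishes, polarization gives `D (v, w) = -D (iv, iw)`,
so the twist of `D` is symmetric and alternates to zero. -/
lemma hessWedge_eq_zero_of_levi {D : Cn n →L[ℝ] Cn n →L[ℝ] ℝ} (hD : ∀ v w, D v w = D w v)
    (h : ∀ v, D v v + D (Complex.I • v) (Complex.I • v) = 0) (β : Form n m) :
    hessWedge D β = 0 := by
  have h' : ∀ v w, D v w + D (Complex.I • v) (Complex.I • w) = 0 := by
    intro v w
    have := h (v + w)
    rw [smul_add] at this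
    simp only [map_add, add_apply] at this
    linarith [h v, h w, hD v w, hD (Complex.I • v) (Complex.I • w)]
  rw [hessWedge_apply]
  refine altTwo_eq_zero_of_symmetric fun v w => ?_
  simp only [twist_apply, tensorForm_apply, neg_smul, map_neg]
  have h1 := h' v (Complex.I • w)
  rw [I_smul_I_smul, map_neg, hD _ w] at h1
  congr 2
  linarith

/-- A positive semidefinite Hermitian form is a sum of squared moduli of linear forms. -/
lemma exists_levi_eq_sum_sq {H : Cn n →L[ℝ] Cn n →L[ℝ] ℝ} (hH : ∀ v w, H v w = H w v)
    (hL : LeviNonneg H) : ∃ α : Fin n → (Cn n →L[ℂ] ℂ),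
      ∀ v, H v v + H (Complex.I • v) (Complex.I • v) = ∑ j, Complex.normSq (α j v) := by
  set S : Cn n → Cn n → ℝ := fun v w => H v w + H (Complex.I • v) (Complex.I • w) with hS
  have Ssymm : ∀ v w, S v w = S w v := fun v w => by simp only [hS, hH v, hH (Complex.I • v)]
  have SI : ∀ v w, S (Complex.I • v) w = - S v (Complex.I • w) := fun v w => by
    simp only [hS, I_smul_I_smul, map_neg, neg_apply]; ring
  have Sadd : ∀ u v w, S (u + v) w = S u w + S v w := fun u v w => by
    simp only [hS, smul_add, map_add, add_apply]; ring
  have Ssmul : ∀ (a : ℝ) v w, S (a • v) w = a * S v w := fun a v w => by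
    simp only [hS, smul_comm _ a, map_smul, smul_apply, smul_eq_mul]; ring
  -- `Q` is the Hermitian form with real part `S`, complex linear in its first variable.
  let Q : Cn n → Cn n → ℂ := fun v w => (S v w : ℂ) - Complex.I * (S (Complex.I • v) w : ℂ)
  have Qadd : ∀ u v w, Q (u + v) w = Q u w + Q v w := fun u v w => by
    simp only [Q, smul_add, Sadd]; push_cast; ring
  have Qsmul : ∀ (a : ℂ) v w, Q (a • v) w = a * Q v w := fun a v w => by
    simp only [Q]
    rw [complex_smul_eq a v, smul_add, smul_comm _ a.re, smul_comm _ a.im, I_smul_I_smul, smul_neg,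
      ← neg_smul]
    simp only [Sadd, Ssmul]
    conv_rhs => rw [← Complex.re_add_im a]
    push_cast
    linear_combination (a.im * S (Complex.I • v) w : ℂ) * Complex.I_mul_I
  have Qconj : ∀ v w, Q w v = star (Q v w) := fun v w => by
    simp only [Q]
    rw [Ssymm w v, Ssymm (Complex.I • w) v, SI v w]
    simp [sub_eq_add_neg]
  have Qdiag : ∀ v, Q v v = (S v v : ℂ) := fun v => by
    have : S (Complex.I • v) v = 0 := by have := SI v v; rw [Ssymm v] at this; linarith
    simp [Q, this]
  let M : Matrix (Fin n) (Fin n) ℂ := Matrix.of fun k l => Q (Pi.single l 1) (Pi.single k 1)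
  have Qexp1 : ∀ v w, Q v w = ∑ l, v l * Q (Pi.single l 1) w := by
    intro v w
    let f : Cn n →ₗ[ℂ] ℂ := ⟨⟨fun v => Q v w, fun a b => Qadd a b w⟩, fun a b => Qsmul a b w⟩
    have := LinearMap.pi_apply_eq_sum_univ f v
    have e : ∀ l, (Pi.single l 1 : Cn n) = fun j => if l = j then 1 else 0 := fun l => by
      funext j; simp [Pi.single_apply, eq_comm]
    simp only [e]
    exact this
  have Qexp : ∀ v, star v ⬝ᵥ M.mulVec v = Q v v := by
    intro v
    rw [Qconj, Qexp1 v]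
    rw [star_sum]
    refine Finset.sum_congr rfl fun k _ => ?_
    rw [star_mul', ← Qconj, Qexp1]
    simp only [Matrix.mulVec, dotProduct, M, Matrix.of_apply, Pi.star_apply]
    congr 1
    exact Finset.sum_congr rfl fun l _ => mul_comm _ _
  have hM : M.PosSemidef := by
    refine Matrix.PosSemidef.of_dotProduct_mulVec_nonneg ?_ fun v => ?_
    · ext k l
      simp only [Matrix.conjTranspose_apply, M, Matrix.of_apply]
      rw [← Qconj]
    · rw [Qexp, Qdiag]
      exact_mod_cast hL v
  -- The rows of a matrix `B` with `M = B* B` are the required linear forms.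
  obtain ⟨B, hB⟩ := CStarAlgebra.nonneg_iff_eq_star_mul_self.mp hM.nonneg
  refine ⟨fun j => ∑ l, B j l • (ContinuousLinearMap.proj l : Cn n →L[ℂ] ℂ), fun v => ?_⟩
  have h1 : (S v v : ℂ) = ∑ j, (Complex.normSq (B.mulVec v j) : ℂ) := by
    rw [← Qdiag, ← Qexp, hB, ← Matrix.mulVec_mulVec, Matrix.dotProduct_mulVec,
      Matrix.star_eq_conjTranspose, Matrix.vecMul_conjTranspose, star_star]
    refine Finset.sum_congr rfl fun j _ => ?_
    rw [Complex.normSq_eq_conj_mul_self]; rfl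
  have h2 : S v v = ∑ j, Complex.normSq (B.mulVec v j) := by exact_mod_cast h1
  change S v v = _
  rw [h2]
  refine Finset.sum_congr rfl fun j _ => ?_
  congr 1
  rw [_root_.sum_apply]
  rfl

lemma hessWedge_eq_sum_of_leviNonneg {H : Cn n →L[ℝ] Cn n →L[ℝ] ℝ} (hH : ∀ v w, H v w = H w v)
    (hL : LeviNonneg H) : ∃ α : Fin n → (Cn n →L[ℂ] ℂ), ∀ (m : ℕ) (β : Form n m),
      hessWedge H β = ∑ j, wedgeCovector (rePart (α j)) (wedgeCovector (imPart (α j)) β) := by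
  obtain ⟨α, hα⟩ := exists_levi_eq_sum_sq hH hL
  refine ⟨α, fun m β => ?_⟩
  -- The factor `1/2` appears because `leviForm α` takes the value `|α v|²` both at `v` and at `iv`;
  -- it later cancels the `2` of `hessWedge_leviForm`.
  have h1 : hessWedge (H - (1 / 2 : ℝ) • ∑ j, leviForm (α j)) β = 0 := by
    refine hessWedge_eq_zero_of_levi (fun v w => ?_) (fun v => ?_) β
    · simp only [sub_apply, smul_apply, _root_.sum_apply, hH v w]
      congr 2
      exact Finset.sum_congr rfl fun j _ => by rw [leviForm_apply, leviForm_apply]; ring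
    · have := hα v
      simp only [sub_apply, smul_apply, _root_.sum_apply, leviForm_apply, map_smul, smul_eq_mul,
        Complex.mul_re, Complex.mul_im, Complex.I_re, Complex.I_im]
      simp only [Complex.normSq_apply] at this
      rw [sub_add_sub_comm, this, ← mul_add, ← Finset.sum_add_distrib, Finset.mul_sum,
        ← Finset.sum_sub_distrib]
      exact Finset.sum_eq_zero fun j _ => by ring
  rw [map_sub, sub_apply, map_smul, smul_apply, map_sum, _root_.sum_apply, sub_eq_zero] at h1
  rw [h1, Finset.smul_sum]
  refine Finset.sum_congr rfl fun j _ => ?_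
  rw [hessWedge_leviForm, smul_smul]
  norm_num

/-- A real linear functional on forms which is nonnegative on elementary forms. -/
def IsPosFunctional (t : Form n (2 * p) →ₗ[ℝ] ℝ) : Prop :=
  ∀ α : Fin p → (Cn n →L[ℂ] ℂ), 0 ≤ t (elementaryForm α)

/-- A form in the closed cone generated by elementary forms. -/
def IsPosForm (β : Form n (2 * p)) : Prop :=
  ∀ t : Form n (2 * p) →ₗ[ℝ] ℝ, IsPosFunctional t → 0 ≤ t β

lemma isPosForm_elementaryForm (α : Fin p → (Cn n →L[ℂ] ℂ)) : IsPosForm (elementaryForm α) :=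
  fun _ ht => ht α

/-- By duality: `dd^c w ∧` maps an elementary form to a sum of elementary forms, so composing with
it keeps a functional positive. -/
lemma IsPosForm.hessWedge {H : Cn n →L[ℝ] Cn n →L[ℝ] ℝ} (hH : ∀ v w, H v w = H w v)
    (hL : LeviNonneg H) {β : Form n (2 * p)} (hβ : IsPosForm β) :
    IsPosForm (p := p + 1) (hessWedge H β) := by
  obtain ⟨a, ha⟩ := hessWedge_eq_sum_of_leviNonneg hH hL
  intro t ht
  refine hβ (t.comp (Pluri.hessWedge H).toLinearMap) fun α => ?_
  change 0 ≤ t (Pluri.hessWedge H (elementaryForm α))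
  rw [ha, map_sum]
  refine Finset.sum_nonneg fun j _ => ?_
  rw [← elementaryForm_cons]
  exact ht _

lemma IsPosForm.smul {β : Form n (2 * p)} (hβ : IsPosForm β) {a : ℝ} (ha : 0 ≤ a) :
    IsPosForm (a • β) := fun t ht => by rw [map_smul]; exact mul_nonneg ha (hβ t ht)

/-- The function `|z|²`. -/
def sqNorm (z : Cn n) : ℝ := ∑ j, Complex.normSq (z j)

lemma sqNorm_eq : (sqNorm : Cn n → ℝ) = fun z =>
    ∑ j, (rePart (ContinuousLinearMap.proj j : Cn n →L[ℂ] ℂ) z ^ 2 +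
      imPart (ContinuousLinearMap.proj j : Cn n →L[ℂ] ℂ) z ^ 2) := by
  funext z
  exact Finset.sum_congr rfl fun j _ => by rw [Complex.normSq_apply]; simp [sq]

lemma contDiff_sqNorm : ContDiff ℝ (⊤ : ℕ∞) (sqNorm : Cn n → ℝ) := by
  rw [sqNorm_eq]
  fun_prop

lemma hess_sq (l : Cn n →L[ℝ] ℝ) (x : Cn n) :
    fderiv ℝ (fderiv ℝ fun z => l z ^ 2) x = (2 : ℝ) • l.smulRight l := by
  have h1 : (fderiv ℝ fun z => l z ^ 2) = fun z => ((2 : ℝ) • l.smulRight l) z := by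
    funext z
    have := (l.hasFDerivAt (x := z)).pow 2
    rw [this.fderiv]
    ext v
    simp [mul_assoc]
  rw [h1]
  exact ContinuousLinearMap.fderiv _

lemma hess_sqNorm (x : Cn n) :
    hess sqNorm x = (2 : ℝ) • ∑ j, leviForm (ContinuousLinearMap.proj j : Cn n →L[ℂ] ℂ) := by
  have d : ∀ (l : Cn n →L[ℝ] ℝ), Differentiable ℝ fun z => l z ^ 2 := fun l => by fun_prop
  have dd : ∀ (l : Cn n →L[ℝ] ℝ), Differentiable ℝ (fderiv ℝ fun z => l z ^ 2) := fun l =>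
    differentiable_of_smooth (contDiff_fderiv (by fun_prop))
  have h1 : fderiv ℝ (sqNorm : Cn n → ℝ) = fun z =>
    ∑ j, (fderiv ℝ (fun z => rePart (ContinuousLinearMap.proj j : Cn n →L[ℂ] ℂ) z ^ 2) z +
      fderiv ℝ (fun z => imPart (ContinuousLinearMap.proj j : Cn n →L[ℂ] ℂ) z ^ 2) z) := by
    funext z
    rw [sqNorm_eq, fderiv_fun_sum fun j _ => (d _ z).fun_add (d _ z)]
    exact Finset.sum_congr rfl fun j _ => fderiv_fun_add (d _ z) (d _ z)
  rw [hess, h1, fderiv_fun_sum fun j _ => (dd _ x).fun_add (dd _ x), Finset.smul_sum]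
  refine Finset.sum_congr rfl fun j _ => ?_
  rw [fderiv_fun_add (dd _ x) (dd _ x), hess_sq, hess_sq, leviForm, smul_add]

/-- This is `ω ∧ ω^q`. The constant `4` is the `2` in the Hessian of `|z|²` times the `2` of
`hessWedge_leviForm`. -/
lemma hessWedge_sqNorm_omegaPow (q : ℕ) (x : Cn n) :
    hessWedge (hess sqNorm x) (omegaPow n q) = omegaPow n (q + 1) := by
  have h : ∀ β : Form n (2 * q), hessWedge (hess sqNorm x) β = ∑ j, (4 : ℝ) •
      wedgeCovector (rePart (ContinuousLinearMap.proj j : Cn n →L[ℂ] ℂ))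
        (wedgeCovector (imPart (ContinuousLinearMap.proj j : Cn n →L[ℂ] ℂ)) β) := by
    intro β
    rw [hess_sqNorm, map_smul, smul_apply, map_sum, _root_.sum_apply, Finset.smul_sum]
    refine Finset.sum_congr rfl fun j _ => ?_
    rw [hessWedge_leviForm, smul_smul]
    norm_num
  rw [omegaPow, map_sum, omegaPow]
  simp only [map_smul]
  simp only [h, Finset.smul_sum, smul_smul]
  rw [← (Fin.consEquiv fun _ : Fin (q + 1) => Fin n).sum_comp, Fintype.sum_prod_type,
    Finset.sum_comm]
  refine Finset.sum_congr rfl fun j _ => Finset.sum_congr rfl fun I _ => ?_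
  rw [← elementaryForm_cons, pow_succ]
  congr 2
  funext k
  refine Fin.cases ?_ (fun k => ?_) k <;> simp [Fin.consEquiv]

lemma leviNonneg_sqNorm (x : Cn n) : LeviNonneg (hess sqNorm x) := by
  intro v
  rw [hess_sqNorm]
  simp only [smul_apply, _root_.sum_apply, leviForm_apply, smul_eq_mul]
  have := fun w : Cn n => Finset.sum_nonneg fun j (_ : j ∈ Finset.univ) =>
    add_nonneg (mul_self_nonneg (w j).re) (mul_self_nonneg (w j).im)
  exact add_nonneg (mul_nonneg zero_le_two (this v))
    (mul_nonneg zero_le_two (this (Complex.I • v)))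

end PositiveForms

/-! ### Elementary forms determine the rotation-invariant functionals. -/

section Spanning

open ContinuousAlternatingMap hiding sub_apply add_apply smul_apply map_sum sum_apply neg_apply

variable {n m p : ℕ}

/-- The sum runs over all multi-indices, not only increasing ones, so each basis form is counted
`m!` times. -/
lemma factorial_smul_eq_sum_wedgeOne {ι : Type*} [Fintype ι] (b : Module.Basis ι ℝ (Cn n))
    (β : Form n m) :
    (m.factorial : ℝ) • β = ∑ I : Fin m → ι, β (fun j => b (I j)) •
      wedgeOne fun j => (b.coord (I j)).toContinuousLinearMap := by
  classical
  ext v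
  have h1 : ∀ σ : Equiv.Perm (Fin m), β (fun j => v (σ j)) =
      ∑ I : Fin m → ι, (∏ j, b.coord (I j) (v (σ j))) * β fun j => b (I j) := by
    intro σ
    have e : (fun j => v (σ j)) = fun j => ∑ k, b.coord k (v (σ j)) • b k := by
      funext j; exact (b.sum_repr (v (σ j))).symm
    rw [e, ContinuousAlternatingMap.map_sum]
    refine Finset.sum_congr rfl fun I _ => ?_
    have := β.toMultilinearMap.map_smul_univ (fun j => b.coord (I j) (v (σ j))) fun j => b (I j)
    exact this
  have h2 : ∀ σ : Equiv.Perm (Fin m), (Equiv.Perm.sign σ : ℤ) • β (fun j => v (σ j)) = β v := by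
    intro σ
    have : β (fun j => v (σ j)) = Equiv.Perm.sign σ • β v := β.toAlternatingMap.map_perm v σ
    rw [this]
    simp only [Units.smul_def, smul_smul, ← Units.val_mul, Int.units_mul_self, Units.val_one,
      one_smul]
  have h3 : (m.factorial : ℝ) * β v = ∑ σ : Equiv.Perm (Fin m),
      (Equiv.Perm.sign σ : ℤ) • β (fun j => v (σ j)) := by
    simp only [h2, Finset.sum_const, Finset.card_univ, Fintype.card_perm, Fintype.card_fin,
      nsmul_eq_mul]
  rw [ContinuousAlternatingMap.smul_apply, smul_eq_mul, h3, ContinuousAlternatingMap.sum_apply]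
  simp only [h1, ContinuousAlternatingMap.smul_apply, wedgeOne_apply, Matrix.det_apply,
    Finset.smul_sum]
  rw [Finset.sum_comm]
  refine Finset.sum_congr rfl fun I _ => Finset.sum_congr rfl fun σ _ => ?_
  simp only [Units.smul_def, zsmul_eq_mul, smul_eq_mul, Matrix.of_apply,
    LinearMap.coe_toContinuousLinearMap']
  ring

lemma linearMap_eq_zero_of_wedgeOne {t : Form n m →ₗ[ℝ] ℝ}
    (h : ∀ l : Fin m → (Cn n →L[ℝ] ℝ), t (wedgeOne l) = 0) : t = 0 := by
  ext β
  have h' : (m.factorial : ℝ) • t β = 0 := by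
    rw [← map_smul, factorial_smul_eq_sum_wedgeOne (Module.finBasis ℝ (Cn n)) β, map_sum]
    exact Finset.sum_eq_zero fun I _ => by rw [map_smul, h, smul_zero]
  exact (smul_eq_zero.1 h').resolve_left (by exact_mod_cast m.factorial_ne_zero)

lemma exists_rePart_eq (l : Cn n →L[ℝ] ℝ) : ∃ α : Cn n →L[ℂ] ℂ, rePart α = l := by
  let α : Cn n →ₗ[ℂ] ℂ :=
    { toFun := fun v => (l v : ℂ) - Complex.I * (l (Complex.I • v) : ℂ)
      map_add' := fun v w => by simp only [smul_add, map_add]; push_cast; ring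
      map_smul' := fun c v => by
        rw [complex_smul_eq c v, smul_add, smul_comm _ c.re, smul_comm _ c.im, I_smul_I_smul,
          smul_neg]
        simp only [map_add, map_smul, map_neg, smul_eq_mul, RingHom.id_apply]
        conv_rhs => rw [← Complex.re_add_im c]
        push_cast
        linear_combination (c.im * l (Complex.I • v) : ℂ) * Complex.I_mul_I }
  refine ⟨LinearMap.toContinuousLinearMap α, ?_⟩
  ext v
  simp [α]

/-- The functional can move complex factors between the first two covectors. -/
def MovesScalars (t : Form n (m + 2) →ₗ[ℝ] ℝ) : Prop :=
  ∀ (c : ℂ) (a b : Cn n →L[ℂ] ℂ) (β : Form n m),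
    t (wedgeCovector (rePart a) (wedgeCovector (rePart (c • b)) β)) =
      t (wedgeCovector (rePart (c • a)) (wedgeCovector (rePart b) β))

lemma wedgeCovector_comm_three (x a b : Cn n →L[ℝ] ℝ) (β : Form n m) :
    wedgeCovector x (wedgeCovector a (wedgeCovector b β)) =
      wedgeCovector a (wedgeCovector b (wedgeCovector x β)) := by
  rw [wedgeCovector_comm x a, wedgeCovector_comm x b, ← wedgeCovectorLM_apply a, map_neg, neg_neg]
  rfl

/-- The scalars `c` are collected on `a` one covector at a time. In the induction `x 0` is absorbed
into the functional, which still moves scalars because a covector passes a pair of covectors without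
a sign. -/
lemma MovesScalars.pow {c : ℂ} : ∀ {m : ℕ} {t : Form n (m + 2) →ₗ[ℝ] ℝ}, MovesScalars t →
    ∀ (a : Cn n →L[ℂ] ℂ) (x : Fin (m + 1) → (Cn n →L[ℂ] ℂ)),
      t (wedgeCovector (rePart a) (wedgeOne fun i => rePart (c • x i))) =
        t (wedgeCovector (rePart (c ^ (m + 1) • a)) (wedgeOne fun i => rePart (x i))) := by
  have hcons : ∀ (m : ℕ) (c : ℂ) (x : Fin (m + 1) → (Cn n →L[ℂ] ℂ)),
      wedgeOne (fun i => rePart (c • x i)) =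
        wedgeCovector (rePart (c • x 0)) (wedgeOne fun i => rePart (c • x (Fin.succ i))) := by
    intro m c x
    rw [wedgeCovector_wedgeOne]
    congr 1
    funext i
    refine Fin.cases ?_ (fun i => ?_) i <;> simp
  have hcons' : ∀ (m : ℕ) (x : Fin (m + 1) → (Cn n →L[ℂ] ℂ)), wedgeOne (fun i => rePart (x i)) =
        wedgeCovector (rePart (x 0)) (wedgeOne fun i => rePart (x (Fin.succ i))) := by
    intro m x
    simpa using hcons m 1 x
  intro m
  induction m with
  | zero =>
    intro t ht a x
    have h0 : ∀ l l' : Fin 0 → (Cn n →L[ℝ] ℝ), wedgeOne l = wedgeOne l' := fun l l' => by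
      rw [Subsingleton.elim l l']
    rw [hcons, hcons', ht]
    simp only [zero_add, pow_one]
    rw [h0 (fun i => rePart (c • x (Fin.succ i))) fun i => rePart (x (Fin.succ i))]
  | succ m ih =>
    intro t ht a x
    let t' : Form n (m + 2) →ₗ[ℝ] ℝ := t.comp (wedgeCovectorLM (rePart (x 0))).toLinearMap
    have ht' : MovesScalars t' := by
      intro c a b β
      change t (wedgeCovector _ (wedgeCovector _ (wedgeCovector _ _))) =
        t (wedgeCovector _ (wedgeCovector _ (wedgeCovector _ _)))
      rw [wedgeCovector_comm_three, ht, ← wedgeCovector_comm_three]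
    have h1 := ih ht' (c • a) fun i => x (Fin.succ i)
    rw [hcons (m + 1), ht, wedgeCovector_comm, map_neg]
    rw [hcons' (m + 1), wedgeCovector_comm (rePart (c ^ (m + 1 + 1) • a)), map_neg, pow_succ,
      mul_smul]
    exact congrArg Neg.neg h1

lemma leviForm_smul {d : ℂ} (hd : ‖d‖ = 1) (a : Cn n →L[ℂ] ℂ) : leviForm (d • a) = leviForm a := by
  have hd' : d.re * d.re + d.im * d.im = 1 := by
    have := Complex.normSq_eq_norm_sq d
    rw [hd, Complex.normSq_apply] at this
    linarith
  ext v w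
  simp only [leviForm_apply, smul_apply, smul_eq_mul, Complex.mul_re, Complex.mul_im]
  linear_combination ((a v).re * (a w).re + (a v).im * (a w).im) * hd'

lemma wedge_re_im_smul {d : ℂ} (hd : ‖d‖ = 1) (a : Cn n →L[ℂ] ℂ) (β : Form n m) :
    wedgeCovector (rePart (d • a)) (wedgeCovector (imPart (d • a)) β) =
      wedgeCovector (rePart a) (wedgeCovector (imPart a) β) := by
  have h := hessWedge_leviForm (d • a) β
  rw [leviForm_smul hd, hessWedge_leviForm] at h
  exact (smul_right_injective _ (two_ne_zero' ℝ) h).symm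

/-- A functional which is invariant under rotations is determined by its values on elementary
forms. -/
lemma eq_zero_of_elementaryForm : ∀ {p : ℕ} {t : Form n (2 * p) →ₗ[ℝ] ℝ},
    (∀ c : ℂ, ‖c‖ = 1 → ∀ β, t (pull c β) = t β) → (∀ α, t (elementaryForm α) = 0) → t = 0 := by
  intro p
  induction p with
  | zero =>
    intro t _ h
    refine linearMap_eq_zero_of_wedgeOne fun l => ?_
    have := h Fin.elim0
    rw [elementaryForm] at this
    rw [← this]
    congr 2
  | succ p ih =>
    intro t hrot h
    -- `Re a ∧ Im a` is invariant under rotations, so contracting `t` with it leaves an invariant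
    -- functional in degree `2p`, to which the induction hypothesis applies.
    have step : ∀ (a : Cn n →L[ℂ] ℂ) (β : Form n (2 * p)),
        t (wedgeCovector (rePart a) (wedgeCovector (imPart a) β)) = 0 := by
      intro a β
      let t' : Form n (2 * p) →ₗ[ℝ] ℝ := t.comp
        ((wedgeCovectorLM (rePart a)).comp (wedgeCovectorLM (imPart a))).toLinearMap
      have : t' = 0 := by
        refine ih (fun c hc β => ?_) fun α => ?_
        · have hc0 : c ≠ 0 := fun h0 => by simp [h0] at hc
          have hci : ‖c⁻¹‖ = 1 := by rw [norm_inv, hc, inv_one]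
          have e1 : rePart a = (rePart (c⁻¹ • a)).comp (scalarMap n c) := by
            ext v; simp [hc0]
          have e2 : imPart a = (imPart (c⁻¹ • a)).comp (scalarMap n c) := by
            ext v; simp [hc0]
          change t (wedgeCovector (rePart a) (wedgeCovector (imPart a) (pull c β))) =
            t (wedgeCovector (rePart a) (wedgeCovector (imPart a) β))
          conv_lhs => rw [e1, e2]
          rw [← pull_wedgeCovector, ← pull_wedgeCovector, wedge_re_im_smul hci]
          exact hrot c hc _
        · change t (wedgeCovector (rePart a) (wedgeCovector (imPart a) (elementaryForm α))) = 0
          rw [← elementaryForm_cons]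
          exact h _
      exact congrArg (fun f : Form n (2 * p) →ₗ[ℝ] ℝ => f β) this
    -- Polarization of `step`.
    have step2 : ∀ (a b : Cn n →L[ℂ] ℂ) (β : Form n (2 * p)),
        t (wedgeCovector (rePart a) (wedgeCovector (imPart b) β)) =
          -t (wedgeCovector (rePart b) (wedgeCovector (imPart a) β)) := by
      intro a b β
      have e1 : rePart (a + b) = rePart a + rePart b := by ext v; simp
      have e2 : imPart (a + b) = imPart a + imPart b := by ext v; simp
      have h3 := step (a + b) β
      rw [e1, e2] at h3
      simp only [← wedgeCovectorLM_apply, map_add, add_apply] at h3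
      have h1 := step a β
      have h2 := step b β
      simp only [← wedgeCovectorLM_apply] at h1 h2 ⊢
      rw [h1, h2] at h3
      linarith
    have moves : MovesScalars t := by
      intro c a b β
      have e1 : ∀ a : Cn n →L[ℂ] ℂ, rePart (c • a) = c.re • rePart a - c.im • imPart a := by
        intro a; ext v; simp
      have e3 := step2 b a β
      have e4 : t (wedgeCovector (imPart a) (wedgeCovector (rePart b) β)) =
          -t (wedgeCovector (rePart b) (wedgeCovector (imPart a) β)) := by
        rw [wedgeCovector_comm, map_neg]
      rw [e1, e1]
      simp only [← wedgeCovectorLM_apply, map_sub, map_smul, sub_apply, smul_apply,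
        smul_eq_mul] at e3 e4 ⊢
      rw [e4, e3]
      ring
    refine linearMap_eq_zero_of_wedgeOne fun l => ?_
    choose x hx using fun i => exists_rePart_eq (l i)
    -- The choice gives `c^(2p+2) = -1`. Rotation by `c` multiplies all `2p+2` covectors by `c`;
    -- collecting these scalars on the first covector yields `t = -t` on every decomposable form.
    set c : ℂ := Complex.exp (((Real.pi / (2 * p + 2) : ℝ) : ℂ) * Complex.I) with hc
    have hc1 : ‖c‖ = 1 := Complex.norm_exp_ofReal_mul_I _
    have hcp : c ^ (2 * p + 1 + 1) = -1 := by
      rw [hc, ← Complex.exp_nat_mul, ← Complex.exp_pi_mul_I]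
      congr 1
      push_cast
      have : (2 * (p : ℂ) + 2) ≠ 0 := by exact_mod_cast (by positivity : (2 * (p : ℝ) + 2) ≠ 0)
      field_simp
      ring
    have hl : l = fun i => rePart (x i) := funext fun i => (hx i).symm
    have hcons : ∀ c : ℂ, wedgeOne (m := 2 * p + 1 + 1) (fun i => rePart (c • x i)) =
        wedgeCovector (rePart (c • x 0))
          (wedgeOne fun i : Fin (2 * p + 1) => rePart (c • x (Fin.succ i))) := by
      intro c
      rw [wedgeCovector_wedgeOne]
      congr 1
      funext i
      refine Fin.cases ?_ (fun i => ?_) i <;> rfl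
    have h1 : pull c (wedgeOne (m := 2 * p + 1 + 1) fun i => rePart (x i)) =
        wedgeOne (m := 2 * p + 1 + 1) fun i => rePart (c • x i) := by
      ext v
      rw [pull_apply, wedgeOne_apply, wedgeOne_apply]
      congr 2
      funext i j
      simp
    have h2 := hrot c hc1 (wedgeOne (m := 2 * p + 1 + 1) fun i => rePart (x i))
    rw [h1, hcons c] at h2
    have h3 := MovesScalars.pow (m := 2 * p) (c := c) moves (c • x 0) fun i : Fin (2 * p + 1) => x (Fin.succ i)
    have h4 := hcons 1
    simp only [one_smul] at h4
    have h5 : rePart ((c ^ (2 * p + 1)) • c • x 0) = -rePart (x 0) := by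
      rw [smul_smul, ← pow_succ, hcp]; ext v; simp
    rw [hl]
    have h6 : t (wedgeOne (m := 2 * p + 1 + 1) fun i => rePart (x i)) =
        -t (wedgeOne (m := 2 * p + 1 + 1) fun i => rePart (x i)) := by
      refine h2.symm.trans (h3.trans ?_)
      rw [h5, h4]
      simp only [← wedgeCovectorLM_apply, map_neg, neg_apply]
    exact self_eq_neg.1 h6

end Spanning

/-! ### Measures from positive distributions on `Ω`. -/

section Riesz

variable {n : ℕ} {Ω : TopologicalSpace.Opens (Cn n)}

/-- A measure which does not charge the complement of `Ω` and is finite on compact subsets. -/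
structure IsRadonOn (Ω : TopologicalSpace.Opens (Cn n)) (μ : Measure (Cn n)) : Prop where
  compl_eq_zero : μ (Ω : Set (Cn n))ᶜ = 0
  lt_top_of_isCompact : ∀ K : Set (Cn n), IsCompact K → K ⊆ Ω → μ K < ⊤

lemma isSigmaCompact_opens (Ω : TopologicalSpace.Opens (Cn n)) :
    IsSigmaCompact (Ω : Set (Cn n)) :=
  isSigmaCompact_iff_sigmaCompactSpace.mpr
    (have : LocallyCompactSpace Ω := Ω.isOpen.locallyCompactSpace
     sigmaCompactSpace_of_locallyCompact_secondCountable)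

lemma IsRadonOn.sigmaFinite {μ : Measure (Cn n)} (h : IsRadonOn Ω μ) : SigmaFinite μ := by
  obtain ⟨K, hK, hKU⟩ := isSigmaCompact_opens Ω
  refine ⟨⟨⟨fun i => K i ∪ (Ω : Set (Cn n))ᶜ, fun _ => trivial, fun i => ?_, ?_⟩⟩⟩
  · refine (measure_union_le _ _).trans_lt ?_
    rw [h.compl_eq_zero, add_zero]
    exact h.lt_top_of_isCompact _ (hK i) (hKU ▸ Set.subset_iUnion K i)
  · rw [← Set.iUnion_union, hKU, Set.union_compl_self]

lemma IsRadonOn.locallyIntegrableOn {μ : Measure (Cn n)} (h : IsRadonOn Ω μ) {F : Type*}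
    [NormedAddCommGroup F] {f : Cn n → F} (hf : AEStronglyMeasurable f μ) {C : ℝ}
    (hC : ∀ x ∈ Ω, ‖f x‖ ≤ C) : LocallyIntegrableOn f (Ω : Set (Cn n)) μ := by
  refine (locallyIntegrableOn_iff Ω.isOpen.isLocallyClosed).2 fun K hKΩ hK => ?_
  exact Measure.integrableOn_of_bounded (h.lt_top_of_isCompact K hK hKΩ).ne hf
    ((ae_restrict_iff' hK.measurableSet).2 (ae_of_all _ fun x hx => hC x (hKΩ hx)))

lemma isCompact_preimage_val {K : Set (Cn n)} (hK : IsCompact K) (hKΩ : K ⊆ Ω) :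
    IsCompact ((Subtype.val : Ω → Cn n) ⁻¹' K) :=
  (Topology.IsInducing.subtypeVal.isCompact_preimage_iff (by simpa using hKΩ)).2 hK

/-- A smooth cutoff function which is `1` near a compact subset. -/
lemma exists_cutoff {K : Set (Cn n)} (hK : IsCompact K) (hKΩ : K ⊆ Ω) :
    ∃ χ : 𝓓(Ω, ℝ), (∀ x, 0 ≤ χ x) ∧ (∀ x, χ x ≤ 1) ∧ ∀ᶠ x in 𝓝ˢ K, χ x = 1 := by
  obtain ⟨K', hK', h1, h2⟩ := exists_compact_between hK Ω.isOpen hKΩ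
  obtain ⟨f, hf1, hf2, hf3⟩ := exists_contMDiffMap_one_nhds_of_subset_interior
    (modelWithCornersSelf ℝ (Cn n)) (n := (⊤ : ℕ∞)) hK.isClosed h1
  have hs : tsupport f ⊆ K' := closure_minimal (fun x hx => by_contra fun h => hx (hf2 x h))
    hK'.isClosed
  exact ⟨⟨f, f.contMDiff.contDiff, hK'.of_isClosed_subset (isClosed_tsupport _) hs, hs.trans h2⟩,
    fun x => (hf3 x).1, fun x => (hf3 x).2, hf1⟩

open scoped CompactlySupported in
/-- Restriction of test functions to `Ω`, as compactly supported continuous functions. -/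
def restrictTest : 𝓓(Ω, ℝ) →ₗ[ℝ] C_c(Ω, ℝ) where
  toFun χ := ⟨⟨fun x => χ x, χ.continuous.comp continuous_subtype_val⟩, by
    refine HasCompactSupport.intro (K := Subtype.val ⁻¹' tsupport χ) ?_ fun x hx =>
      image_eq_zero_of_notMem_tsupport (f := χ) hx
    exact isCompact_preimage_val χ.hasCompactSupport χ.tsupport_subset⟩
  map_add' _ _ := rfl
  map_smul' _ _ := rfl

open scoped CompactlySupported in
-- M. Riesz's extension theorem extends the positive functional from test functions to `C_c(Ω)`,
-- where the Riesz-Markov theorem applies.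
lemma exists_isRepresentingMeasure (L : 𝓓(Ω, ℝ) →ₗ[ℝ] ℝ)
    (hL : ∀ χ : 𝓓(Ω, ℝ), (∀ x, 0 ≤ χ x) → 0 ≤ L χ) : ∃ μ, IsRepresentingMeasure (fun χ => L χ) μ := by
  have : LocallyCompactSpace Ω := Ω.isOpen.locallyCompactSpace
  have hinj : Function.Injective (restrictTest (Ω := Ω)) := by
    intro χ χ' h
    ext x
    by_cases hx : x ∈ Ω
    · exact congrArg (fun f : C_c(Ω, ℝ) => f ⟨x, hx⟩) h
    · rw [image_eq_zero_of_notMem_tsupport fun h => hx (χ.tsupport_subset h),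
        image_eq_zero_of_notMem_tsupport fun h => hx (χ'.tsupport_subset h)]
  let s : PointedCone ℝ C_c(Ω, ℝ) :=
    { carrier := {f | ∀ x, 0 ≤ f x}
      add_mem' := fun {f g} hf hg x => add_nonneg (hf x) (hg x)
      zero_mem' := fun x => le_rfl
      smul_mem' := fun c f hf x => mul_nonneg c.2 (hf x) }
  let f : C_c(Ω, ℝ) →ₗ.[ℝ] ℝ :=
    ⟨LinearMap.range restrictTest, L ∘ₗ (LinearEquiv.ofInjective restrictTest hinj).symm.toLinearMap⟩
  have hf : ∀ χ, f ⟨restrictTest χ, LinearMap.mem_range_self _ χ⟩ = L χ := by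
    intro χ
    change L ((LinearEquiv.ofInjective restrictTest hinj).symm _) = _
    congr 1
    rw [LinearEquiv.symm_apply_eq]
    rfl
  have hdom : ∀ x : f.domain, ∃ χ, x = ⟨restrictTest χ, LinearMap.mem_range_self _ χ⟩ := by
    rintro ⟨_, χ, rfl⟩
    exact ⟨χ, rfl⟩
  obtain ⟨g, hg1, hg2⟩ := riesz_extension s f (fun x hx => by
      obtain ⟨χ, rfl⟩ := hdom x
      rw [hf]
      refine hL χ fun x => ?_
      by_cases hx' : x ∈ Ω
      · exact hx ⟨x, hx'⟩
      · rw [image_eq_zero_of_notMem_tsupport fun h => hx' (χ.tsupport_subset h)]) (fun y => by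
      have hK : IsCompact (Subtype.val '' tsupport y) :=
        y.hasCompactSupport.image continuous_subtype_val
      obtain ⟨χ, h0, _, h1⟩ := exists_cutoff (Ω := Ω) hK (by rintro _ ⟨x, _, rfl⟩; exact x.2)
      obtain ⟨C, hC⟩ := y.continuous.bounded_above_of_compact_support y.hasCompactSupport
      -- A multiple of a cutoff function equal to `1` on the support of `y` dominates `-y`; this is
      -- the cofinality that the extension theorem requires.
      refine ⟨⟨restrictTest (C • χ), LinearMap.mem_range_self _ _⟩, fun x => ?_⟩
      change 0 ≤ C * χ x + y x
      by_cases hx : x ∈ tsupport y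
      · rw [h1.self_of_nhdsSet x ⟨x, hx, rfl⟩]
        have := neg_abs_le (y x)
        have : |y x| ≤ C := hC x
        linarith
      · rw [image_eq_zero_of_notMem_tsupport hx, add_zero]
        exact mul_nonneg ((norm_nonneg _).trans (hC x)) (h0 x))
  let Λ : C_c(Ω, ℝ) →ₚ[ℝ] ℝ := PositiveLinearMap.mk₀ g fun x hx => hg2 x hx
  have hme : MeasurableEmbedding (Subtype.val : Ω → Cn n) :=
    MeasurableEmbedding.subtype_coe Ω.isOpen.measurableSet
  refine ⟨(RealRMK.rieszMeasure Λ).map Subtype.val, ?_, fun K hK hKΩ => ?_, fun χ => ?_⟩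
  · rw [hme.map_apply]
    have : (Subtype.val : Ω → Cn n) ⁻¹' (Ω : Set (Cn n))ᶜ = ∅ := by
      ext x; simp
    rw [this, measure_empty]
  · rw [hme.map_apply]
    exact (isCompact_preimage_val hK hKΩ).measure_lt_top
  · rw [hme.integral_map]
    refine (RealRMK.integral_rieszMeasure Λ (restrictTest χ)).trans ?_
    exact (hg1 ⟨restrictTest χ, LinearMap.mem_range_self _ χ⟩).trans (hf χ)

lemma IsRepresentingMeasure.isRadonOn {L : 𝓓(Ω, ℝ) → ℝ} {μ : Measure (Cn n)}
    (h : IsRepresentingMeasure L μ) : IsRadonOn Ω μ := ⟨h.compl_eq_zero, h.lt_top_of_isCompact⟩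

lemma measureOf_spec {L : 𝓓(Ω, ℝ) → ℝ} (h : ∃ μ, IsRepresentingMeasure L μ) :
    IsRepresentingMeasure L (measureOf L) := by
  rw [measureOf, dif_pos h]
  exact h.choose_spec

end Riesz

/-! ### Positive currents as densities against Radon measures. -/

section Representation

variable {n p : ℕ} {Ω : TopologicalSpace.Opens (Cn n)}

/-- Rotation invariant functionals on forms are determined by finitely many elementary forms. -/
lemma exists_eq_sum_elementaryForm (n p : ℕ) :
    ∃ (ι : Type) (_ : Fintype ι) (α : ι → Fin p → (Cn n →L[ℂ] ℂ)) (L : ι → (Form n (2 * p) →L[ℝ] ℝ)),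
      ∀ t : Form n (2 * p) →ₗ[ℝ] ℝ, (∀ c : ℂ, ‖c‖ = 1 → ∀ β, t (pull c β) = t β) →
        ∀ β, t β = ∑ i, L i β * t (elementaryForm (α i)) := by
  -- Rotation-invariant functionals are the functionals on the quotient by `N`. By
  -- `eq_zero_of_elementaryForm` the classes of elementary forms span this quotient, so a basis can
  -- be chosen among them.
  let N : Submodule ℝ (Form n (2 * p)) :=
    Submodule.span ℝ {γ | ∃ c : ℂ, ‖c‖ = 1 ∧ ∃ β, γ = pull c β - β}
  let s : Set (Form n (2 * p) ⧸ N) := Set.range fun α => N.mkQ (elementaryForm α)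
  have hs : ⊤ ≤ Submodule.span ℝ s := by
    by_contra h
    obtain ⟨f, hf0, hf⟩ := Submodule.exists_le_ker_of_lt_top (Submodule.span ℝ s)
      (lt_top_iff_ne_top.2 fun h' => h h'.ge)
    have h0 : f ∘ₗ N.mkQ = 0 := by
      refine eq_zero_of_elementaryForm (fun c hc β => ?_) fun α => ?_
      · have : N.mkQ (pull c β) = N.mkQ β := by
          rw [← sub_eq_zero, ← map_sub]
          exact (Submodule.Quotient.mk_eq_zero N).2 (Submodule.subset_span ⟨c, hc, β, rfl⟩)
        rw [LinearMap.comp_apply, this, LinearMap.comp_apply]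
      · exact hf (Submodule.subset_span ⟨α, rfl⟩)
    refine hf0 (LinearMap.ext fun x => ?_)
    obtain ⟨β, rfl⟩ := N.mkQ_surjective x
    exact LinearMap.congr_fun h0 β
  let b0 := Module.Basis.ofSpan hs
  have hfin := Module.Finite.finite_basis b0
  let e := Finite.equivFin ((linearIndepOn_empty ℝ id).extend (Set.empty_subset s))
  let b := b0.reindex e
  have hb : ∀ i, ∃ α, N.mkQ (elementaryForm α) = b i := fun i => by
    rw [Module.Basis.reindex_apply]
    exact Module.Basis.ofSpan_subset hs ⟨_, rfl⟩
  choose α hα using hb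
  refine ⟨_, inferInstance, α, fun i => LinearMap.toContinuousLinearMap (b.coord i ∘ₗ N.mkQ),
    fun t ht β => ?_⟩
  have hN : N ≤ LinearMap.ker t := by
    refine Submodule.span_le.2 ?_
    rintro _ ⟨c, hc, β, rfl⟩
    simp [ht c hc]
  have h1 : ∀ β, t β = N.liftQ t hN (N.mkQ β) := fun β => rfl
  rw [h1, ← b.sum_repr (N.mkQ β), map_sum]
  refine Finset.sum_congr rfl fun i _ => ?_
  rw [map_smul, smul_eq_mul, ← hα, h1 (elementaryForm (α i))]
  rfl

/-- Lets positivity pass from a countable dense set of tuples `α` to all of them. -/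
lemma continuous_elementaryForm :
    ∀ {p : ℕ}, Continuous fun α : Fin p → (Cn n →L[ℂ] ℂ) => elementaryForm α := by
  intro p
  induction p with
  | zero => exact continuous_of_discreteTopology
  | succ p ih =>
    have h : (fun α : Fin (p + 1) → (Cn n →L[ℂ] ℂ) => elementaryForm α) = fun α =>
        wedgeCovectorLM (rePart (α 0)) (wedgeCovectorLM (imPart (α 0)) (elementaryForm (Fin.tail α))) := by
      funext α
      conv_lhs => rw [← Fin.cons_self_tail α, elementaryForm_cons]
      rfl
    have hre : Continuous (rePart (n := n)) :=
      (ContinuousLinearMap.compL ℝ (Cn n) ℂ ℝ Complex.reCLM).continuous.comp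
        (ContinuousLinearMap.restrictScalarsL ℂ (Cn n) ℂ ℝ ℝ).continuous
    have him : Continuous (imPart (n := n)) :=
      (ContinuousLinearMap.compL ℝ (Cn n) ℂ ℝ Complex.imCLM).continuous.comp
        (ContinuousLinearMap.restrictScalarsL ℂ (Cn n) ℂ ℝ ℝ).continuous
    have ht : Continuous fun α : Fin (p + 1) → (Cn n →L[ℂ] ℂ) => Fin.tail α :=
      continuous_pi fun i => continuous_apply _
    rw [h]
    exact (wedgeCovectorLM.continuous.comp (hre.comp (continuous_apply 0))).clm_apply
      ((wedgeCovectorLM.continuous.comp (him.comp (continuous_apply 0))).clm_apply (ih.comp ht))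

lemma smulForm_apply {m : ℕ} (χ : 𝓓(Ω, ℝ)) (β : Form n m) (x : Cn n) :
    smulForm χ β x = χ x • β := rfl

/-- A test form is a combination of constant forms with test functions as coefficients. -/
lemma testForm_eq_sum {m : ℕ} (φ : TestForm Ω m) :
    φ = ∑ k, smulForm (TestFunction.postcompCLM
      (LinearMap.toContinuousLinearMap ((Module.finBasis ℝ (Form n m)).coord k)) φ)
      (Module.finBasis ℝ (Form n m) k) := by
  ext1 x
  have h : ∀ (s : Finset (Fin (Module.finrank ℝ (Form n m)))) (f : _ → TestForm Ω m),
      (∑ k ∈ s, f k) x = ∑ k ∈ s, f k x := by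
    intro s f
    induction s using Finset.cons_induction with
    | empty => simp
    | cons a s ha ih => rw [Finset.sum_cons, Finset.sum_cons, ← ih]; rfl
  rw [h]
  exact ((Module.finBasis ℝ (Form n m)).sum_repr (φ x)).symm

lemma smulForm_add_right {m : ℕ} (χ : 𝓓(Ω, ℝ)) (β γ : Form n m) :
    smulForm χ (β + γ) = smulForm χ β + smulForm χ γ := by
  ext1 x
  exact smul_add (χ x) β γ

lemma smulForm_smul_right {m : ℕ} (χ : 𝓓(Ω, ℝ)) (c : ℝ) (β : Form n m) :
    smulForm χ (c • β) = c • smulForm χ β := by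
  ext1 x
  exact smul_comm (χ x) c β

/-- The functional on constant forms given by a current and a test function. -/
def currentAt {m : ℕ} (T : Current Ω m) (χ : 𝓓(Ω, ℝ)) : Form n m →ₗ[ℝ] ℝ where
  toFun β := T (smulForm χ β)
  map_add' β γ := by rw [smulForm_add_right, map_add]
  map_smul' c β := by rw [smulForm_smul_right, map_smul, RingHom.id_apply]

lemma IsBidim.pull {T : Current Ω (2 * p)} (hT : IsBidim T) {c : ℂ} (hc : ‖c‖ = 1)
    {φ ψ : TestForm Ω (2 * p)} (h : ∀ x, ψ x = pull c (φ x)) : T ψ = T φ := by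
  refine hT (Complex.arg c) φ ψ fun x => ?_
  rw [h x]
  congr 1
  conv_lhs => rw [← Complex.norm_mul_exp_arg_mul_I c, hc]
  simp

lemma IsBidim.currentAt {T : Current Ω (2 * p)} (hT : IsBidim T) (χ : 𝓓(Ω, ℝ)) {c : ℂ}
    (hc : ‖c‖ = 1) (β : Form n (2 * p)) : currentAt T χ (Pluri.pull c β) = currentAt T χ β :=
  hT.pull hc fun x => (map_smul (pullCLM c) (χ x) β).symm

/-- A bounded density with respect to a Radon measure, with values in the positive functionals,
which represents a current. -/
structure IsPosRep (T : Current Ω (2 * p)) (μ : Measure (Cn n))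
    (τ : Cn n → (Form n (2 * p) →L[ℝ] ℝ)) : Prop where
  radon : IsRadonOn Ω μ
  meas : StronglyMeasurable τ
  bound : ∃ C, ∀ x, ‖τ x‖ ≤ C
  eq_integral : ∀ φ : TestForm Ω (2 * p), T φ = ∫ x, τ x (φ x) ∂μ
  pos : ∀ᵐ x ∂μ, IsPosFunctional (τ x : Form n (2 * p) →ₗ[ℝ] ℝ)

/-- As distributions `f μ = m`. Both sides have densities with respect to `μ + m`, these agree
almost everywhere on `Ω`, and the density of `m` is nonnegative. -/
lemma nonneg_ae_of_represents {μ m : Measure (Cn n)} (hμ : IsRadonOn Ω μ) (hm : IsRadonOn Ω m)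
    {f : Cn n → ℝ} (hf : LocallyIntegrableOn f (Ω : Set (Cn n)) μ)
    (h : ∀ χ : 𝓓(Ω, ℝ), ∫ x, χ x * f x ∂μ = ∫ x, χ x ∂m) : ∀ᵐ x ∂μ, 0 ≤ f x := by
  have := hμ.sigmaFinite
  have := hm.sigmaFinite
  set ν := μ + m
  have hμν : μ ≪ ν := Measure.AbsolutelyContinuous.rfl.add_right m
  have hmν : m ≪ ν := by
    have := (Measure.AbsolutelyContinuous.refl m).add_right μ
    rwa [add_comm] at this
  have hl : LocallyIntegrableOn (fun x => (μ.rnDeriv ν x).toReal • f x) (Ω : Set (Cn n)) ν := by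
    rw [locallyIntegrableOn_iff Ω.isOpen.isLocallyClosed] at hf ⊢
    intro K hK hKc
    have h1 := hf K hK hKc
    rw [← integrable_indicator_iff hKc.measurableSet] at h1 ⊢
    rw [← integrable_rnDeriv_smul_iff hμν] at h1
    refine h1.congr (ae_of_all _ fun x => ?_)
    by_cases hx : x ∈ K <;> simp [hx]
  have hl2 : LocallyIntegrableOn (fun x => (m.rnDeriv ν x).toReal) (Ω : Set (Cn n)) ν := by
    rw [locallyIntegrableOn_iff Ω.isOpen.isLocallyClosed]
    intro K hK hKc
    have h1 : IntegrableOn (fun _ => (1 : ℝ)) K m := by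
      have := hm.lt_top_of_isCompact K hKc hK
      exact integrableOn_const this.ne
    rw [← integrable_indicator_iff hKc.measurableSet] at h1 ⊢
    rw [← integrable_rnDeriv_smul_iff hmν] at h1
    refine h1.congr (ae_of_all _ fun x => ?_)
    by_cases hx : x ∈ K <;> simp [hx]
  have key := Ω.isOpen.ae_eq_zero_of_integral_contDiff_smul_eq_zero (hl.sub hl2) (by
    intro g hg hgc hgs
    let χ : 𝓓(Ω, ℝ) := ⟨g, hg, hgc, hgs⟩
    have e1 := h χ
    rw [← integral_rnDeriv_smul hμν, ← integral_rnDeriv_smul hmν] at e1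
    have i1 := χ.integrable_bilin (ContinuousLinearMap.mul ℝ ℝ) hl
    have i2 := χ.integrable_bilin (ContinuousLinearMap.mul ℝ ℝ) hl2
    have : ∫ x, (χ x * ((μ.rnDeriv ν x).toReal • f x) - χ x * (m.rnDeriv ν x).toReal) ∂ν = 0 := by
      refine (integral_sub i1 i2).trans ?_
      rw [sub_eq_zero]
      convert e1 using 2 with x
      · funext x; simp only [smul_eq_mul, ContinuousLinearMap.mul_apply']; ring
      · funext x; simp only [smul_eq_mul, ContinuousLinearMap.mul_apply']; ring
    rw [← this]
    refine integral_congr_ae (ae_of_all _ fun x => ?_)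
    simp only [Pi.sub_apply, smul_eq_mul, mul_sub]
    rfl)
  have hΩ : ∀ᵐ x ∂μ, x ∈ Ω := by
    rw [ae_iff]
    exact hμ.compl_eq_zero
  filter_upwards [hμν.ae_le key, Measure.rnDeriv_pos hμν, hΩ,
    hμν.ae_le (Measure.rnDeriv_lt_top μ ν)] with x h1 h2 h3 h4
  have h5 := h1 h3
  simp only [Pi.sub_apply, smul_eq_mul, sub_eq_zero] at h5
  have h6 : 0 ≤ (μ.rnDeriv ν x).toReal * f x := h5 ▸ ENNReal.toReal_nonneg
  exact nonneg_of_mul_nonneg_right h6 (ENNReal.toReal_pos h2.ne' h4.ne)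

lemma IsRadonOn.integrable_test {μ : Measure (Cn n)} (hμ : IsRadonOn Ω μ) {m : ℕ}
    {τ : Cn n → (Form n m →L[ℝ] ℝ)} (hτ : StronglyMeasurable τ) {C : ℝ} (hC : ∀ x, ‖τ x‖ ≤ C)
    (φ : TestForm Ω m) : Integrable (fun x => τ x (φ x)) μ :=
  φ.integrable_bilin (ContinuousLinearMap.apply ℝ ℝ)
    (hμ.locallyIntegrableOn hτ.aestronglyMeasurable fun x _ => hC x)

lemma smulForm_add_left {m : ℕ} (χ χ' : 𝓓(Ω, ℝ)) (β : Form n m) :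
    smulForm (χ + χ') β = smulForm χ β + smulForm χ' β := map_add _ _ _

lemma smulForm_smul_left {m : ℕ} (c : ℝ) (χ : 𝓓(Ω, ℝ)) (β : Form n m) :
    smulForm (c • χ) β = c • smulForm χ β := map_smul _ _ _

/-- The distribution `χ ↦ T (χ β)`. -/
def currentCoeff {m : ℕ} (T : Current Ω m) (β : Form n m) : 𝓓(Ω, ℝ) →ₗ[ℝ] ℝ where
  toFun χ := T (smulForm χ β)
  map_add' χ χ' := by rw [smulForm_add_left, map_add]
  map_smul' c χ := by rw [smulForm_smul_left, map_smul, RingHom.id_apply]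

/-- Finitely many elementary forms determine the current, and on each of them it is a positive
measure. The sum `μ` of these measures dominates each one, so all coefficients of `T` have bounded
densities with respect to `μ`. -/
theorem exists_isPosRep {T : Current Ω (2 * p)} (hb : IsBidim T) (hp : IsPositive T) :
    ∃ μ τ, IsPosRep T μ τ := by
  have hm : ∀ α, ∃ m, IsRepresentingMeasure (fun χ : 𝓓(Ω, ℝ) => T (smulForm χ (elementaryForm α))) m :=
    fun α => exists_isRepresentingMeasure (currentCoeff T (elementaryForm α)) (hp α)
  choose m hm using hm
  obtain ⟨ι, _, α, L, hL⟩ := exists_eq_sum_elementaryForm n p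
  set μ : Measure (Cn n) := ∑ i, m (α i) with hμdef
  have hμ : IsRadonOn Ω μ := by
    refine ⟨?_, fun K hK hKΩ => ?_⟩
    · simp [hμdef, (hm _).compl_eq_zero]
    · simp only [hμdef, Measure.coe_finsetSum, Finset.sum_apply]
      exact ENNReal.sum_lt_top.2 fun i _ => (hm _).lt_top_of_isCompact K hK hKΩ
  have := hμ.sigmaFinite
  have hsf : ∀ i, SigmaFinite (m (α i)) := fun i => (hm (α i)).isRadonOn.sigmaFinite
  have hle : ∀ i, m (α i) ≤ μ := fun i =>
    Finset.single_le_sum (f := fun i => m (α i)) (fun j _ => Measure.zero_le _) (Finset.mem_univ i)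
  -- The density is at most `1` almost everywhere; the minimum makes the bound hold at every point.
  let d : ι → Cn n → ℝ := fun i x => min 1 ((m (α i)).rnDeriv μ x).toReal
  have hdm : ∀ i, Measurable (d i) := fun i =>
    measurable_const.min (Measure.measurable_rnDeriv _ _).ennreal_toReal
  have hd0 : ∀ i x, 0 ≤ d i x := fun i x => le_min zero_le_one ENNReal.toReal_nonneg
  have hd1 : ∀ i x, d i x ≤ 1 := fun i x => min_le_left _ _
  have hdae : ∀ i, ∀ᵐ x ∂μ, d i x = ((m (α i)).rnDeriv μ x).toReal := fun i => by
    filter_upwards [Measure.rnDeriv_le_one_of_le (hle i)] with x hx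
    refine min_eq_right ?_
    have := ENNReal.toReal_mono ENNReal.one_ne_top hx
    simpa using this
  have hdint : ∀ i (χ : 𝓓(Ω, ℝ)), ∫ x, d i x * χ x ∂μ = T (smulForm χ (elementaryForm (α i))) := by
    intro i χ
    rw [← (hm (α i)).integral_eq, ← integral_rnDeriv_smul (Measure.absolutelyContinuous_of_le (hle i))]
    refine integral_congr_ae ?_
    filter_upwards [hdae i] with x hx
    rw [hx, smul_eq_mul]
  let τ : Cn n → (Form n (2 * p) →L[ℝ] ℝ) := fun x => ∑ i, d i x • L i
  have hτm : StronglyMeasurable τ := by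
    refine Finset.stronglyMeasurable_fun_sum _ fun i _ => ?_
    exact (hdm i).stronglyMeasurable.smul_const (L i)
  have hτb : ∀ x, ‖τ x‖ ≤ ∑ i, ‖L i‖ := by
    intro x
    refine norm_sum_le_of_le _ fun i _ => ?_
    rw [norm_smul, Real.norm_of_nonneg (hd0 i x)]
    exact mul_le_of_le_one_left (norm_nonneg _) (hd1 i x)
  have hconst : ∀ (χ : 𝓓(Ω, ℝ)) β, T (smulForm χ β) = ∫ x, τ x (smulForm χ β x) ∂μ := by
    intro χ β
    have e1 := hL (currentAt T χ) (fun c hc β => hb.currentAt χ hc β) β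
    change T (smulForm χ β) = _ at e1
    rw [e1]
    have e2 : ∀ x, τ x (smulForm χ β x) = ∑ i, L i β * (d i x * χ x) := by
      intro x
      rw [smulForm_apply, map_smul, _root_.sum_apply, smul_eq_mul, Finset.mul_sum]
      refine Finset.sum_congr rfl fun i _ => ?_
      rw [smul_apply, smul_eq_mul]
      ring
    simp_rw [e2]
    rw [integral_finsetSum]
    · refine Finset.sum_congr rfl fun i _ => ?_
      rw [integral_const_mul, hdint]
      rfl
    · intro i _
      refine Integrable.const_mul ?_ _
      refine (χ.integrable_bilin (ContinuousLinearMap.mul ℝ ℝ).flip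
        (hμ.locallyIntegrableOn (hdm i).aestronglyMeasurable (C := 1) fun x _ => ?_))
      rw [Real.norm_of_nonneg (hd0 i x)]
      exact hd1 i x
  have hrep : ∀ φ : TestForm Ω (2 * p), T φ = ∫ x, τ x (φ x) ∂μ := by
    intro φ
    have hφ := testForm_eq_sum φ
    set c := fun k => TestFunction.postcompCLM
      (LinearMap.toContinuousLinearMap ((Module.finBasis ℝ (Form n (2 * p))).coord k)) φ
    set b := Module.finBasis ℝ (Form n (2 * p))
    have h2 : ∀ x, τ x (φ x) = ∑ k, τ x (smulForm (c k) (b k) x) := by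
      intro x
      rw [← map_sum]
      congr 1
      exact (b.sum_repr (φ x)).symm
    rw [hφ, map_sum, ← hφ]
    simp_rw [h2]
    rw [integral_finsetSum _ fun k _ => hμ.integrable_test hτm hτb _]
    exact Finset.sum_congr rfl fun k _ => hconst _ _
  refine ⟨μ, τ, hμ, hτm, ⟨_, hτb⟩, hrep, ?_⟩
  have hae : ∀ α, ∀ᵐ x ∂μ, 0 ≤ τ x (elementaryForm α) := by
    intro α
    refine nonneg_ae_of_represents hμ (hm α).isRadonOn (f := fun x => τ x (elementaryForm α)) ?_
      fun χ => ?_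
    · refine hμ.locallyIntegrableOn (C := (∑ i, ‖L i‖) * ‖(elementaryForm α : Form n (2 * p))‖)
        ((ContinuousLinearMap.apply ℝ ℝ _).continuous.comp_stronglyMeasurable
          hτm).aestronglyMeasurable fun x _ => ?_
      exact (τ x).le_of_opNorm_le (hτb x) _
    · rw [(hm α).integral_eq, hconst]
      refine integral_congr_ae (ae_of_all _ fun x => ?_)
      simp only [smulForm_apply, map_smul, smul_eq_mul]
  -- The exceptional null set depends on `α`, so only a dense sequence of tuples is used, followed
  -- by continuity.
  filter_upwards [ae_all_iff.2 fun k : ℕ => hae (TopologicalSpace.denseSeq _ k)] with x hx β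
  have hcl : IsClosed {β : Fin p → (Cn n →L[ℂ] ℂ) | 0 ≤ τ x (elementaryForm β)} :=
    isClosed_le continuous_const ((τ x).continuous.comp continuous_elementaryForm)
  refine hcl.closure_subset_iff.2 ?_ (TopologicalSpace.denseRange_denseSeq _ β)
  rintro _ ⟨k, rfl⟩
  exact hx k

lemma IsPosRep.nonneg {T : Current Ω (2 * p)} {μ : Measure (Cn n)}
    {τ : Cn n → (Form n (2 * p) →L[ℝ] ℝ)} (h : IsPosRep T μ τ) {φ : TestForm Ω (2 * p)}
    (hφ : ∀ x, IsPosForm (φ x)) : 0 ≤ T φ := by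
  rw [h.eq_integral]
  refine integral_nonneg_of_ae ?_
  filter_upwards [h.pos] with x hx
  exact hφ x _ hx

lemma IsPosRep.isRepresentedBy {T : Current Ω (2 * p)} {μ : Measure (Cn n)}
    {τ : Cn n → (Form n (2 * p) →L[ℝ] ℝ)} (h : IsPosRep T μ τ) : IsRepresentedBy T μ τ := by
  obtain ⟨C, hC⟩ := h.bound
  refine ⟨fun β => ?_, h.eq_integral⟩
  refine h.radon.locallyIntegrableOn (C := C * ‖β‖)
    ((ContinuousLinearMap.apply ℝ ℝ _).continuous.comp_stronglyMeasurable
      h.meas).aestronglyMeasurable fun x _ => ?_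
  exact (τ x).le_of_opNorm_le (hC x) _

end Representation

/-! ### Rotation-invariant mollifiers and the sub-mean value property. -/

section Mollification

variable {n : ℕ}

/-- A smooth bump function supported in the ball of radius `ε`, invariant under rotations. -/
def bump (n : ℕ) (ε : ℝ) (y : Cn n) : ℝ := Real.smoothTransition (1 - sqNorm y / ε ^ 2)

lemma bump_nonneg (ε : ℝ) (y : Cn n) : 0 ≤ bump n ε y := Real.smoothTransition.nonneg _

lemma contDiff_bump (ε : ℝ) : ContDiff ℝ (⊤ : ℕ∞) (bump n ε) :=
  Real.smoothTransition.contDiff.comp (contDiff_const.sub (contDiff_sqNorm.div_const _))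

lemma norm_sq_le_sqNorm (y : Cn n) (j : Fin n) : ‖y j‖ ^ 2 ≤ sqNorm y := by
  rw [← Complex.normSq_eq_norm_sq]
  exact Finset.single_le_sum (f := fun j => Complex.normSq (y j))
    (fun i _ => Complex.normSq_nonneg _) (Finset.mem_univ j)

lemma support_bump {ε : ℝ} (hε : 0 < ε) : Function.support (bump n ε) ⊆ Metric.ball 0 ε := by
  intro y hy
  -- `Cn n` carries the sup norm, whose square is at most `sqNorm`, so the Euclidean ball lies in
  -- the sup-norm ball.
  have h : sqNorm y < ε ^ 2 := by
    by_contra h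
    refine hy (Real.smoothTransition.zero_of_nonpos ?_)
    rw [sub_nonpos, le_div_iff₀ (by positivity)]
    linarith
  rw [mem_ball_zero_iff, pi_norm_lt_iff hε]
  exact fun j => lt_of_pow_lt_pow_left₀ 2 hε.le ((norm_sq_le_sqNorm y j).trans_lt h)

lemma hasCompactSupport_bump {ε : ℝ} (hε : 0 < ε) : HasCompactSupport (bump n ε) :=
  HasCompactSupport.intro (isCompact_closedBall 0 ε) fun _ hx => by_contra fun h =>
    hx (Metric.ball_subset_closedBall (support_bump hε h))

lemma integral_bump_pos {ε : ℝ} (hε : 0 < ε) : 0 < ∫ y, bump n ε y := by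
  refine (contDiff_bump ε).continuous.integral_pos_of_hasCompactSupport_nonneg_nonzero
    (hasCompactSupport_bump hε) (bump_nonneg ε) (x := 0) ?_
  simp [bump, sqNorm]

/-- The rotation invariant mollifier at scale `ε`. -/
def mollifier (n : ℕ) (ε : ℝ) (y : Cn n) : ℝ := (∫ y, bump n ε y)⁻¹ * bump n ε y

lemma mollifier_nonneg {ε : ℝ} (hε : 0 < ε) (y : Cn n) : 0 ≤ mollifier n ε y :=
  mul_nonneg (inv_nonneg.2 (integral_bump_pos hε).le) (bump_nonneg _ _)

lemma contDiff_mollifier (ε : ℝ) : ContDiff ℝ (⊤ : ℕ∞) (mollifier n ε) :=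
  contDiff_const.mul (contDiff_bump ε)

lemma support_mollifier {ε : ℝ} (hε : 0 < ε) :
    Function.support (mollifier n ε) ⊆ Metric.ball 0 ε :=
  fun _ hy => support_bump hε (right_ne_zero_of_mul hy)

lemma mollifier_eq_zero {ε : ℝ} (hε : 0 < ε) {y : Cn n} (hy : ¬ ‖y‖ ≤ ε) : mollifier n ε y = 0 := by
  by_contra h
  exact hy (mem_ball_zero_iff.1 (support_mollifier hε h)).le

lemma hasCompactSupport_mollifier {ε : ℝ} (hε : 0 < ε) : HasCompactSupport (mollifier n ε) :=
  (hasCompactSupport_bump hε).mul_left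

lemma integral_mollifier {ε : ℝ} (hε : 0 < ε) : ∫ y, mollifier n ε y = 1 := by
  simp only [mollifier]
  rw [integral_const_mul]
  exact inv_mul_cancel₀ (integral_bump_pos hε).ne'

lemma integrable_mollifier {ε : ℝ} (hε : 0 < ε) : Integrable (mollifier n ε) :=
  integrable_of_integral_eq_one (integral_mollifier hε)

lemma mollifier_smul (ε : ℝ) {c : ℂ} (hc : ‖c‖ = 1) (y : Cn n) :
    mollifier n ε (c • y) = mollifier n ε y := by
  have : sqNorm (c • y) = sqNorm y := by
    refine Finset.sum_congr rfl fun j _ => ?_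
    rw [Pi.smul_apply, smul_eq_mul, map_mul, Complex.normSq_eq_norm_sq c, hc]
    simp
  simp only [mollifier, bump, this]

lemma measurePreserving_rotation {c : ℂ} (hc : ‖c‖ = 1) :
    MeasurePreserving (fun y : Cn n => c • y) := by
  have h : MeasurePreserving (fun x : ℂ => c * x) :=
    (rotation ⟨c, mem_sphere_zero_iff_norm.2 hc⟩).measurePreserving
  exact volume_preserving_pi fun _ => h

/-- The convolution with the mollifier at scale `ε`. -/
def mol (ε : ℝ) (f : Cn n → ℝ) (z : Cn n) : ℝ := ∫ y, mollifier n ε y * f (z - y)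

lemma mol_eq_convolution (ε : ℝ) (f : Cn n → ℝ) :
    mol ε f = convolution (mollifier n ε) f (ContinuousLinearMap.lsmul ℝ ℝ) volume := rfl

/-- Bounded measurable functions. -/
structure BddMeas (f : Cn n → ℝ) : Prop where
  meas : Measurable f
  bdd : ∃ M, ∀ x, |f x| ≤ M

lemma BddMeas.comp_bound {f : Cn n → ℝ} (hf : BddMeas f) {X : Type*} [MeasurableSpace X]
    {μ : Measure X} {g : X → ℝ} (hg : Integrable g μ) {a : X → Cn n} (ha : Measurable a) :
    Integrable (fun x => g x * f (a x)) μ := by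
  obtain ⟨M, hM⟩ := hf.bdd
  exact hg.mul_bdd (c := M) (hf.meas.comp ha).aestronglyMeasurable (ae_of_all _ fun x => hM _)

lemma BddMeas.integrable_mol {f : Cn n → ℝ} (hf : BddMeas f) {ε : ℝ} (hε : 0 < ε) (z : Cn n) :
    Integrable fun y => mollifier n ε y * f (z - y) :=
  hf.comp_bound (integrable_mollifier hε) (measurable_const.sub measurable_id)

lemma BddMeas.locallyIntegrable {f : Cn n → ℝ} (hf : BddMeas f) : LocallyIntegrable f := by
  obtain ⟨M, hM⟩ := hf.bdd
  refine (locallyIntegrable_iff).2 fun K hK => ?_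
  exact Measure.integrableOn_of_bounded hK.measure_lt_top.ne hf.meas.aestronglyMeasurable
    (ae_of_all _ hM)

lemma contDiff_mol {f : Cn n → ℝ} (hf : BddMeas f) {ε : ℝ} (hε : 0 < ε) :
    ContDiff ℝ (⊤ : ℕ∞) (mol ε f) := by
  rw [mol_eq_convolution]
  exact (hasCompactSupport_mollifier hε).contDiff_convolution_left _ (contDiff_mollifier ε)
    hf.locallyIntegrable

lemma hasCompactSupport_mol {f : Cn n → ℝ} (hf : HasCompactSupport f) {ε : ℝ} (hε : 0 < ε) :
    HasCompactSupport (mol ε f) := by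
  rw [mol_eq_convolution]
  exact (hasCompactSupport_mollifier hε).convolution _ hf

lemma mol_mono_of_ae {f g : Cn n → ℝ} (hf : BddMeas f) (hg : BddMeas g) {ε : ℝ} (hε : 0 < ε)
    {z : Cn n} (h : ∀ᵐ y, y ∈ Metric.ball z ε → f y ≤ g y) : mol ε f z ≤ mol ε g z := by
  refine integral_mono_ae (hf.integrable_mol hε z) (hg.integrable_mol hε z) ?_
  have h' := (Measure.measurePreserving_sub_left volume z).quasiMeasurePreserving.ae h
  filter_upwards [h'] with y hy
  by_cases h0 : mollifier n ε y = 0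
  · simp [h0]
  · refine mul_le_mul_of_nonneg_left (hy ?_) (mollifier_nonneg hε y)
    have := support_mollifier hε h0
    simpa [Metric.mem_ball, dist_eq_norm] using this

lemma mol_mono {f g : Cn n → ℝ} (hf : BddMeas f) (hg : BddMeas g) {ε : ℝ} (hε : 0 < ε)
    {z : Cn n} (h : ∀ y ∈ Metric.ball z ε, f y ≤ g y) : mol ε f z ≤ mol ε g z :=
  mol_mono_of_ae hf hg hε (ae_of_all _ h)

lemma mol_congr {f g : Cn n → ℝ} {ε : ℝ} (hε : 0 < ε)
    {z : Cn n} (h : ∀ y ∈ Metric.ball z ε, f y = g y) : mol ε f z = mol ε g z := by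
  refine integral_congr_ae (ae_of_all _ fun y => ?_)
  by_cases h0 : mollifier n ε y = 0
  · simp [h0]
  · have := support_mollifier hε h0
    have h1 := h (z - y) (by simpa [Metric.mem_ball, dist_eq_norm] using this)
    simp only [h1]

lemma bddMeas_const (c : ℝ) : BddMeas fun _ : Cn n => c := ⟨measurable_const, |c|, fun _ => le_rfl⟩

lemma mol_const {ε : ℝ} (hε : 0 < ε) (c : ℝ) (z : Cn n) : mol ε (fun _ => c) z = c := by
  rw [mol, integral_mul_const, integral_mollifier hε, one_mul]

lemma mol_add {f g : Cn n → ℝ} (hf : BddMeas f) (hg : BddMeas g) {ε : ℝ} (hε : 0 < ε) (z : Cn n) :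
    mol ε (fun x => f x + g x) z = mol ε f z + mol ε g z := by
  rw [mol, mol, mol, ← integral_add (hf.integrable_mol hε z) (hg.integrable_mol hε z)]
  simp only [mul_add]

lemma mol_le {f : Cn n → ℝ} (hf : BddMeas f) {ε : ℝ} (hε : 0 < ε) {z : Cn n} {c : ℝ}
    (h : ∀ y ∈ Metric.ball z ε, f y ≤ c) : mol ε f z ≤ c :=
  (mol_mono hf (bddMeas_const c) hε h).trans_eq (mol_const hε c z)

lemma le_mol {f : Cn n → ℝ} (hf : BddMeas f) {ε : ℝ} (hε : 0 < ε) {z : Cn n} {c : ℝ}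
    (h : ∀ y ∈ Metric.ball z ε, c ≤ f y) : c ≤ mol ε f z :=
  (mol_const hε c z).symm.trans_le (mol_mono (bddMeas_const c) hf hε h)

lemma abs_mol_le {f : Cn n → ℝ} (hf : BddMeas f) {ε : ℝ} (hε : 0 < ε) {z : Cn n} {M : ℝ}
    (h : ∀ y, |f y| ≤ M) : |mol ε f z| ≤ M :=
  abs_le.2 ⟨le_mol hf hε fun y _ => (abs_le.1 (h y)).1, mol_le hf hε fun y _ => (abs_le.1 (h y)).2⟩

/-- The sub-mean value inequality at `z` for all discs of radius at most `r`. -/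
def Submean (f : Cn n → ℝ) (z : Cn n) (r : ℝ) : Prop :=
  ∀ w : Cn n, ‖w‖ ≤ r → f z ≤ Real.circleAverage (fun ζ : ℂ => f (z + ζ • w)) 0 1

lemma continuous_circle (w : Cn n) : Continuous fun θ : ℝ => circleMap 0 1 θ • w :=
  (continuous_circleMap 0 1).smul continuous_const

lemma BddMeas.circleIntegrable {f : Cn n → ℝ} (hf : BddMeas f) (z w : Cn n) :
    CircleIntegrable (fun ζ : ℂ => f (z + ζ • w)) 0 1 := by
  have := hf.comp_bound (intervalIntegrable_const (a := 0) (b := 2 * Real.pi)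
    (c := (1 : ℝ)) (μ := volume)).1 (a := fun θ => z + circleMap 0 1 θ • w)
    (measurable_const.add (continuous_circle w).measurable)
  simp only [one_mul] at this
  exact (intervalIntegrable_iff_integrableOn_Ioc_of_le Real.two_pi_pos.le).2 this

lemma integrable_mollifier_circleAverage {f : Cn n → ℝ} (hf : BddMeas f) {ε : ℝ} (hε : 0 < ε)
    {a b : Cn n → Cn n} (ha : Measurable a) (hb : Measurable b) :
    Integrable fun y => mollifier n ε y *
      Real.circleAverage (fun ζ : ℂ => f (a y + ζ • b y)) 0 1 := by
  have hm : Measurable fun q : ℝ × Cn n => a q.2 + circleMap 0 1 q.1 • b q.2 :=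
    (ha.comp measurable_snd).add
      (((continuous_circleMap 0 1).measurable.comp measurable_fst).smul (hb.comp measurable_snd))
  have hi := (hf.comp_bound (μ := (volume.restrict (Set.Ioc 0 (2 * Real.pi))).prod volume)
    (g := fun q : ℝ × Cn n => mollifier n ε q.2) ((integrable_mollifier hε).comp_snd _)
    hm).integral_prod_right
  refine (hi.const_mul (2 * Real.pi)⁻¹).congr (ae_of_all _ fun y => ?_)
  simp only [Real.circleAverage_def, smul_eq_mul]
  rw [integral_const_mul, intervalIntegral.integral_of_le Real.two_pi_pos.le]
  ring

lemma integral_mollifier_circleAverage {f : Cn n → ℝ} (hf : BddMeas f) {ε : ℝ} (hε : 0 < ε)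
    {a b : Cn n → Cn n} (ha : Measurable a) (hb : Measurable b) :
    ∫ y, mollifier n ε y * Real.circleAverage (fun ζ : ℂ => f (a y + ζ • b y)) 0 1 =
      Real.circleAverage (fun ζ : ℂ => ∫ y, mollifier n ε y * f (a y + ζ • b y)) 0 1 := by
  have hm : Measurable fun q : ℝ × Cn n => a q.2 + circleMap 0 1 q.1 • b q.2 :=
    (ha.comp measurable_snd).add
      (((continuous_circleMap 0 1).measurable.comp measurable_fst).smul (hb.comp measurable_snd))
  simp only [Real.circleAverage_def, smul_eq_mul]
  rw [intervalIntegral_integral_swap, ← integral_const_mul]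
  · refine integral_congr_ae (ae_of_all _ fun y => ?_)
    simp only
    rw [intervalIntegral.integral_const_mul]
    ring
  · refine hf.comp_bound (g := fun q : ℝ × Cn n => mollifier n ε q.2) ?_ hm
    rw [Set.uIoc_of_le Real.two_pi_pos.le]
    exact (integrable_mollifier hε).comp_snd _

/-- The sub-mean value inequality on the circle through `z - y` is averaged over `y`. After
exchanging the integrals, rotation invariance of the mollifier makes every point of the circle
contribute `mol ε f z`. -/
lemma Submean.le_mol {f : Cn n → ℝ} (hf : BddMeas f) {z : Cn n} {r ε : ℝ} (h : Submean f z r)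
    (hε : 0 < ε) (hr : ε ≤ r) : f z ≤ mol ε f z := by
  have h1 : f z ≤ ∫ y, mollifier n ε y *
      Real.circleAverage (fun ζ : ℂ => f (z + ζ • (-y))) 0 1 := by
    have e : f z = ∫ y, mollifier n ε y * f z := by
      rw [integral_mul_const, integral_mollifier hε, one_mul]
    conv_lhs => rw [e]
    refine integral_mono ((integrable_mollifier hε).mul_const _)
      (integrable_mollifier_circleAverage hf hε measurable_const measurable_neg) fun y => ?_
    by_cases hy : ‖y‖ ≤ ε
    · exact mul_le_mul_of_nonneg_left (h _ (by rw [norm_neg]; exact hy.trans hr))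
        (mollifier_nonneg hε y)
    · simp [mollifier_eq_zero hε hy]
  refine h1.trans_eq ?_
  rw [integral_mollifier_circleAverage hf hε (a := fun _ => z) (b := fun y => -y) measurable_const
    measurable_neg]
  have h2 : ∀ ζ : ℂ, ‖ζ‖ = 1 → ∫ y, mollifier n ε y * f (z + ζ • (-y)) = mol ε f z := by
    intro ζ hζ
    have e := (measurePreserving_rotation (n := n) hζ).integral_comp
      ((MeasurableEquiv.smul₀ ζ (by rintro rfl; simp at hζ)).measurableEmbedding)
      (fun y => mollifier n ε y * f (z - y))
    rw [mol, ← e]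
    simp only [mollifier_smul ε hζ, smul_neg, sub_eq_add_neg]
  rw [Real.circleAverage_congr_sphere (f₂ := fun _ => mol ε f z) fun ζ hζ => h2 ζ (by simpa using hζ)]
  exact Real.circleAverage_const _ _ _

lemma Submean.mol {f : Cn n → ℝ} (hf : BddMeas f) {z : Cn n} {r ε : ℝ} (hε : 0 < ε)
    (h : ∀ y, ‖y‖ ≤ ε → Submean f (z - y) r) : Submean (mol ε f) z r := by
  intro w hw
  have e : Real.circleAverage (fun ζ : ℂ => Pluri.mol ε f (z + ζ • w)) 0 1 =
      ∫ y, mollifier n ε y * Real.circleAverage (fun ζ : ℂ => f (z - y + ζ • w)) 0 1 := by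
    rw [integral_mollifier_circleAverage hf hε (a := fun y => z - y) (b := fun _ => w)
      (measurable_const.sub measurable_id) measurable_const]
    refine congrArg (fun F => Real.circleAverage F 0 1) (funext fun ζ => ?_)
    simp only [Pluri.mol, sub_add_eq_add_sub]
  rw [e, Pluri.mol]
  refine integral_mono (hf.integrable_mol hε z) (integrable_mollifier_circleAverage hf hε
    (measurable_const.sub measurable_id) measurable_const) fun y => ?_
  by_cases hy : ‖y‖ ≤ ε
  · exact mul_le_mul_of_nonneg_left (h y hy w hw) (mollifier_nonneg hε y)
  · simp [mollifier_eq_zero hε hy]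

end Mollification

/-! ### Levi forms of smooth submean functions and limits of mollifications. -/

section Levi

variable {n : ℕ}

lemma exists_taylor_two {g : Cn n → ℝ} (hg : ContDiff ℝ 2 g) (x : Cn n) {c : ℝ} (hc : 0 < c) :
    ∃ δ > 0, ∀ v, ‖v‖ ≤ δ →
      |g (x + v) - g x - fderiv ℝ g x v - 1 / 2 * hess g x v v| ≤ c * ‖v‖ ^ 2 := by
  have hd : Differentiable ℝ g := hg.differentiable (by norm_num)
  have hd1 : ContDiff ℝ 1 (fderiv ℝ g) := hg.fderiv_right (by norm_num)
  have h0 := (hd1.differentiable (by norm_num) x).hasFDerivAt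
  rw [hasFDerivAt_iff_isLittleO_nhds_zero] at h0
  have h1 := h0.bound hc
  obtain ⟨δ, hδ, h2⟩ := Metric.eventually_nhds_iff_ball.1 h1
  refine ⟨δ / 2, by positivity, fun v hv => ?_⟩
  set R : Cn n → ℝ := fun v => g (x + v) - g x - fderiv ℝ g x v - 1 / 2 * hess g x v v with hR
  have hder : ∀ y, HasFDerivAt R (fderiv ℝ g (x + y) - fderiv ℝ g x - hess g x y) y := by
    intro y
    have a1 : HasFDerivAt (fun v => g (x + v)) (fderiv ℝ g (x + y)) y := by
      have := (hd (x + y)).hasFDerivAt.comp y ((hasFDerivAt_id y).const_add x)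
      simpa [Function.comp_def] using this
    have a2 := (hess g x).hasFDerivAt_of_bilinear (hasFDerivAt_id (𝕜 := ℝ) y) (hasFDerivAt_id y)
    have a3 := ((a1.sub_const (g x)).sub (fderiv ℝ g x).hasFDerivAt).sub (a2.const_mul (1 / 2))
    refine a3.congr_fderiv ?_
    ext w
    have hs := snd_fderiv_symm hg x w y
    simp [hess] at hs ⊢
    rw [hs]
    ring
  have key := (convex_closedBall (0 : Cn n) ‖v‖).norm_image_sub_le_of_norm_hasFDerivWithin_le
    (f := R) (C := c * ‖v‖) (fun y _ => (hder y).hasFDerivWithinAt) (fun y hy => by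
      rw [mem_closedBall_zero_iff] at hy
      refine (h2 y ?_).trans (by gcongr)
      rw [mem_ball_zero_iff]
      linarith) (x := 0) (y := v) (by simp) (by simp)
  have hR0 : R 0 = 0 := by simp [hR]
  rw [hR0, sub_zero, sub_zero, Real.norm_eq_abs] at key
  calc _ ≤ _ := key
    _ = _ := by ring

lemma circleMap_smul (w : Cn n) (θ : ℝ) :
    circleMap 0 1 θ • w = Real.cos θ • w + Real.sin θ • (Complex.I • w) := by
  have : circleMap 0 1 θ = (Real.cos θ : ℂ) + (Real.sin θ : ℂ) * Complex.I := by
    rw [circleMap, Complex.exp_mul_I, ← Complex.ofReal_cos, ← Complex.ofReal_sin]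
    simp
  rw [this, add_smul, mul_smul, Complex.coe_smul, Complex.coe_smul]

lemma circleAverage_linear (l : Cn n →L[ℝ] ℝ) (w : Cn n) :
    Real.circleAverage (fun ζ : ℂ => l (ζ • w)) 0 1 = 0 := by
  simp only [Real.circleAverage_def, circleMap_smul, map_add, map_smul, smul_eq_mul]
  rw [intervalIntegral.integral_add, intervalIntegral.integral_mul_const,
    intervalIntegral.integral_mul_const, integral_cos, integral_sin]
  · simp
  · exact (Real.continuous_cos.mul continuous_const).intervalIntegrable _ _
  · exact (Real.continuous_sin.mul continuous_const).intervalIntegrable _ _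

lemma circleAverage_bilinear (H : Cn n →L[ℝ] Cn n →L[ℝ] ℝ) (w : Cn n) :
    Real.circleAverage (fun ζ : ℂ => H (ζ • w) (ζ • w)) 0 1 =
      1 / 2 * (H w w + H (Complex.I • w) (Complex.I • w)) := by
  have e : ∀ θ : ℝ, H (circleMap 0 1 θ • w) (circleMap 0 1 θ • w) =
      Real.cos θ ^ 2 * H w w + Real.sin θ ^ 2 * H (Complex.I • w) (Complex.I • w) +
        Real.sin θ * Real.cos θ * (H w (Complex.I • w) + H (Complex.I • w) w) := by
    intro θ
    simp only [circleMap_smul, map_add, map_smul, add_apply, smul_apply, smul_eq_mul]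
    ring
  simp only [Real.circleAverage_def, e]
  rw [intervalIntegral.integral_add, intervalIntegral.integral_add,
    intervalIntegral.integral_mul_const, intervalIntegral.integral_mul_const,
    intervalIntegral.integral_mul_const, integral_cos_sq, integral_sin_sq, integral_sin_mul_cos₁]
  · simp
    field_simp
  all_goals exact Continuous.intervalIntegrable (by fun_prop) _ _

/-- On a small circle the linear Taylor term averages to zero and the quadratic one to a quarter of
the Levi form; the factor `4` in `key` is the inverse of this quarter. -/
lemma Submean.leviNonneg {g : Cn n → ℝ} (hg : ContDiff ℝ 2 g) {x : Cn n} {r : ℝ} (hr : 0 < r)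
    (h : Submean g x r) : LeviNonneg (hess g x) := by
  intro w
  have key : ∀ c : ℝ, 0 < c →
      -(4 * c * ‖w‖ ^ 2) ≤ hess g x w w + hess g x (Complex.I • w) (Complex.I • w) := by
    intro c hc
    obtain ⟨δ, hδ, hT⟩ := exists_taylor_two hg x hc
    obtain ⟨t, ht, htw⟩ : ∃ t : ℝ, 0 < t ∧ t * ‖w‖ ≤ min δ r := by
      refine ⟨min δ r / (‖w‖ + 1), by positivity, ?_⟩
      rw [div_mul_eq_mul_div, div_le_iff₀ (by positivity)]
      exact mul_le_mul_of_nonneg_left (by linarith) (by positivity)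
    have hn : ‖t • w‖ = t * ‖w‖ := by rw [norm_smul, Real.norm_of_nonneg ht.le]
    have h1 := h (t • w) (by rw [hn]; exact htw.trans (min_le_right _ _))
    have hci : ∀ {F : ℂ → ℝ}, Continuous F → CircleIntegrable F 0 1 := fun hF =>
      (hF.comp (continuous_circleMap 0 1)).intervalIntegrable _ _
    have hc1 : Continuous fun ζ : ℂ => ζ • t • w := continuous_id.smul continuous_const
    have hc2 : Continuous fun ζ : ℂ => g (x + ζ • t • w) :=
      hg.continuous.comp (continuous_const.add hc1)
    have hc3 : Continuous fun ζ : ℂ => fderiv ℝ g x (ζ • t • w) := (fderiv ℝ g x).continuous.comp hc1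
    have hc4 : Continuous fun ζ : ℂ => hess g x (ζ • t • w) (ζ • t • w) :=
      ((hess g x).continuous.comp hc1).clm_apply hc1
    have hc5 : Continuous fun ζ : ℂ => (1 / 2 : ℝ) • hess g x (ζ • t • w) (ζ • t • w) :=
      continuous_const.mul hc4
    have hc6 : Continuous fun ζ : ℂ => fderiv ℝ g x (ζ • t • w) +
        (1 / 2 : ℝ) • hess g x (ζ • t • w) (ζ • t • w) := hc3.add hc5
    have h2 : Real.circleAverage (fun ζ : ℂ => g (x + ζ • t • w)) 0 1 ≤
        Real.circleAverage (fun ζ : ℂ => (g x + c * (t * ‖w‖) ^ 2) + (fderiv ℝ g x (ζ • t • w) +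
          (1 / 2 : ℝ) • hess g x (ζ • t • w) (ζ • t • w))) 0 1 := by
      refine Real.circleAverage_mono (hci hc2)
        (hci (continuous_const.add hc6)) fun ζ hζ => ?_
      have hζ1 : ‖ζ‖ = 1 := by simpa using hζ
      have hz : ‖ζ • t • w‖ = t * ‖w‖ := by rw [norm_smul, hζ1, one_mul, hn]
      have := hT (ζ • t • w) (by rw [hz]; exact htw.trans (min_le_left _ _))
      rw [hz] at this
      have := (abs_le.1 this).2
      simp only [smul_eq_mul]
      linarith
    have hB : Real.circleAverage (fun ζ : ℂ => (1 / 2 : ℝ) • hess g x (ζ • t • w) (ζ • t • w)) 0 1 =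
        (1 / 2 : ℝ) • Real.circleAverage (fun ζ : ℂ => hess g x (ζ • t • w) (ζ • t • w)) 0 1 :=
      Real.circleAverage_fun_smul
    rw [Real.circleAverage_fun_add (hci continuous_const) (hci hc6),
      Real.circleAverage_fun_add (hci hc3) (hci hc5), hB,
      Real.circleAverage_const, circleAverage_linear, circleAverage_bilinear] at h2
    have h3 := h1.trans h2
    have e : hess g x (t • w) (t • w) + hess g x (Complex.I • t • w) (Complex.I • t • w) =
        t ^ 2 * (hess g x w w + hess g x (Complex.I • w) (Complex.I • w)) := by
      rw [smul_comm Complex.I t w]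
      simp only [map_smul, smul_apply, smul_eq_mul]
      ring
    rw [e, smul_eq_mul] at h3
    have h4 : 0 ≤ t ^ 2 * ((hess g x w w + hess g x (Complex.I • w) (Complex.I • w)) +
      4 * c * ‖w‖ ^ 2) := by nlinarith
    have := nonneg_of_mul_nonneg_right h4 (by positivity)
    linarith
  by_contra hneg
  push Not at hneg
  set L := hess g x w w + hess g x (Complex.I • w) (Complex.I • w)
  -- For this `c` the error is at most `-L / 2`, which is incompatible with `L < 0`.
  have := key (-L / (8 * (‖w‖ ^ 2 + 1))) (div_pos (by linarith) (by positivity))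
  have h5 : 4 * (-L / (8 * (‖w‖ ^ 2 + 1))) * ‖w‖ ^ 2 ≤ -L / 2 := by
    rw [mul_div_assoc', div_mul_eq_mul_div, div_le_iff₀ (by positivity)]
    nlinarith [sq_nonneg ‖w‖]
  linarith

/-- Near each point of `K` a constant separates `f` from `w`, by upper semicontinuity of `f` and
continuity of `w`; compactness makes the admissible `ε` uniform. -/
lemma eventually_mol_lt {f : Cn n → ℝ} (hf : BddMeas f) {K : Set (Cn n)} (hK : IsCompact K)
    (hus : ∀ x ∈ K, UpperSemicontinuousAt f x) {w : Cn n → ℝ} (hw : ∀ x ∈ K, ContinuousAt w x)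
    (h : ∀ x ∈ K, f x < w x) : ∀ᶠ ε in 𝓝[>] (0 : ℝ), ∀ x ∈ K, mol ε f x < w x := by
  have := hK.eventually_forall_of_forall_eventually (x₀ := (0 : ℝ))
    (P := fun ε x => 0 < ε → mol ε f x < w x) (fun x hx => by
      obtain ⟨c, hc1, hc2⟩ := exists_between (h x hx)
      obtain ⟨r, hr, h1⟩ := Metric.eventually_nhds_iff_ball.1 (hus x hx c hc1)
      have h2 := (hw x hx).eventually (lt_mem_nhds hc2)
      have h3 : ∀ᶠ z : ℝ × Cn n in 𝓝 (0, x), z.1 < r / 2 :=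
        (continuous_fst.tendsto _).eventually (gt_mem_nhds (by simpa using half_pos hr))
      have h4 : ∀ᶠ z : ℝ × Cn n in 𝓝 (0, x), z.2 ∈ Metric.ball x (r / 2) :=
        (continuous_snd.tendsto _).eventually (Metric.ball_mem_nhds _ (half_pos hr))
      filter_upwards [h3, h4, (continuous_snd.tendsto _).eventually h2] with z a1 a2 a3 a4
      refine (mol_le hf a4 fun y hy => (h1 y ?_).le).trans_lt a3
      rw [Metric.mem_ball] at *
      linarith [dist_triangle y z.2 x])
  rw [eventually_nhdsWithin_iff]
  filter_upwards [this] with ε hε h0 x hx using hε x hx h0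

/-- The sub-mean value inequality bounds the mollifications from below, upper semicontinuity bounds
their limit from above. -/
lemma tendsto_mol {f : Cn n → ℝ} (hf : BddMeas f) {x : Cn n} {r : ℝ} (hr : 0 < r)
    (h : Submean f x r) (hus : UpperSemicontinuousAt f x) :
    Tendsto (fun ε => mol ε f x) (𝓝[>] 0) (𝓝 (f x)) := by
  refine tendsto_order.2 ⟨fun a ha => ?_, fun a ha => ?_⟩
  · filter_upwards [Ioc_mem_nhdsGT hr] with ε hε
    exact ha.trans_le (h.le_mol hf hε.1 hε.2)
  · have := eventually_mol_lt hf (isCompact_singleton (x := x)) (w := fun _ => a)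
      (by simpa using hus) (fun _ _ => continuousAt_const) (by simpa using ha)
    simpa using this

lemma fderiv_convolution_mollifier {F : Type*} [NormedAddCommGroup F] [NormedSpace ℝ F]
    [CompleteSpace F] {g : Cn n → F} (hg : ContDiff ℝ 1 g) (hc : HasCompactSupport g) {ε : ℝ}
    (hε : 0 < ε) :
    fderiv ℝ (convolution (mollifier n ε) g (ContinuousLinearMap.lsmul ℝ ℝ) volume) =
      convolution (mollifier n ε) (fderiv ℝ g) (ContinuousLinearMap.lsmul ℝ ℝ) volume := by
  funext x
  rw [(hc.hasFDerivAt_convolution_right (ContinuousLinearMap.lsmul ℝ ℝ)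
    (integrable_mollifier hε).locallyIntegrable hg x).fderiv]
  rfl

/-- Derivatives commute with convolution, and the Hessian of `g` is uniformly continuous because its
support is compact. -/
lemma eventually_hess_mol {g : Cn n → ℝ} (hg : ContDiff ℝ 2 g) (hc : HasCompactSupport g)
    {η : ℝ} (hη : 0 < η) : ∀ᶠ ε in 𝓝[>] (0 : ℝ), ∀ x, ‖hess (mol ε g) x - hess g x‖ ≤ η := by
  have hd1 : ContDiff ℝ 1 (fderiv ℝ g) := hg.fderiv_right (by norm_num)
  have hcont : Continuous (hess g) := hd1.continuous_fderiv (by norm_num)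
  have hcs : HasCompactSupport (hess g) := (hc.fderiv (𝕜 := ℝ)).fderiv (𝕜 := ℝ)
  obtain ⟨δ, hδ, hu⟩ := Metric.uniformContinuous_iff.1 (hcs.uniformContinuous_of_continuous hcont) η hη
  filter_upwards [Ioc_mem_nhdsGT hδ] with ε hε x
  rw [hess, mol_eq_convolution, fderiv_convolution_mollifier (hg.of_le (by norm_num)) hc hε.1,
    fderiv_convolution_mollifier hd1 (hc.fderiv (𝕜 := ℝ)) hε.1, ← dist_eq_norm]
  refine dist_convolution_le hη.le (support_mollifier hε.1) (mollifier_nonneg hε.1)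
    (integral_mollifier hε.1) hcont.aestronglyMeasurable fun y hy => (hu ?_).le
  exact (Metric.mem_ball.1 hy).trans_le hε.2

end Levi

/-! ### Truncated plurisubharmonic functions and comparison almost everywhere. -/

section RealPSH

variable {n : ℕ} {U : Set (Cn n)}

/-- Real valued plurisubharmonic functions which are bounded below. -/
structure RealPSH (U : Set (Cn n)) (f : Cn n → ℝ) : Prop where
  usc : UpperSemicontinuousOn f U
  le_average : ∀ z ∈ U, ∀ w : Cn n, (∀ ζ : ℂ, ‖ζ‖ ≤ 1 → z + ζ • w ∈ U) →
    f z ≤ Real.circleAverage (fun ζ : ℂ => f (z + ζ • w)) 0 1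
  bddBelow : ∃ c, ∀ z ∈ U, c ≤ f z

lemma UpperSemicontinuousOn.isOpen_sublevel {β : Type*} [Preorder β] {f : Cn n → β} (hU : IsOpen U)
    (hf : UpperSemicontinuousOn f U) (c : β) : IsOpen {x ∈ U | f x < c} := by
  rw [isOpen_iff_mem_nhds]
  rintro x ⟨hx, hc⟩
  have := hf x hx c hc
  rw [hU.nhdsWithin_eq hx] at this
  filter_upwards [this, hU.mem_nhds hx] with y h1 h2 using ⟨h2, h1⟩

lemma RealPSH.measurable_indicator {f : Cn n → ℝ} (hU : IsOpen U) (hf : RealPSH U f)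
    {K : Set (Cn n)} (hK : MeasurableSet K) (hKU : K ⊆ U) : Measurable (K.indicator f) := by
  refine measurable_of_Iio fun c => ?_
  have e : K.indicator f ⁻¹' Set.Iio c =
      (K ∩ {x ∈ U | f x < c}) ∪ (Kᶜ ∩ {_x | 0 < c}) := by
    ext x
    by_cases hx : x ∈ K
    · simp [hx, hKU hx]
    · simp [hx]
  rw [e]
  exact (hK.inter (UpperSemicontinuousOn.isOpen_sublevel hU hf.usc c).measurableSet).union
    (hK.compl.inter (MeasurableSet.const _))

lemma RealPSH.bddMeas_indicator {f : Cn n → ℝ} (hU : IsOpen U) (hf : RealPSH U f)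
    {K : Set (Cn n)} (hK : IsCompact K) (hKU : K ⊆ U) : BddMeas (K.indicator f) := by
  refine ⟨hf.measurable_indicator hU hK.measurableSet hKU, ?_⟩
  obtain ⟨A, hA⟩ := (hf.usc.mono hKU).bddAbove_of_isCompact hK
  obtain ⟨c, hc⟩ := hf.bddBelow
  refine ⟨max |A| |c|, fun x => ?_⟩
  by_cases hx : x ∈ K
  · rw [Set.indicator_of_mem hx]
    exact abs_le_max_abs_abs (hc x (hKU hx)) (hA ⟨x, hx, rfl⟩) |>.trans_eq (max_comm _ _)
  · rw [Set.indicator_of_notMem hx, abs_zero]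
    positivity

lemma RealPSH.submean_indicator {f : Cn n → ℝ} (hf : RealPSH U f) {K : Set (Cn n)} (hKU : K ⊆ U)
    {z : Cn n} {r : ℝ} (hr : 0 ≤ r) (hz : Metric.closedBall z r ⊆ K) : Submean (K.indicator f) z r := by
  intro w hw
  have hd : ∀ ζ : ℂ, ‖ζ‖ ≤ 1 → z + ζ • w ∈ K := by
    intro ζ hζ
    refine hz ?_
    rw [mem_closedBall_iff_norm, add_sub_cancel_left, norm_smul]
    exact (mul_le_of_le_one_left (norm_nonneg _) hζ).trans hw
  have hzK : z ∈ K := hz (Metric.mem_closedBall_self hr)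
  rw [Set.indicator_of_mem hzK]
  refine (hf.le_average z (hKU hzK) w fun ζ hζ => hKU (hd ζ hζ)).trans_eq ?_
  refine Real.circleAverage_congr_sphere fun ζ hζ => ?_
  have h1 : ‖ζ‖ = 1 := by simpa using hζ
  exact (Set.indicator_of_mem (hd ζ h1.le) f).symm

lemma RealPSH.usc_indicator {f : Cn n → ℝ} (hf : RealPSH U f) {K : Set (Cn n)} (hKU : K ⊆ U)
    {z : Cn n} (hz : z ∈ interior K) : UpperSemicontinuousAt (K.indicator f) z := by
  intro c hc
  have hK := mem_interior_iff_mem_nhds.1 hz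
  have hzK := interior_subset hz
  rw [Set.indicator_of_mem hzK] at hc
  have := hf.usc z (hKU hzK) c hc
  rw [nhdsWithin_eq_nhds.2 (mem_of_superset hK hKU)] at this
  filter_upwards [this, hK] with y h1 h2
  rwa [Set.indicator_of_mem h2]

/-- The real valued truncation `max u (-N)`. -/
def trunc (u : Cn n → EReal) (N : ℕ) (z : Cn n) : ℝ :=
  (max (u z) (((-(N : ℝ)) : ℝ) : EReal)).toReal

lemma coe_trunc {u : Cn n → EReal} {N : ℕ} {z : Cn n} (hz : u z ≠ ⊤) :
    ((trunc u N z : ℝ) : EReal) = max (u z) (((-(N : ℝ)) : ℝ) : EReal) := by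
  refine EReal.coe_toReal ?_ ?_
  · exact (max_lt (lt_top_iff_ne_top.2 hz) (EReal.coe_lt_top _)).ne
  · exact ((EReal.bot_lt_coe _).trans_le (le_max_right _ _)).ne'

lemma usc_trunc {u : Cn n → EReal} (hu : ∀ z ∈ U, u z ≠ ⊤) (h : UpperSemicontinuousOn u U) (N : ℕ) :
    UpperSemicontinuousOn (trunc u N) U := by
  intro z hz c hc
  change trunc u N z < c at hc
  rw [← EReal.coe_lt_coe_iff, coe_trunc (hu z hz), max_lt_iff] at hc
  filter_upwards [h z hz c hc.1, self_mem_nhdsWithin] with y h1 h2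
  change trunc u N y < c
  rw [← EReal.coe_lt_coe_iff, coe_trunc (hu y h2), max_lt_iff]
  exact ⟨h1, hc.2⟩

lemma PSHOn.realPSH_trunc {u : Cn n → EReal} (hu : PSHOn U u) (N : ℕ) : RealPSH U (trunc u N) := by
  have hlow : ∀ z ∈ U, -(N : ℝ) ≤ trunc u N z := fun z hz => by
    rw [← EReal.coe_le_coe_iff, coe_trunc (hu.ne_top z hz)]
    exact le_max_right _ _
  refine ⟨usc_trunc hu.ne_top hu.usc N, fun z hz w hw => ?_, _, hlow⟩
  rw [← EReal.coe_le_coe_iff, coe_trunc (hu.ne_top z hz)]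
  refine max_le (hu.le_average z hz w hw N) (EReal.coe_le_coe_iff.2 ?_)
  have hS : ∀ ζ ∈ Metric.sphere (0 : ℂ) |1|, z + ζ • w ∈ U := fun ζ hζ => hw ζ (by
    have : ‖ζ‖ = 1 := by simpa using hζ
    exact this.le)
  by_cases hci : CircleIntegrable (fun ζ : ℂ => trunc u N (z + ζ • w)) 0 1
  · rw [← Real.circleAverage_const (-(N : ℝ)) (0 : ℂ) 1]
    exact Real.circleAverage_mono (circleIntegrable_const _ _ _) hci fun ζ hζ => hlow _ (hS ζ hζ)
  -- The average of a function that is not circle integrable is `0` by convention, which is still at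
  -- least `-N`.
  · rw [Real.circleAverage.integral_undef hci]
    simp

lemma PSHOn.realPSH_of_bounded {f : Cn n → ℝ} (hf : PSHOn U fun z => ((f z : ℝ) : EReal)) {M : ℝ}
    (hM : ∀ z ∈ U, |f z| ≤ M) : RealPSH U f := by
  obtain ⟨N, hN⟩ := exists_nat_ge M
  have h := hf.realPSH_trunc N
  have e : ∀ z ∈ U, trunc (fun z => ((f z : ℝ) : EReal)) N z = f z := by
    intro z hz
    rw [← EReal.coe_eq_coe_iff, coe_trunc (EReal.coe_ne_top _), max_eq_left]
    rw [EReal.coe_le_coe_iff]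
    have := (abs_le.1 (hM z hz)).1
    linarith
  refine ⟨fun z hz c hc => ?_, fun z hz w hw => ?_, -M, fun z hz => (abs_le.1 (hM z hz)).1⟩
  · change f z < c at hc
    rw [← e z hz] at hc
    filter_upwards [h.usc z hz c hc, self_mem_nhdsWithin] with y h1 h2
    change trunc _ N y < c at h1
    rwa [e y h2] at h1
  · rw [← e z hz]
    refine (h.le_average z hz w hw).trans_eq (Real.circleAverage_congr_sphere fun ζ hζ => ?_)
    have : ‖ζ‖ = 1 := by simpa using hζ
    exact e _ (hw ζ this.le)

/-- Both values are limits of mollifications, and these ignore null sets. -/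
lemma RealPSH.le_of_ae_le {f g : Cn n → ℝ} (hU : IsOpen U) (hf : RealPSH U f) (hg : RealPSH U g)
    (h : ∀ᵐ z, z ∈ U → f z ≤ g z) {z : Cn n} (hz : z ∈ U) : f z ≤ g z := by
  obtain ⟨r, hr, hb⟩ := Metric.nhds_basis_closedBall.mem_iff.1 (hU.mem_nhds hz)
  set K := Metric.closedBall z r
  have hK : IsCompact K := isCompact_closedBall z r
  have hzK : z ∈ K := Metric.mem_closedBall_self hr.le
  have h1 := tendsto_mol (hf.bddMeas_indicator hU hK hb) hr (hf.submean_indicator hb hr.le subset_rfl)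
    (hf.usc_indicator hb (mem_interior_iff_mem_nhds.2 (Metric.closedBall_mem_nhds z hr)))
  have h2 := tendsto_mol (hg.bddMeas_indicator hU hK hb) hr (hg.submean_indicator hb hr.le subset_rfl)
    (hg.usc_indicator hb (mem_interior_iff_mem_nhds.2 (Metric.closedBall_mem_nhds z hr)))
  rw [Set.indicator_of_mem hzK] at h1 h2
  refine le_of_tendsto_of_tendsto h1 h2 ?_
  filter_upwards [self_mem_nhdsWithin] with ε hε
  refine mol_mono_of_ae (hf.bddMeas_indicator hU hK hb) (hg.bddMeas_indicator hU hK hb) hε ?_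
  filter_upwards [h] with y hy _
  by_cases hyK : y ∈ K
  · rw [Set.indicator_of_mem hyK, Set.indicator_of_mem hyK]
    exact hy (hb hyK)
  · simp [hyK]

lemma PSHOn.mono {u : Cn n → EReal} (hu : PSHOn U u) {V : Set (Cn n)} (hV : V ⊆ U) : PSHOn V u :=
  ⟨fun z hz => hu.ne_top z (hV hz), hu.usc.mono hV,
    fun z hz w h => hu.le_average z (hV hz) w fun ζ hζ => hV (h ζ hζ)⟩

/-- Plurisubharmonic functions are compared everywhere if they are compared almost everywhere. -/
lemma PSHOn.le_of_ae_le {u v : Cn n → EReal} (hU : IsOpen U) (hv : PSHOn U v) (hu : PSHOn U u)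
    (h : ∀ᵐ z, z ∈ U → v z ≤ u z) {z : Cn n} (hz : z ∈ U) : v z ≤ u z := by
  have key : ∀ N : ℕ, v z ≤ max (u z) (((-(N : ℝ)) : ℝ) : EReal) := by
    intro N
    have h1 : trunc v N z ≤ trunc u N z := by
      refine (hv.realPSH_trunc N).le_of_ae_le hU (hu.realPSH_trunc N) ?_ hz
      filter_upwards [h] with y hy hyU
      rw [← EReal.coe_le_coe_iff, coe_trunc (hv.ne_top y hyU), coe_trunc (hu.ne_top y hyU)]
      exact max_le_max (hy hyU) le_rfl
    rw [← EReal.coe_le_coe_iff, coe_trunc (hv.ne_top z hz), coe_trunc (hu.ne_top z hz)] at h1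
    exact (le_max_left _ _).trans h1
  by_contra hlt
  push Not at hlt
  -- A real number strictly between `u z` and `v z`: once `-N ≤ c`, the truncation level too lies
  -- below `v z`, against `key`.
  obtain ⟨c, hc1, hc2⟩ := EReal.lt_iff_exists_real_btwn.1 hlt
  obtain ⟨N, hN⟩ := exists_nat_ge (-c)
  refine absurd (key N) (not_le.2 (max_lt hlt (lt_of_le_of_lt ?_ hc2)))
  rw [EReal.coe_le_coe_iff]
  linarith

end RealPSH

/-! ### The Bedford-Taylor product `dd^c u ∧ T` for bounded plurisubharmonic `u`. -/

section BedfordTaylor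

variable {n m p : ℕ} {Ω : TopologicalSpace.Opens (Cn n)}

lemma test_eq_zero {F : Type*} [NormedAddCommGroup F] [NormedSpace ℝ F] (φ : 𝓓(Ω, F)) {x : Cn n}
    (hx : x ∉ tsupport φ) : φ x = 0 := image_eq_zero_of_notMem_tsupport hx

lemma ddcTest_eq_zero (φ : TestForm Ω m) {x : Cn n} (hx : x ∉ tsupport φ) : ddcTest φ x = 0 := by
  rw [ddcTest_apply, ddc_eq (contDiff_nat φ.contDiff 2)]
  have h0 : fderiv ℝ (fderiv ℝ φ) x = 0 :=
    image_eq_zero_of_notMem_tsupport fun h => hx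
      (tsupport_fderiv_subset ℝ (tsupport_fderiv_subset ℝ h))
  rw [h0, map_zero, map_zero]

lemma IsRepresentedBy.integrable {T : Current Ω m} {μ : Measure (Cn n)}
    {τ : Cn n → (Form n m →L[ℝ] ℝ)} (h : IsRepresentedBy T μ τ) (φ : TestForm Ω m) :
    Integrable (fun x => τ x (φ x)) μ := by
  set b := Module.finBasis ℝ (Form n m)
  set c := fun k => TestFunction.postcompCLM (LinearMap.toContinuousLinearMap (b.coord k)) φ
  have h2 : ∀ x, τ x (φ x) = ∑ k, c k x * τ x (b k) := by
    intro x
    conv_lhs => rw [← b.sum_repr (φ x), map_sum]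
    exact Finset.sum_congr rfl fun k _ => map_smul (τ x) _ _
  simp_rw [h2]
  exact integrable_finsetSum _ fun k _ =>
    (c k).integrable_bilin (ContinuousLinearMap.mul ℝ ℝ) (h.locallyIntegrable (b k))

/-- The regularizations `u_ε` of the restriction of a plurisubharmonic function to a compact set
converge, in the sense needed for the product with a current. -/
lemma eventually_mulTest_ddcTest {T : Current Ω (m + 2)} {μ : Measure (Cn n)}
    {τ : Cn n → (Form n (m + 2) →L[ℝ] ℝ)} (h : IsRepresentedBy T μ τ) {u : Cn n → ℝ}
    (hu : RealPSH (Ω : Set (Cn n)) u) {K : Set (Cn n)} (hK : IsCompact K) (hKΩ : K ⊆ Ω) {r : ℝ}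
    (hr : 0 < r) {φ : TestForm Ω m} (hφ : ∀ x ∈ tsupport φ, Metric.closedBall x r ⊆ K) :
    Tendsto (fun ε => ∫ x, mol ε (K.indicator u) x * τ x (ddcTest φ x) ∂μ) (𝓝[>] 0)
      (𝓝 (∫ x, u x * τ x (ddc φ x) ∂μ)) := by
  have hb := hu.bddMeas_indicator Ω.isOpen hK hKΩ
  obtain ⟨M, hM⟩ := hb.bdd
  have hi := h.integrable (ddcTest φ)
  refine tendsto_integral_filter_of_dominated_convergence
    (fun x => M * ‖τ x (ddcTest φ x)‖) ?_ ?_ (hi.norm.const_mul M) ?_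
  · filter_upwards [self_mem_nhdsWithin] with ε hε
    exact (contDiff_mol hb hε).continuous.aestronglyMeasurable.mul hi.aestronglyMeasurable
  · filter_upwards [self_mem_nhdsWithin] with ε hε
    refine ae_of_all _ fun x => ?_
    rw [norm_mul]
    exact mul_le_mul_of_nonneg_right (abs_mol_le hb hε hM) (norm_nonneg _)
  · refine ae_of_all _ fun x => ?_
    rw [← ddcTest_apply]
    by_cases hx : x ∈ tsupport φ
    · refine Tendsto.mul_const _ ?_
      have := tendsto_mol hb hr (hu.submean_indicator hKΩ hr.le (hφ x hx))
        (hu.usc_indicator hKΩ (mem_interior_iff_mem_nhds.2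
          (mem_of_superset (Metric.closedBall_mem_nhds x hr) (hφ x hx))))
      rwa [Set.indicator_of_mem (hφ x hx (Metric.mem_closedBall_self hr.le))] at this
    · rw [ddcTest_eq_zero φ hx]
      simp

lemma RealPSH.leviNonneg_mol {U : Set (Cn n)} {u : Cn n → ℝ} (hU : IsOpen U) (hu : RealPSH U u)
    {K : Set (Cn n)} (hK : IsCompact K) (hKU : K ⊆ U) {x : Cn n} {r ε : ℝ}
    (hx : Metric.closedBall x r ⊆ K) (hε : 0 < ε) (hεr : ε < r) :
    LeviNonneg (hess (mol ε (K.indicator u)) x) := by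
  have hb := hu.bddMeas_indicator hU hK hKU
  refine Submean.leviNonneg (contDiff_nat (contDiff_mol hb hε) 2) (sub_pos.2 hεr)
    (Submean.mol hb hε fun y hy => hu.submean_indicator hKU (sub_pos.2 hεr).le ?_)
  refine subset_trans (Metric.closedBall_subset_closedBall' ?_) hx
  rw [dist_eq_norm, sub_sub_cancel_left, norm_neg]
  linarith

lemma IsClosedPositive.dTest {T : Current Ω (2 * (p + 1))} (hT : IsClosedPositive T)
    (ψ : TestForm Ω (2 * p + 1)) : T (Pluri.dTest ψ) = 0 :=
  hT.closed ψ (Pluri.dTest ψ) (dTest_apply ψ)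

lemma IsClosedPositive.pullTest {T : Current Ω (2 * p)} (hT : IsClosedPositive T) {c : ℂ}
    (hc : ‖c‖ = 1) (φ : TestForm Ω (2 * p)) : T (Pluri.pullTest c φ) = T φ :=
  hT.bidim.pull hc (pullTest_apply c φ)

lemma IsClosedPositive.by_parts {T : Current Ω (2 * (p + 1))} (hT : IsClosedPositive T)
    (w : Cn n → ℝ) (hw : ContDiff ℝ (⊤ : ℕ∞) w) (φ : TestForm Ω (2 * p)) :
    T (mulTest w hw (ddcTest φ)) = T (hessTest w hw φ) :=
  current_ddc_by_parts (m := 2 * p) (T := (T : TestForm Ω (2 * (p + 1)) →ₗ[ℝ] ℝ)) hT.dTest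
    (hT.pullTest (by simp)) w hw φ

/-- Ensures that `ddcWedge` does not take its default value: a bounded `u` keeps the density `u τ`
locally integrable. -/
lemma exists_isDDcWedge {T : Current Ω (2 * (p + 1))} (hT : IsClosedPositive T) {u : Cn n → ℝ}
    (hu : RealPSH (Ω : Set (Cn n)) u) {M : ℝ} (hM : ∀ x ∈ Ω, |u x| ≤ M) :
    ∃ S, IsDDcWedge (m := 2 * p) u T S := by
  obtain ⟨μ, τ, h⟩ := exists_isPosRep hT.bidim hT.positive
  obtain ⟨C, hC⟩ := h.bound
  have hm := hu.measurable_indicator Ω.isOpen Ω.isOpen.measurableSet subset_rfl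
  have hl : LocallyIntegrableOn (fun x => (Ω : Set (Cn n)).indicator u x • τ x) (Ω : Set (Cn n)) μ := by
    refine h.radon.locallyIntegrableOn (C := M * C)
      (hm.stronglyMeasurable.smul h.meas).aestronglyMeasurable fun x hx => ?_
    rw [norm_smul, Set.indicator_of_mem (show x ∈ (Ω : Set (Cn n)) from hx)]
    exact mul_le_mul (hM x hx) (hC x) (norm_nonneg _) ((abs_nonneg _).trans (hM x hx))
  let I : Current Ω (2 * p + 2) := TestFunction.integralAgainstBilinCLM
    (ContinuousLinearMap.apply ℝ ℝ) μ (fun x => (Ω : Set (Cn n)).indicator u x • τ x)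
  refine ⟨I.comp ddcTest, μ, τ, h.isRepresentedBy, fun φ => ?_⟩
  change I (ddcTest φ) = _
  rw [TestFunction.integralAgainstBilinCLM_eq_integral hl]
  refine integral_congr_ae (ae_of_all _ fun x => ?_)
  simp only [ContinuousLinearMap.apply_apply, smul_apply, smul_eq_mul, ← ddcTest_apply]
  by_cases hx : x ∈ Ω
  · rw [Set.indicator_of_mem (show x ∈ (Ω : Set (Cn n)) from hx)]
  · rw [ddcTest_eq_zero φ fun h => hx (φ.tsupport_subset h)]
    simp

lemma ddcWedge_spec {u : Cn n → ℝ} {T : Current Ω (m + 2)} (h : ∃ S, IsDDcWedge u T S) :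
    IsDDcWedge u T (ddcWedge u T) := by
  rw [ddcWedge, dif_pos h]
  exact h.choose_spec

/-- The current `dd^c u ∧ T` is a limit of the currents `dd^c u_ε ∧ T`. -/
lemma eventually_hessTest_mem {T : Current Ω (2 * (p + 1))} (hT : IsClosedPositive T) {u : Cn n → ℝ}
    (hu : RealPSH (Ω : Set (Cn n)) u) {M : ℝ} (hM : ∀ x ∈ Ω, |u x| ≤ M)
    {K : Set (Cn n)} (hK : IsCompact K) (hKΩ : K ⊆ Ω) {r : ℝ} (hr : 0 < r) {φ : TestForm Ω (2 * p)}
    (hφ : ∀ x ∈ tsupport φ, Metric.closedBall x r ⊆ K) {s : Set ℝ}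
    (hs : s ∈ 𝓝 (ddcWedge (m := 2 * p) u T φ)) :
    ∀ᶠ ε in 𝓝[>] (0 : ℝ), ∀ hw : ContDiff ℝ (⊤ : ℕ∞) (mol ε (K.indicator u)),
      T (hessTest _ hw φ) ∈ s := by
  obtain ⟨μ, τ, h, hS⟩ := ddcWedge_spec (exists_isDDcWedge hT hu hM)
  rw [hS] at hs
  filter_upwards [eventually_mulTest_ddcTest h hu hK hKΩ hr hφ hs] with ε hε hw
  rw [← hT.by_parts _ hw φ]
  have e : T (mulTest (m := 2 * p + 2) _ hw (ddcTest φ)) =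
      ∫ x, mol ε (K.indicator u) x * τ x (ddcTest φ x) ∂μ := by
    refine (h.eq_integral _).trans (integral_congr_ae (ae_of_all _ fun x => ?_))
    simp only [mulTest_apply, map_smul, smul_eq_mul]
  rw [e]
  exact hε

lemma exists_compact_closedBall (φ : TestForm Ω m) : ∃ K : Set (Cn n), IsCompact K ∧ K ⊆ Ω ∧
    ∃ r > 0, ∀ x ∈ tsupport φ, Metric.closedBall x r ⊆ K := by
  have hc : IsCompact (tsupport φ) := φ.hasCompactSupport
  obtain ⟨r, hr, h⟩ := hc.exists_cthickening_subset_open Ω.isOpen φ.tsupport_subset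
  exact ⟨_, hc.cthickening, h, r, hr, fun x hx => Metric.closedBall_subset_cthickening hx r⟩

lemma isPosForm_zero : IsPosForm (0 : Form n (2 * p)) := fun t _ => (map_zero t).ge

/-- Bidegree and positivity hold for the smooth products `dd^c u_ε ∧ T` and survive the weak limit;
closedness follows from `dd^c d = 0`. -/
theorem IsClosedPositive.ddcWedge {T : Current Ω (2 * (p + 1))} (hT : IsClosedPositive T)
    {u : Cn n → ℝ} (hu : RealPSH (Ω : Set (Cn n)) u) {M : ℝ} (hM : ∀ x ∈ Ω, |u x| ≤ M) :
    IsClosedPositive (p := p) (Pluri.ddcWedge (m := 2 * p) u T) := by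
  refine ⟨fun θ φ ψ hψ => ?_, fun α χ hχ => ?_, ?_⟩
  · have hc : ‖Complex.exp (θ * Complex.I)‖ = 1 := Complex.norm_exp_ofReal_mul_I θ
    obtain ⟨K, hK, hKΩ, r, hr, h1⟩ := exists_compact_closedBall φ
    obtain ⟨K', hK', hKΩ', r', hr', h2⟩ := exists_compact_closedBall ψ
    have hb := hu.bddMeas_indicator Ω.isOpen (hK.union hK') (Set.union_subset hKΩ hKΩ')
    have hr'' : 0 < min r r' := lt_min hr hr'
    -- Disjoint neighbourhoods would separate two different values, while for small `ε` the
    -- approximations of both are one and the same number.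
    by_contra hne
    obtain ⟨s, t, hs, ht, hst⟩ := t2_separation_nhds hne
    obtain ⟨ε, ⟨h3, h4⟩, hε⟩ := (((eventually_hessTest_mem hT hu hM (hK.union hK')
      (Set.union_subset hKΩ hKΩ') hr'' (fun x hx => (Metric.closedBall_subset_closedBall
        (min_le_right _ _)).trans ((h2 x hx).trans Set.subset_union_right)) hs).and
      (eventually_hessTest_mem hT hu hM (hK.union hK')
      (Set.union_subset hKΩ hKΩ') hr'' (fun x hx => (Metric.closedBall_subset_closedBall
        (min_le_left _ _)).trans ((h1 x hx).trans Set.subset_union_left)) ht)).and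
      self_mem_nhdsWithin).exists
    have hw := contDiff_mol hb hε
    have e : hessTest _ hw ψ = Pluri.pullTest (Complex.exp (θ * Complex.I)) (hessTest _ hw φ) := by
      ext1 x
      rw [hessTest_apply, pullTest_apply, hessTest_apply, hψ, pull_hessWedge hc]
      exact snd_fderiv_symm (contDiff_nat hw 2) x
    have h5 := h3 hw
    rw [e, hT.pullTest (p := p + 1) hc] at h5
    exact Set.disjoint_left.1 hst h5 (h4 hw)
  · obtain ⟨μ, τ, h⟩ := exists_isPosRep hT.bidim hT.positive
    obtain ⟨K, hK, hKΩ, r, hr, h1⟩ := exists_compact_closedBall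
      (smulForm χ (elementaryForm α : Form n (2 * p)))
    have hb := hu.bddMeas_indicator Ω.isOpen hK hKΩ
    by_contra hneg
    push Not at hneg
    obtain ⟨ε, hε, h2⟩ := ((eventually_hessTest_mem hT hu hM hK hKΩ hr h1
      (Iio_mem_nhds hneg)).and (Ioo_mem_nhdsGT hr)).exists
    refine absurd (hε (contDiff_mol hb h2.1)) (not_lt.2 (h.nonneg fun x => ?_))
    change IsPosForm (p := p + 1) (hessWedge _ _)
    by_cases hx : x ∈ tsupport (smulForm χ (elementaryForm α : Form n (2 * p)))
    · exact IsPosForm.hessWedge (snd_fderiv_symm (contDiff_nat (contDiff_mol hb h2.1) 2) x)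
        (hu.leviNonneg_mol Ω.isOpen hK hKΩ (h1 x hx) h2.1 h2.2)
        ((isPosForm_elementaryForm α).smul (hχ x))
    · rw [test_eq_zero _ hx, map_zero]
      exact isPosForm_zero (p := p + 1)
  · obtain ⟨μ, τ, h, hS⟩ := ddcWedge_spec (exists_isDDcWedge hT hu hM)
    cases p with
    | zero => trivial
    | succ p =>
      intro φ ψ hψ
      rw [hS]
      have : ⇑ψ = extDeriv φ := funext hψ
      rw [this]
      simp only [ddc_extDeriv (contDiff_nat φ.contDiff 3), map_zero, mul_zero, integral_zero]

end BedfordTaylor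

/-! ### The smooth estimate: exchanging the factors `ω` for factors `dd^c w`. -/

section ChainEstimate

variable {n m p : ℕ} {Ω : TopologicalSpace.Opens (Cn n)}

/-- Smooth functions on `ℂⁿ`. -/
abbrev SmoothFn (n : ℕ) : Type := {w : Cn n → ℝ // ContDiff ℝ (⊤ : ℕ∞) w}

/-- The functional `T ↦ dd^c w ∧ T` for a smooth function `w`. -/
def contract (w : SmoothFn n) (L : TestForm Ω (m + 2) →ₗ[ℝ] ℝ) : TestForm Ω m →ₗ[ℝ] ℝ where
  toFun φ := L (hessTest w.1 w.2 φ)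
  map_add' φ ψ := by
    rw [← map_add]
    congr 1
    ext1 x
    exact map_add (hessWedge (hess w.1 x)) (φ x) (ψ x)
  map_smul' c φ := by
    rw [← map_smul]
    congr 1
    ext1 x
    exact map_smul (hessWedge (hess w.1 x)) c (φ x)

/-- Closed linear functionals on test forms of even degree. -/
def IsClosedLin : {p : ℕ} → (TestForm Ω (2 * p) →ₗ[ℝ] ℝ) → Prop
  | 0, _ => True
  | p + 1, L => ∀ ψ : TestForm Ω (2 * p + 1), L (dTest ψ) = 0

/-- Closed, rotation invariant functionals which are positive on forms vanishing off `E`. -/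
structure IsClosedPosOn (E : Set (Cn n)) (L : TestForm Ω (2 * p) →ₗ[ℝ] ℝ) : Prop where
  closed : IsClosedLin L
  inv : ∀ c : ℂ, ‖c‖ = 1 → ∀ φ, L (pullTest c φ) = L φ
  pos : ∀ φ, (∀ x ∉ E, φ x = 0) → (∀ x, IsPosForm (φ x)) → 0 ≤ L φ

lemma IsClosedPositive.isClosedPosOn {T : Current Ω (2 * p)} (hT : IsClosedPositive T)
    (E : Set (Cn n)) : IsClosedPosOn E (T : TestForm Ω (2 * p) →ₗ[ℝ] ℝ) := by
  obtain ⟨μ, τ, h⟩ := exists_isPosRep hT.bidim hT.positive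
  refine ⟨?_, fun c hc φ => hT.pullTest hc φ, fun φ _ hφ => h.nonneg hφ⟩
  cases p with
  | zero => trivial
  | succ p => exact hT.dTest

lemma IsClosedPosOn.by_parts {E : Set (Cn n)} {L : TestForm Ω (2 * (p + 1)) →ₗ[ℝ] ℝ}
    (hL : IsClosedPosOn E L) (w : SmoothFn n) (φ : TestForm Ω (2 * p)) :
    L (mulTest w.1 w.2 (ddcTest φ)) = L (hessTest w.1 w.2 φ) :=
  current_ddc_by_parts (m := 2 * p) hL.closed (hL.inv _ (by simp)) w.1 w.2 φ

lemma SmoothFn.hess_symm (w : SmoothFn n) (x v v' : Cn n) : hess w.1 x v v' = hess w.1 x v' v :=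
  snd_fderiv_symm (contDiff_nat w.2 2) x v v'

/-- Closedness comes from `L (dd^c w ∧ dψ) = L (w dd^c dψ) = 0`. Positivity of `dd^c w` is only
available on `E`, which is why positivity is tested on forms vanishing off `E`. -/
lemma IsClosedPosOn.contract {E : Set (Cn n)} {L : TestForm Ω (2 * (p + 1)) →ₗ[ℝ] ℝ}
    (hL : IsClosedPosOn E L) {w : SmoothFn n} (hw : ∀ x ∈ E, LeviNonneg (hess w.1 x)) :
    IsClosedPosOn (p := p) E (contract (m := 2 * p) w L) := by
  refine ⟨?_, fun c hc φ => ?_, fun φ hφ hpos => hL.pos _ (fun x hx => ?_) fun x => ?_⟩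
  · cases p with
    | zero => trivial
    | succ p =>
      intro ψ
      change L (hessTest (m := 2 * (p + 1)) w.1 w.2 (dTest ψ)) = 0
      rw [← hL.by_parts]
      refine (congrArg L ?_).trans (map_zero L)
      ext1 x
      rw [mulTest_apply, ddcTest_apply]
      have : ⇑(dTest ψ) = extDeriv ψ := funext fun y => dTest_apply ψ y
      rw [this, ddc_extDeriv (contDiff_nat ψ.contDiff 3), smul_zero]
      rfl
  · change L (hessTest (m := 2 * p) w.1 w.2 (pullTest c φ)) = L (hessTest (m := 2 * p) w.1 w.2 φ)
    rw [← hL.inv c hc (hessTest (m := 2 * p) w.1 w.2 φ)]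
    congr 1
    ext1 x
    exact (pull_hessWedge hc (w.hess_symm x) (φ x)).symm
  · change Pluri.hessWedge _ _ = _
    rw [hφ x hx, map_zero]
  · change IsPosForm (p := p + 1) (Pluri.hessWedge _ _)
    by_cases hx : x ∈ E
    · exact (hpos x).hessWedge (w.hess_symm x) (hw x hx)
    · rw [hφ x hx, map_zero]
      exact isPosForm_zero (p := p + 1)

lemma isPosForm_omegaPow (n p : ℕ) : IsPosForm (omegaPow n p) := by
  intro t ht
  rw [omegaPow, map_sum]
  refine Finset.sum_nonneg fun I _ => ?_
  rw [map_smul, smul_eq_mul]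
  exact mul_nonneg (by positivity) (ht _)

/-- The test form `χ h^k ω^p`. -/
def powForm (χ : 𝓓(Ω, ℝ)) (h : SmoothFn n) (k p : ℕ) : TestForm Ω (2 * p) :=
  mulTest (fun x => h.1 x ^ k) (h.2.pow k) (smulForm χ (omegaPow n p))

lemma powForm_apply (χ : 𝓓(Ω, ℝ)) (h : SmoothFn n) (k p : ℕ) (x : Cn n) :
    powForm χ h k p x = (h.1 x ^ k * χ x) • omegaPow n p := by
  rw [mul_smul]
  rfl

/-- For `k = 0` the exponent `k - 1` is truncated, but its term carries the factor `k`. Below, only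
the nonnegativity of the last term matters. -/
lemma hess_pow (h : SmoothFn n) (k : ℕ) (x v : Cn n) :
    hess (fun y => h.1 y ^ (k + 1)) x v v = (k + 1) * h.1 x ^ k * hess h.1 x v v +
      (k + 1) * k * h.1 x ^ (k - 1) * (fderiv ℝ h.1 x v) ^ 2 := by
  have hd : Differentiable ℝ h.1 := differentiable_of_smooth h.2
  have e : (fderiv ℝ fun y => h.1 y ^ (k + 1)) =
      fun y => ((k + 1 : ℝ) * h.1 y ^ k) • fderiv ℝ h.1 y := by
    funext y
    have := ((hd y).hasFDerivAt.pow (k + 1)).fderiv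
    rw [this]
    ext v
    simp
  have h1 : HasFDerivAt (fun y => (k + 1 : ℝ) * h.1 y ^ k)
      ((k + 1 : ℝ) • ((k * h.1 x ^ (k - 1)) • fderiv ℝ h.1 x)) x := by
    have := ((hd x).hasFDerivAt.pow k).const_mul (k + 1 : ℝ)
    refine this.congr_fderiv ?_
    ext v
    simp
  have h2 := h1.smul ((differentiable_of_smooth (contDiff_fderiv h.2)) x).hasFDerivAt
  rw [hess, e]
  erw [h2.fderiv]
  simp
  ring

lemma ddc_smul_const {g : Cn n → ℝ} (hg : ContDiff ℝ (⊤ : ℕ∞) g) (β : Form n m) (x : Cn n) :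
    ddc (fun y => g y • β) x = hessWedge (hess g x) β := by
  have hs : ContDiff ℝ 2 fun y => g y • β := (contDiff_nat hg 2).smul contDiff_const
  rw [ddc_eq hs, hessWedge_apply]
  congr 2
  have e : fderiv ℝ (fun y => g y • β) = fun y => (fderiv ℝ g y).smulRight β := by
    funext y
    exact ((differentiable_of_smooth hg y).hasFDerivAt.smul_const β).fderiv
  rw [e]
  have h1 := (differentiable_of_smooth (contDiff_fderiv hg) x).hasFDerivAt
  have h2 := ((ContinuousLinearMap.smulRightL ℝ (Cn n) (Form n m)).flip β).hasFDerivAt.comp x h1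
  exact h2.fderiv

/-- The basic estimate, obtained from two integrations by parts. -/
lemma powForm_succ_le {E : Set (Cn n)} {L : TestForm Ω (2 * (p + 1)) →ₗ[ℝ] ℝ}
    (hL : IsClosedPosOn E L) {χ : 𝓓(Ω, ℝ)} (hχ0 : ∀ x, 0 ≤ χ x) (hχE : ∀ x ∉ E, χ x = 0)
    {h w : SmoothFn n} (hh : ∀ x, 0 ≤ h.1 x) (hχ : ∀ x ∈ tsupport h.1, χ x = 1) {M : ℝ}
    (hM : ∀ x ∈ tsupport h.1, sqNorm x ≤ M) (hM0 : 0 ≤ M) (hw : ∀ x ∈ E, LeviNonneg (hess w.1 x))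
    (hhw : ∀ x ∈ tsupport h.1, LeviNonneg (hess h.1 x + hess w.1 x)) :
    L (powForm χ h (p + 1) (p + 1)) ≤ (p + 1) * M * L (hessTest w.1 w.2 (powForm χ h p p)) := by
  -- `dd^c ρ = ω`, and `-M ≤ ρ ≤ 0` on the support of `h`. One factor `ω` is written as `dd^c ρ` and
  -- moved by parts onto `h^(p+1)`; multiplying a lower bound of `dd^c h^(p+1)` by `ρ` gives an
  -- upper bound.
  let ρ : SmoothFn n := ⟨fun x => sqNorm x - M, contDiff_sqNorm.sub contDiff_const⟩
  have hρ : ∀ x, hess ρ.1 x = hess sqNorm x := by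
    intro x
    have : fderiv ℝ ρ.1 = fderiv ℝ sqNorm := funext fun y => fderiv_sub_const M
    rw [hess, this]
  have e1 : powForm χ h (p + 1) (p + 1) = hessTest ρ.1 ρ.2 (powForm χ h (p + 1) p) := by
    ext1 x
    rw [hessTest_apply, hρ, powForm_apply, powForm_apply, map_smul]
    exact congrArg _ (hessWedge_sqNorm_omegaPow p x).symm
  have hh0 : ∀ x ∉ tsupport h.1, h.1 x = 0 := fun x hx => image_eq_zero_of_notMem_tsupport hx
  have hg : ContDiff ℝ (⊤ : ℕ∞) fun x => h.1 x ^ (p + 1) := h.2.pow _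
  have e2 : ∀ x, ddcTest (powForm χ h (p + 1) p) x =
      hessWedge (hess (fun x => h.1 x ^ (p + 1)) x) (omegaPow n p) := by
    intro x
    have : ⇑(powForm χ h (p + 1) p) = fun y => h.1 y ^ (p + 1) • omegaPow n p := by
      funext y
      rw [powForm_apply]
      by_cases hy : y ∈ tsupport h.1
      · rw [hχ y hy, mul_one]
      · rw [hh0 y hy]
        simp
    rw [ddcTest_apply, this, ddc_smul_const hg]
  rw [e1, ← hL.by_parts ρ, ← sub_nonneg, ← smul_eq_mul, ← map_smul, ← map_sub]
  have hval : ∀ x, (((p : ℝ) + 1) * M) • hessTest w.1 w.2 (powForm χ h p p) x -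
      mulTest ρ.1 ρ.2 (ddcTest (powForm χ h (p + 1) p)) x =
      hessWedge ((((p : ℝ) + 1) * M * (h.1 x ^ p * χ x)) • hess w.1 x - ρ.1 x •
        hess (fun x => h.1 x ^ (p + 1)) x) (omegaPow n p) := by
    intro x
    rw [hessTest_apply, mulTest_apply, e2, powForm_apply, map_sub, map_smul, map_smul, map_smul,
      sub_apply, smul_apply, smul_apply, smul_smul]
  have hz : ∀ x ∉ tsupport h.1, hess (fun x => h.1 x ^ (p + 1)) x = 0 := by
    intro x hx
    have hsub : tsupport (fun x => h.1 x ^ (p + 1)) ⊆ tsupport h.1 :=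
      closure_mono fun y hy h0 => hy (by simp [h0])
    exact image_eq_zero_of_notMem_tsupport fun hx' => hx
      (hsub (tsupport_fderiv_subset ℝ (tsupport_fderiv_subset ℝ hx')))
  refine hL.pos _ (fun x hx => ?_) fun x => ?_
  · refine (hval x).trans ?_
    have hx' : x ∉ tsupport h.1 := fun h' => by
      have := hχ x h'
      rw [hχE x hx] at this
      exact zero_ne_one this
    rw [hz x hx', hχE x hx]
    simp
  · have hpos : IsPosForm (p := p + 1)
        (hessWedge ((((p : ℝ) + 1) * M * (h.1 x ^ p * χ x)) • hess w.1 x - ρ.1 x •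
        hess (fun x => h.1 x ^ (p + 1)) x) (omegaPow n p)) := by
      refine (isPosForm_omegaPow n p).hessWedge (fun v v' => ?_) fun v => ?_
      · have s1 := w.hess_symm x v v'
        have s2 := SmoothFn.hess_symm (⟨_, hg⟩ : SmoothFn n) x v v'
        simp only [sub_apply, smul_apply, s1, s2]
      · by_cases hx : x ∈ tsupport h.1
        · have hxE : x ∈ E := by
            by_contra hE
            have := hχ x hx
            rw [hχE x hE] at this
            exact zero_ne_one this
          have a1 := hw x hxE v
          have a2 := hhw x hx v
          have a3 := hM x hx
          have a4 : 0 ≤ sqNorm x := Finset.sum_nonneg fun _ _ => Complex.normSq_nonneg _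
          simp only [sub_apply, smul_apply, add_apply, smul_eq_mul, hess_pow, hχ x hx] at a1 a2 ⊢
          set A := hess w.1 x v v
          set A' := hess w.1 x (Complex.I • v) (Complex.I • v)
          set B := hess h.1 x v v
          set B' := hess h.1 x (Complex.I • v) (Complex.I • v)
          set D := fderiv ℝ h.1 x v
          set D' := fderiv ℝ h.1 x (Complex.I • v)
          have c1 : 0 ≤ ((p : ℝ) + 1) * h.1 x ^ p := by have := hh x; positivity
          have c2 : 0 ≤ ((p : ℝ) + 1) * p * h.1 x ^ (p - 1) * (D ^ 2 + D' ^ 2) := by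
            have := hh x
            positivity
          -- Up to nonnegative coefficients the difference is the sum of `|z|² dd^c w`, `(M - |z|²)
          -- dd^c (h + w)` and `(M - |z|²) dh ∧ d^c h`, each of them nonnegative.
          have b1 := mul_nonneg c1 (mul_nonneg a4 a1)
          have b2 := mul_nonneg c1 (mul_nonneg (sub_nonneg.2 a3) a2)
          have b3 := mul_nonneg (sub_nonneg.2 a3) c2
          have key : ∀ P Q s M : ℝ, P * M * A - (s - M) * (P * B + Q * D ^ 2) +
              (P * M * A' - (s - M) * (P * B' + Q * D' ^ 2)) =
              P * (s * (A + A')) + P * ((M - s) * (B + A + (B' + A'))) +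
                (M - s) * (Q * (D ^ 2 + D' ^ 2)) := by intros; ring
          have := key (((p : ℝ) + 1) * h.1 x ^ p) (((p : ℝ) + 1) * p * h.1 x ^ (p - 1)) (sqNorm x) M
          change 0 ≤ (((p : ℝ) + 1) * M * (h.1 x ^ p * 1) * A - (sqNorm x - M) * _) +
            (((p : ℝ) + 1) * M * (h.1 x ^ p * 1) * A' - (sqNorm x - M) * _)
          linarith
        · rw [hz x hx]
          by_cases hE : x ∈ E
          · have a1 := hw x hE v
            have c1 : 0 ≤ ((p : ℝ) + 1) * M * (h.1 x ^ p * χ x) := by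
              have := hh x
              have := hχ0 x
              positivity
            have := mul_nonneg c1 a1
            simp only [sub_apply, smul_apply, smul_zero, zero_apply, smul_eq_mul] at a1 ⊢
            linarith
          · simp [hχE x hE]
    rw [← hval] at hpos
    exact hpos

/-- Iterated contraction with smooth functions. -/
def contractPow : (w : ℕ → SmoothFn n) → (p : ℕ) → (TestForm Ω (2 * p) →ₗ[ℝ] ℝ) →
    (TestForm Ω 0 →ₗ[ℝ] ℝ)
  | _, 0, L => L
  | w, p + 1, L => contractPow (fun i => w (i + 1)) p (contract (m := 2 * p) (w 0) L)

/-- The test form `dd^c w_{p-1} ∧ ⋯ ∧ dd^c w_0 ∧ φ`. -/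
def hessPow (w : ℕ → SmoothFn n) (φ : TestForm Ω 0) : (p : ℕ) → TestForm Ω (2 * p)
  | 0 => φ
  | p + 1 => hessTest (m := 2 * p) (w p).1 (w p).2 (hessPow w φ p)

lemma hessTest_comm (w w' : SmoothFn n) (φ : TestForm Ω m) :
    hessTest w.1 w.2 (hessTest w'.1 w'.2 φ) = hessTest w'.1 w'.2 (hessTest w.1 w.2 φ) := by
  ext1 x
  exact hessWedge_comm _ _ _

/-- `contractPow` consumes the sequence from its front while `hessPow` appends at its end;
commutativity of the factors reconciles the two orders. -/
lemma hessTest_hessPow_shift (w : ℕ → SmoothFn n) (φ : TestForm Ω 0) : ∀ p,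
    hessTest (m := 2 * p) (w 0).1 (w 0).2 (hessPow (fun i => w (i + 1)) φ p) = hessPow w φ (p + 1)
  | 0 => rfl
  | p + 1 => by
    have ih := hessTest_hessPow_shift w φ p
    change hessTest (m := 2 * p + 2) _ _ (hessTest (m := 2 * p) _ _ _) =
      hessTest (m := 2 * p + 2) _ _ (hessPow w φ (p + 1))
    rw [hessTest_comm, ← ih]

lemma contractPow_apply : ∀ (p : ℕ) (w : ℕ → SmoothFn n) (L : TestForm Ω (2 * p) →ₗ[ℝ] ℝ)
    (φ : TestForm Ω 0), contractPow w p L φ = L (hessPow w φ p)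
  | 0, _, _, _ => rfl
  | p + 1, w, L, φ => by
    change contractPow _ p _ φ = _
    rw [contractPow_apply p, ← hessTest_hessPow_shift]
    rfl

/-- Iterates `powForm_succ_le`. After each step `h i` is replaced by the larger `h (i + 1)`, which
is adapted to the next function `w (i + 1)`; the factors `(p + 1) M` multiply up to `p! M^p`. -/
lemma contractPow_bound {E : Set (Cn n)} {χ : 𝓓(Ω, ℝ)} (hχ0 : ∀ x, 0 ≤ χ x)
    (hχE : ∀ x ∉ E, χ x = 0) {M : ℝ} (hM0 : 0 ≤ M) : ∀ (p : ℕ) (L : TestForm Ω (2 * p) →ₗ[ℝ] ℝ)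
    (_ : IsClosedPosOn E L) (h w : ℕ → SmoothFn n)
    (_ : ∀ i < p, ∀ x, 0 ≤ (h i).1 x) (_ : ∀ i < p, ∀ x ∈ tsupport (h i).1, χ x = 1)
    (_ : ∀ i < p, ∀ x ∈ tsupport (h i).1, sqNorm x ≤ M)
    (_ : ∀ i < p, ∀ x ∈ E, LeviNonneg (hess (w i).1 x))
    (_ : ∀ i < p, ∀ x ∈ tsupport (h i).1, LeviNonneg (hess (h i).1 x + hess (w i).1 x))
    (_ : ∀ i, i + 1 < p → ∀ x, (h i).1 x ≤ (h (i + 1)).1 x),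
    L (powForm χ (h 0) p p) ≤ p.factorial * M ^ p * contractPow w p L (smulForm χ (omegaPow n 0))
  | 0, L, _, h, w, _, _, _, _, _, _ => by
    refine le_of_eq ?_
    have : powForm χ (h 0) 0 0 = smulForm χ (omegaPow n 0) := by
      ext1 x
      rw [powForm_apply, pow_zero, one_mul]
      rfl
    rw [this]
    simp [contractPow]
  | p + 1, L, hL, h, w, h1, h2, h3, h4, h5, h6 => by
    have hL' := hL.contract (w := w 0) (h4 0 (by omega))
    have s1 := powForm_succ_le hL hχ0 hχE (h1 0 (by omega)) (h2 0 (by omega)) (h3 0 (by omega)) hM0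
      (h4 0 (by omega)) (h5 0 (by omega))
    have s2 : contract (m := 2 * p) (w 0) L (powForm χ (h 0) p p) ≤
        contract (m := 2 * p) (w 0) L (powForm χ (h 1) p p) := by
      rw [← sub_nonneg, ← map_sub]
      have hv : ∀ x, (powForm χ (h 1) p p - powForm χ (h 0) p p) x =
          (((h 1).1 x ^ p - (h 0).1 x ^ p) * χ x) • omegaPow n p := by
        intro x
        rw [sub_apply, powForm_apply, powForm_apply, ← sub_smul, sub_mul]
      refine hL'.pos _ (fun x hx => ?_) fun x => ?_
      · rw [hv, hχE x hx]
        simp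
      · rw [hv]
        refine (isPosForm_omegaPow n p).smul (mul_nonneg (sub_nonneg.2 ?_) (hχ0 x))
        rcases Nat.eq_zero_or_pos p with rfl | hp
        · simp
        · exact pow_le_pow_left₀ (h1 0 (by omega) x) (h6 0 (by omega) x) p
    have s3 := contractPow_bound hχ0 hχE hM0 p _ hL' (fun i => h (i + 1)) (fun i => w (i + 1))
      (fun i hi => h1 _ (by omega)) (fun i hi => h2 _ (by omega)) (fun i hi => h3 _ (by omega))
      (fun i hi => h4 _ (by omega)) (fun i hi => h5 _ (by omega)) (fun i hi => h6 _ (by omega))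
    calc L (powForm χ (h 0) (p + 1) (p + 1))
        ≤ (p + 1) * M * contract (m := 2 * p) (w 0) L (powForm χ (h 0) p p) := s1
      _ ≤ (p + 1) * M * (p.factorial * M ^ p * contractPow (fun i => w (i + 1)) p
            (contract (m := 2 * p) (w 0) L) (smulForm χ (omegaPow n 0))) :=
          mul_le_mul_of_nonneg_left (s2.trans s3) (by positivity)
      _ = _ := by
          rw [contractPow, Nat.factorial_succ]
          push_cast
          ring

end ChainEstimate

/-! ### Choosing the regularizations of `u` one after the other. -/

section SuccessiveApproximation

variable {n m p : ℕ} {Ω : TopologicalSpace.Opens (Cn n)}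

/-- The smooth function `f_ε + η |z|²`, for `s = (ε, η)`. -/
def regFn {f : Cn n → ℝ} (hf : BddMeas f) (s : {ε : ℝ // 0 < ε} × ℝ) : SmoothFn n :=
  ⟨fun x => mol s.1 f x + s.2 * sqNorm x,
    (contDiff_mol hf s.1.2).add (contDiff_const.mul contDiff_sqNorm)⟩

lemma fderiv_add_smooth {F : Type*} [NormedAddCommGroup F] [NormedSpace ℝ F] {g k : Cn n → F}
    (hg : ContDiff ℝ (⊤ : ℕ∞) g) (hk : ContDiff ℝ (⊤ : ℕ∞) k) :
    fderiv ℝ (fun y => g y + k y) = fun y => fderiv ℝ g y + fderiv ℝ k y :=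
  funext fun y => fderiv_fun_add (differentiable_of_smooth hg y) (differentiable_of_smooth hk y)

lemma hess_add {g k : Cn n → ℝ} (hg : ContDiff ℝ (⊤ : ℕ∞) g) (hk : ContDiff ℝ (⊤ : ℕ∞) k)
    (x : Cn n) : hess (fun y => g y + k y) x = hess g x + hess k x := by
  rw [hess, fderiv_add_smooth hg hk, fderiv_add_smooth (contDiff_fderiv hg) (contDiff_fderiv hk)]

lemma hess_const_mul {g : Cn n → ℝ} (hg : ContDiff ℝ (⊤ : ℕ∞) g) (c : ℝ)
    (x : Cn n) : hess (fun y => c * g y) x = c • hess g x := by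
  have h1 : fderiv ℝ (fun y => c * g y) = fun y => c • fderiv ℝ g y :=
    funext fun y => fderiv_const_mul (differentiable_of_smooth hg y) c
  rw [hess, h1]
  exact fderiv_fun_const_smul (differentiable_of_smooth (contDiff_fderiv hg) x) c

lemma hess_regFn {f : Cn n → ℝ} (hf : BddMeas f) (s : {ε : ℝ // 0 < ε} × ℝ) (x : Cn n) :
    hess (regFn hf s).1 x = hess (mol s.1 f) x + s.2 • hess sqNorm x := by
  rw [← hess_const_mul contDiff_sqNorm]
  exact hess_add (contDiff_mol hf s.1.2) (contDiff_const.mul contDiff_sqNorm) x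

lemma hessPow_congr {w w' : ℕ → SmoothFn n} (φ : TestForm Ω 0) : ∀ p, (∀ i < p, w i = w' i) →
    hessPow w φ p = hessPow w' φ p
  | 0, _ => rfl
  | p + 1, h => by
    rw [hessPow, hessPow, hessPow_congr φ p fun i hi => h i (by omega)]
    ext1 x
    rw [hessTest_apply, hessTest_apply, h p (by omega)]

lemma tsupport_hessPow_subset (w : ℕ → SmoothFn n) (φ : TestForm Ω 0) : ∀ p,
    tsupport (hessPow w φ p) ⊆ tsupport φ
  | 0 => subset_rfl
  | p + 1 => by
    have hs : Function.support (hessPow w φ (p + 1)) ⊆ Function.support (hessPow w φ p) := by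
      refine Function.support_subset_iff'.2 fun x hx => ?_
      have h0 : hessPow w φ p x = 0 := by simpa using hx
      change hessWedge _ (hessPow w φ p x) = 0
      rw [h0, map_zero]
    exact (closure_mono hs).trans (tsupport_hessPow_subset w φ p)

/-- The current `(dd^c u)^p ∧ T` is approximated by smooth products, where the regularizations
are chosen one after the other. -/
lemma exists_regFn_approx {u : Cn n → ℝ} (hu : RealPSH (Ω : Set (Cn n)) u) {M : ℝ}
    (hM : ∀ x ∈ Ω, |u x| ≤ M) {K : Set (Cn n)} (hK : IsCompact K) (hKΩ : K ⊆ Ω)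
    (hf : BddMeas (K.indicator u)) {E D : Set (Cn n)} (hD : IsCompact D) (hDE : D ⊆ E) {r : ℝ}
    (hr : 0 < r) (hE : ∀ x ∈ E, Metric.closedBall x r ⊆ K) {d : ℝ} (hd : 0 < d)
    {φ : TestForm Ω 0} (hφ : tsupport φ ⊆ E) {ε₀ : ℝ} (hε₀ : 0 < ε₀) (hε₀r : ε₀ ≤ r) :
    ∀ (p : ℕ) (T : Current Ω (2 * p)) (_ : IsClosedPositive T) {tol : ℝ} (_ : 0 < tol),
    ∃ s : ℕ → {ε : ℝ // 0 < ε} × ℝ, (∀ i < p, (s i).1 < ε₀ ∧ 0 < (s i).2) ∧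
      (∀ i, i + 1 < p → ∀ x ∈ D, mol (s (i + 1)).1 (K.indicator u) x <
        mol (s i).1 (K.indicator u) x + d) ∧
      |T (hessPow (fun i => regFn hf (s i)) φ p) - ddcPowWedge u p T φ| < tol
  | 0, T, _, tol, htol => by
    -- There are no factors to approximate, so the values are arbitrary.
    refine ⟨fun _ => (⟨1, one_pos⟩, 0), by simp, by simp, ?_⟩
    simpa [hessPow, ddcPowWedge] using htol
  | p + 1, T, hT, tol, htol => by
    obtain ⟨s, h1, h2, h3⟩ := exists_regFn_approx hu hM hK hKΩ hf hD hDE hr hE hd hφ hε₀ hε₀r p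
      (ddcWedge (m := 2 * p) u T) (hT.ddcWedge hu hM) (half_pos htol)
    -- With the first `p` regularizations fixed, `Φ` is a fixed test form, and the last scale is
    -- found from the weak convergence of `dd^c u_ε ∧ T` alone.
    set Φ := hessPow (fun i => regFn hf (s i)) φ p with hΦ
    have hsupp : ∀ x ∈ tsupport Φ, Metric.closedBall x r ⊆ K := fun x hx =>
      hE x (hφ (tsupport_hessPow_subset _ φ p hx))
    have hev := eventually_hessTest_mem hT hu hM hK hKΩ hr hsupp
      (Metric.ball_mem_nhds _ (show 0 < tol / 4 by positivity))
    -- Since `u` lies below its previous mollification, hence strictly below that plus `d`,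
    -- sufficiently fine mollifications stay below it uniformly on `D`.
    have hord : ∀ᶠ ε in 𝓝[>] (0 : ℝ), ∀ i, i + 1 = p → ∀ x ∈ D, mol ε (K.indicator u) x <
        mol (s i).1 (K.indicator u) x + d := by
      cases p with
      | zero => exact Eventually.of_forall fun ε i hi => by omega
      | succ p =>
        have := eventually_mol_lt hf hD (w := fun x => mol (s p).1 (K.indicator u) x + d)
          (fun x hx => hu.usc_indicator hKΩ (mem_interior_iff_mem_nhds.2
            (mem_of_superset (Metric.closedBall_mem_nhds x hr) (hE x (hDE hx)))))
          (fun x _ => ((contDiff_mol hf (s p).1.2).continuous.add continuous_const).continuousAt)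
          (fun x hx => by
            have := (hu.submean_indicator hKΩ hr.le (hE x (hDE hx))).le_mol hf (s p).1.2
              ((h1 p (by omega)).1.le.trans hε₀r)
            linarith)
        filter_upwards [this] with ε hε i hi
        obtain rfl : i = p := by omega
        exact hε
    obtain ⟨ε, ⟨ha, hb⟩, hc⟩ := ((hev.and hord).and (Ioo_mem_nhdsGT hε₀)).exists
    have hw := contDiff_mol hf hc.1
    have ha' := ha hw
    let B := T (hessTest (m := 2 * p) sqNorm contDiff_sqNorm Φ)
    -- Makes the contribution `η B` of the added term `η |z|²` smaller than `tol / 4`. The remaining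
    -- error is `tol / 2` from the induction and `tol / 4` from the choice of `ε`.
    let η := tol / 4 / (|B| + 1)
    have hη : 0 < η := by positivity
    have hηB : |η * B| < tol / 4 := by
      rw [abs_mul, abs_of_pos hη, div_mul_eq_mul_div, div_lt_iff₀ (by positivity)]
      have : 0 < tol / 4 := by positivity
      nlinarith [abs_nonneg B]
    let s' : ℕ → {ε : ℝ // 0 < ε} × ℝ := Function.update s p (⟨ε, hc.1⟩, η)
    have hs' : ∀ i, i < p → s' i = s i := fun i hi => Function.update_of_ne (by omega) _ _
    have hsp : s' p = (⟨ε, hc.1⟩, η) := Function.update_self _ _ _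
    refine ⟨s', fun i hi => ?_, fun i hi x hx => ?_, ?_⟩
    · rcases Nat.lt_succ_iff_lt_or_eq.1 hi with h | rfl
      · rw [hs' i h]
        exact h1 i h
      · rw [hsp]
        exact ⟨hc.2, hη⟩
    · rcases Nat.lt_succ_iff_lt_or_eq.1 hi with h | h
      · rw [hs' i (by omega), hs' (i + 1) h]
        exact h2 i h x hx
      · rw [hs' i (by omega), h, hsp]
        exact hb i h x hx
    · have e1 : hessPow (fun i => regFn hf (s' i)) φ (p + 1) =
          hessTest (m := 2 * p) _ hw Φ + η • hessTest (m := 2 * p) sqNorm contDiff_sqNorm Φ := by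
        have : hessPow (fun i => regFn hf (s' i)) φ p = Φ :=
          hessPow_congr φ p fun i hi => by rw [hs' i hi]
        rw [hessPow, this]
        ext1 x
        rw [hessTest_apply, hess_regFn, hsp, map_add, map_smul]
        rfl
      rw [e1, map_add, map_smul, smul_eq_mul]
      rw [Metric.mem_ball, Real.dist_eq] at ha'
      change |_ + η * B - ddcPowWedge u p (ddcWedge (m := 2 * p) u T) φ| < tol
      rw [abs_lt] at *
      constructor <;> linarith [ha'.1, ha'.2, h3.1, h3.2, hηB.1, hηB.2]

end SuccessiveApproximation

/-! ### The excess of `v` over a smooth `w`, and its mollification. -/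

section Comparison

variable {n : ℕ}

lemma BddMeas.add {f g : Cn n → ℝ} (hf : BddMeas f) (hg : BddMeas g) :
    BddMeas fun x => f x + g x := by
  obtain ⟨A, hA⟩ := hf.bdd
  obtain ⟨B, hB⟩ := hg.bdd
  exact ⟨hf.meas.add hg.meas, A + B, fun x => (abs_add_le _ _).trans (add_le_add (hA x) (hB x))⟩

/-- The function `(v - w)⁺` on `G`, extended by zero. -/
def excess (G : Set (Cn n)) (v w : Cn n → ℝ) : Cn n → ℝ := G.indicator fun x => max (v x - w x) 0

lemma excess_nonneg (G : Set (Cn n)) (v w : Cn n → ℝ) (x : Cn n) : 0 ≤ excess G v w x :=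
  Set.indicator_nonneg (fun _ _ => le_max_right _ _) x

/-- The setting of the comparison of `v` and `w` on `G`. -/
structure CompData (G : Set (Cn n)) (v w : Cn n → ℝ) : Prop where
  isOpen : IsOpen G
  compact : IsCompact (closure G)
  usc : UpperSemicontinuousOn v (closure G)
  psh : RealPSH G v
  cont : Continuous w
  bdd : BddMeas w
  lt : ∀ x ∈ frontier G, v x < w x

lemma usc_sub_continuous {A : Set (Cn n)} {v w : Cn n → ℝ} (hv : UpperSemicontinuousOn v A)
    (hw : Continuous w) : UpperSemicontinuousOn (fun x => v x - w x) A := by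
  intro x hx c hc
  change v x - w x < c at hc
  obtain ⟨e, he, hec⟩ : ∃ e > 0, v x - w x + 2 * e < c :=
    ⟨(c - (v x - w x)) / 3, by linarith, by linarith⟩
  filter_upwards [hv x hx (v x + e) (by linarith), mem_nhdsWithin_of_mem_nhds
    (hw.continuousAt.eventually (lt_mem_nhds (show w x - e < w x by linarith)))] with y h1 h2
  change v y < v x + e at h1
  change v y - w y < c
  linarith

/-- `v - w` is upper semicontinuous, so the set is closed, and the strict inequality on the boundary
keeps it inside `G`. The excess vanishes off this set. -/
lemma CompData.contactSet {G : Set (Cn n)} {v w : Cn n → ℝ} (h : CompData G v w) :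
    IsCompact {x ∈ closure G | w x ≤ v x} ∧ {x ∈ closure G | w x ≤ v x} ⊆ G := by
  constructor
  · refine h.compact.of_isClosed_subset ?_ fun x hx => hx.1
    refine isClosed_of_closure_subset fun x hx => ?_
    have hxG : x ∈ closure G := closure_minimal (fun x hx => hx.1) isClosed_closure hx
    refine ⟨hxG, le_of_not_gt fun hlt => ?_⟩
    have h1 := usc_sub_continuous h.usc h.cont x hxG 0 (sub_neg.2 hlt)
    rw [eventually_nhdsWithin_iff] at h1
    obtain ⟨y, h2, h3⟩ := ((mem_closure_iff_frequently.1 hx).and_eventually h1).exists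
    have h4 : v y - w y < 0 := h3 h2.1
    linarith [h2.2]
  · rintro x ⟨hx, hle⟩
    by_contra hG
    have : x ∈ frontier G := by rw [h.isOpen.frontier_eq]; exact ⟨hx, hG⟩
    exact absurd (h.lt x this) (not_lt.2 hle)

lemma CompData.excess_eq_zero {G : Set (Cn n)} {v w : Cn n → ℝ} {x : Cn n}
    (hx : x ∉ {x ∈ closure G | w x ≤ v x}) : excess G v w x = 0 := by
  by_cases hG : x ∈ G
  · rw [excess, Set.indicator_of_mem hG, max_eq_right]
    by_contra hneg
    push Not at hneg
    exact hx ⟨subset_closure hG, by linarith⟩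
  · exact Set.indicator_of_notMem hG _

lemma CompData.bddMeas_excess {G : Set (Cn n)} {v w : Cn n → ℝ} (h : CompData G v w) :
    BddMeas (excess G v w) := by
  constructor
  · refine measurable_of_Iio fun c => ?_
    by_cases hc : 0 < c
    · have e : excess G v w ⁻¹' Set.Iio c = {x ∈ G | v x - w x < c} ∪ Gᶜ := by
        ext x
        by_cases hx : x ∈ G
        · simp [excess, hx, hc]
        · simp [excess, hx, hc]
      rw [e]
      exact (UpperSemicontinuousOn.isOpen_sublevel h.isOpen (usc_sub_continuous h.psh.usc h.cont)
        c).measurableSet.union h.isOpen.measurableSet.compl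
    · have e : excess G v w ⁻¹' Set.Iio c = ∅ := by
        ext x
        have := excess_nonneg G v w x
        simp only [Set.mem_preimage, Set.mem_Iio, Set.mem_empty_iff_false, iff_false]
        linarith
      rw [e]
      exact MeasurableSet.empty
  · obtain ⟨A, hA⟩ := h.usc.bddAbove_of_isCompact h.compact
    obtain ⟨B, hB⟩ := h.bdd.bdd
    refine ⟨|A| + B, fun x => ?_⟩
    rw [abs_of_nonneg (excess_nonneg G v w x)]
    have hB0 : 0 ≤ B := (abs_nonneg _).trans (hB x)
    by_cases hx : x ∈ G
    · rw [excess, Set.indicator_of_mem hx]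
      refine max_le ?_ (by positivity)
      have h1 : v x ≤ A := hA ⟨x, subset_closure hx, rfl⟩
      have h2 := (abs_le.1 (hB x)).1
      linarith [le_abs_self A]
    · rw [excess, Set.indicator_of_notMem hx]
      positivity

/-- The function `max v w` on `G`, extended by `w`, has the sub-mean value property. -/
lemma CompData.exists_submean {G : Set (Cn n)} {v w : Cn n → ℝ} (h : CompData G v w)
    {E : Set (Cn n)} {r₀ : ℝ} (hr₀ : 0 < r₀) (hE : ∀ z ∈ E, Submean w z r₀) :
    ∃ r > 0, ∀ z ∈ E, Submean (fun x => excess G v w x + w x) z r := by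
  obtain ⟨hS, hSG⟩ := h.contactSet
  set S := {x ∈ closure G | w x ≤ v x}
  obtain ⟨r₁, hr₁, hthick⟩ := hS.exists_cthickening_subset_open h.isOpen hSG
  refine ⟨min r₀ r₁, lt_min hr₀ hr₁, fun z hz a ha => ?_⟩
  have hV := h.bddMeas_excess.add h.bdd
  -- On the contact set the glued function equals `v` and dominates `v` on all discs of radius `r₁`;
  -- off it the glued function equals `w` and dominates `w` everywhere.
  by_cases hzS : z ∈ S
  · have hball : Metric.closedBall z r₁ ⊆ Metric.cthickening r₁ S :=
      Metric.closedBall_subset_cthickening hzS r₁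
    have hcomp : IsCompact (Metric.cthickening r₁ S) := hS.cthickening
    have h1 := h.psh.submean_indicator hthick hr₁.le hball a (ha.trans (min_le_right _ _))
    rw [Set.indicator_of_mem (hball (Metric.mem_closedBall_self hr₁.le))] at h1
    have h0 : excess G v w z + w z = v z := by
      rw [excess, Set.indicator_of_mem (hSG hzS), max_eq_left (sub_nonneg.2 hzS.2)]
      ring
    simp only [h0]
    refine h1.trans (Real.circleAverage_mono
      ((h.psh.bddMeas_indicator h.isOpen hcomp hthick).circleIntegrable z a)
      (hV.circleIntegrable z a) fun ζ hζ => ?_)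
    have hζ1 : ‖ζ‖ = 1 := by simpa using hζ
    have hmem : z + ζ • a ∈ Metric.cthickening r₁ S := by
      refine hball ?_
      rw [mem_closedBall_iff_norm, add_sub_cancel_left, norm_smul, hζ1, one_mul]
      exact ha.trans (min_le_right _ _)
    rw [Set.indicator_of_mem hmem, excess, Set.indicator_of_mem (hthick hmem)]
    linarith [le_max_left (v (z + ζ • a) - w (z + ζ • a)) 0]
  · simp only [CompData.excess_eq_zero hzS, zero_add]
    refine (hE z hz a (ha.trans (min_le_left _ _))).trans (Real.circleAverage_mono
      (h.bdd.circleIntegrable z a) (hV.circleIntegrable z a) fun ζ _ => ?_)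
    linarith [excess_nonneg G v w (z + ζ • a)]

lemma CompData.usc_excess {G : Set (Cn n)} {v w : Cn n → ℝ} (h : CompData G v w) {x : Cn n}
    (hx : x ∈ G) : UpperSemicontinuousAt (fun y => excess G v w y + w y) x := by
  intro c hc
  change excess G v w x + w x < c at hc
  rw [excess, Set.indicator_of_mem hx, max_add, sub_add_cancel, zero_add, max_lt_iff] at hc
  have h1 := h.psh.usc x hx c hc.1
  rw [h.isOpen.nhdsWithin_eq hx] at h1
  filter_upwards [h1, h.cont.continuousAt.eventually (gt_mem_nhds hc.2), h.isOpen.mem_nhds hx]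
    with y h2 h3 h4
  change excess G v w y + w y < c
  rw [excess, Set.indicator_of_mem h4, max_add, sub_add_cancel, zero_add]
  exact max_lt h2 h3

/-- The excess is a difference of two submean functions, and the mollifications of each converge at
`x`. -/
lemma CompData.tendsto_mol_excess {G : Set (Cn n)} {v w : Cn n → ℝ} (h : CompData G v w)
    {E : Set (Cn n)} {r₀ : ℝ} (hr₀ : 0 < r₀) (hE : ∀ z ∈ E, Submean w z r₀) {x : Cn n}
    (hx : x ∈ G) (hxE : x ∈ E) :
    Tendsto (fun δ => mol δ (excess G v w) x) (𝓝[>] 0) (𝓝 (excess G v w x)) := by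
  obtain ⟨r, hr, hsub⟩ := h.exists_submean hr₀ hE
  have h1 := tendsto_mol (h.bddMeas_excess.add h.bdd) hr (hsub x hxE) (h.usc_excess hx)
  have h2 := tendsto_mol h.bdd hr₀ (hE x hxE) (h.cont.upperSemicontinuous x)
  have h3 := h1.sub h2
  rw [add_sub_cancel_right] at h3
  refine h3.congr' ?_
  filter_upwards [self_mem_nhdsWithin] with δ hδ
  rw [mol_add h.bddMeas_excess h.bdd hδ, add_sub_cancel_right]

/-- Mollification enlarges the compact contact set by at most `δ`. -/
lemma CompData.eventually_tsupport {G : Set (Cn n)} {v w : Cn n → ℝ} (h : CompData G v w) :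
    ∀ᶠ δ in 𝓝[>] (0 : ℝ), tsupport (mol δ (excess G v w)) ⊆ G := by
  obtain ⟨hS, hSG⟩ := h.contactSet
  obtain ⟨r₁, hr₁, hthick⟩ := hS.exists_cthickening_subset_open h.isOpen hSG
  filter_upwards [Ioc_mem_nhdsGT hr₁] with δ hδ
  refine (closure_minimal (fun x hx => ?_) Metric.isClosed_cthickening).trans hthick
  by_contra hx'
  refine hx ?_
  rw [mol_congr (g := fun _ => 0) hδ.1 fun y hy => CompData.excess_eq_zero fun hyS => hx' ?_,
    mol_const hδ.1]
  refine Metric.closedBall_subset_cthickening hyS r₁ ?_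
  rw [Metric.mem_closedBall, dist_comm]
  exact (Metric.mem_ball.1 hy).le.trans hδ.2

lemma norm_sq_le (v : Cn n) : ‖v‖ ^ 2 ≤ sqNorm v := by
  have h0 : 0 ≤ sqNorm v := Finset.sum_nonneg fun _ _ => Complex.normSq_nonneg _
  have : ‖v‖ ≤ √(sqNorm v) := (pi_norm_le_iff_of_nonneg (Real.sqrt_nonneg _)).2 fun j =>
    Real.le_sqrt_of_sq_le (norm_sq_le_sqNorm v j)
  calc ‖v‖ ^ 2 ≤ √(sqNorm v) ^ 2 := by gcongr
    _ = sqNorm v := Real.sq_sqrt h0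

lemma hess_sqNorm_apply (x v : Cn n) : hess sqNorm x v v = 2 * sqNorm v := by
  rw [hess_sqNorm]
  simp only [smul_apply, _root_.sum_apply, leviForm_apply, smul_eq_mul, sqNorm]
  congr 1

/-- The Hessian of `|z|²` dominates the squared sup norm, so `η` times it absorbs a perturbation of
norm at most `η`. -/
lemma leviNonneg_of_close {H H' : Cn n →L[ℝ] Cn n →L[ℝ] ℝ} (hH : LeviNonneg H) {η : ℝ}
    (h : ‖H' - H‖ ≤ η) (hη : 0 ≤ η) (x : Cn n) : LeviNonneg (H' + η • hess sqNorm x) := by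
  intro v
  have hI : ‖Complex.I • v‖ = ‖v‖ := by rw [norm_smul]; simp
  have b : ∀ a : Cn n, ‖a‖ = ‖v‖ → -(η * ‖v‖ ^ 2) ≤ H' a a - H a a := by
    intro a ha
    have h1 : ‖(H' - H) a a‖ ≤ η * ‖v‖ ^ 2 := by
      refine ((H' - H).le_opNorm₂ a a).trans ?_
      rw [ha, mul_assoc, ← sq]
      gcongr
    rw [Real.norm_eq_abs] at h1
    exact (abs_le.1 h1).1
  have h1 := b v rfl
  have h2 := b _ hI
  have h3 := hH v
  simp only [add_apply, smul_apply, smul_eq_mul, hess_sqNorm_apply]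
  have h4 := mul_le_mul_of_nonneg_left (norm_sq_le v) hη
  have h5 := mul_le_mul_of_nonneg_left (norm_sq_le (Complex.I • v)) hη
  rw [hI] at h5
  have h6 : 0 ≤ η * ‖v‖ ^ 2 := by positivity
  linarith

/-- The mollification of `excess + w` has nonnegative Levi form; replacing the mollified `w` by `w`
itself costs a small Hessian error, paid for by `η |z|²`. -/
lemma CompData.eventually_levi {G : Set (Cn n)} {v w : Cn n → ℝ} (h : CompData G v w)
    (hws : ContDiff ℝ (⊤ : ℕ∞) w) (hwc : HasCompactSupport w)
    {E : Set (Cn n)} {r₀ : ℝ} (hr₀ : 0 < r₀) (hE : ∀ z ∈ E, Submean w z r₀)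
    (hGE : ∀ x ∈ closure G, Metric.closedBall x r₀ ⊆ E) {η : ℝ} (hη : 0 < η) :
    ∀ᶠ δ in 𝓝[>] (0 : ℝ), ∀ x ∈ closure G,
      LeviNonneg (hess (mol δ (excess G v w)) x + (hess w x + η • hess sqNorm x)) := by
  obtain ⟨r, hr, hsub⟩ := h.exists_submean hr₀ hE
  have hV := h.bddMeas_excess.add h.bdd
  filter_upwards [eventually_hess_mol (contDiff_nat hws 2) hwc hη, Ioc_mem_nhdsGT hr₀]
    with δ h1 hδ x hx
  have h2 : LeviNonneg (hess (mol δ fun x => excess G v w x + w x) x) := by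
    refine Submean.leviNonneg (contDiff_nat (contDiff_mol hV hδ.1) 2) hr
      (Submean.mol hV hδ.1 fun y hy => hsub _ (hGE x hx ?_))
    rw [mem_closedBall_iff_norm, sub_sub_cancel_left, norm_neg]
    exact hy.trans hδ.2
  have e : (mol δ fun x => excess G v w x + w x) = fun x => mol δ (excess G v w) x + mol δ w x :=
    funext fun x => mol_add h.bddMeas_excess h.bdd hδ.1 x
  rw [e, hess_add (contDiff_mol h.bddMeas_excess hδ.1) (contDiff_mol h.bdd hδ.1)] at h2
  have h3 := leviNonneg_of_close h2 (H' := hess (mol δ (excess G v w)) x + hess w x) (η := η) (by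
    rw [add_sub_add_left_eq_sub, norm_sub_rev]
    exact h1 x) hη.le x
  rwa [add_assoc] at h3

end Comparison

/-! ### Trace measures, total masses and cutoff neighbourhoods. -/

section MassEstimate

variable {n q : ℕ} {Ω : TopologicalSpace.Opens (Cn n)}

/-- A constant passes through the circle average only for circle integrable functions; integrability
is read off from the restriction to the compact disc. -/
lemma RealPSH.sub_const {U : Set (Cn n)} {v : Cn n → ℝ} (hU : IsOpen U) (hv : RealPSH U v) (c : ℝ) :
    RealPSH U fun x => v x - c := by
  refine ⟨usc_sub_continuous hv.usc continuous_const, fun z hz w hw => ?_, ?_⟩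
  · set K := (fun ζ : ℂ => z + ζ • w) '' Metric.closedBall 0 1 with hKdef
    have hK : IsCompact K := (isCompact_closedBall 0 1).image
      (continuous_const.add (continuous_id.smul continuous_const))
    have hKU : K ⊆ U := by
      rintro _ ⟨ζ, hζ, rfl⟩
      exact hw ζ (mem_closedBall_zero_iff.1 hζ)
    have hci : CircleIntegrable (fun ζ : ℂ => v (z + ζ • w)) 0 1 := by
      have h1 := (hv.bddMeas_indicator hU hK hKU).circleIntegrable z w
      have e : (fun θ : ℝ => K.indicator v (z + circleMap 0 1 θ • w)) =
          fun θ : ℝ => v (z + circleMap 0 1 θ • w) := by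
        funext θ
        exact Set.indicator_of_mem (show _ ∈ K from ⟨circleMap 0 1 θ, by simp, rfl⟩) v
      change IntervalIntegrable (fun θ : ℝ => v (z + circleMap 0 1 θ • w)) _ _ _
      rw [← e]
      exact h1
    have h2 := hv.le_average z hz w hw
    have h3 := Real.circleAverage_fun_sub hci (circleIntegrable_const c 0 1)
    rw [h3, Real.circleAverage_const]
    linarith
  · obtain ⟨a, ha⟩ := hv.bddBelow
    exact ⟨a - c, fun z hz => by linarith [ha z hz]⟩

/-- Fatou's lemma, in the form used for both limits below. -/
lemma lintegral_le_of_tendsto {X : Type*} [MeasurableSpace X] {μ : Measure X}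
    {F : ℕ → X → ENNReal} {g : X → ENNReal} {B : ℕ → ENNReal} {b : ENNReal}
    (hF : ∀ l, Measurable (F l)) (hlim : ∀ᵐ x ∂μ, Tendsto (fun l => F l x) atTop (𝓝 (g x)))
    (hB : ∀ᶠ l in atTop, ∫⁻ x, F l x ∂μ ≤ B l) (hb : Tendsto B atTop (𝓝 b)) : ∫⁻ x, g x ∂μ ≤ b := by
  calc ∫⁻ x, g x ∂μ = ∫⁻ x, liminf (fun l => F l x) atTop ∂μ :=
        lintegral_congr_ae (hlim.mono fun x hx => hx.liminf_eq.symm)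
    _ ≤ liminf (fun l => ∫⁻ x, F l x ∂μ) atTop := lintegral_liminf_le hF
    _ ≤ liminf B atTop := liminf_le_liminf hB
    _ = b := hb.liminf_eq

lemma IsClosedPositive.ddcPowWedge {u : Cn n → ℝ} (hu : RealPSH (Ω : Set (Cn n)) u) {M : ℝ}
    (hM : ∀ x ∈ Ω, |u x| ≤ M) : ∀ (p : ℕ) (T : Current Ω (2 * p)), IsClosedPositive T →
    IsClosedPositive (p := 0) (Pluri.ddcPowWedge u p T)
  | 0, _, hT => hT
  | p + 1, _, hT => IsClosedPositive.ddcPowWedge hu hM p _ (hT.ddcWedge hu hM)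

lemma isRepresentingMeasure_traceMeasure {T : Current Ω (2 * q)} (hT : IsClosedPositive T) :
    IsRepresentingMeasure (fun χ : 𝓓(Ω, ℝ) => T (smulForm χ (omegaPow n q))) (traceMeasure T) := by
  obtain ⟨μ, τ, h⟩ := exists_isPosRep hT.bidim hT.positive
  exact measureOf_spec (exists_isRepresentingMeasure (currentCoeff T (omegaPow n q)) fun χ hχ =>
    h.nonneg fun x => (isPosForm_omegaPow n q).smul (hχ x))

lemma omegaPow_zero : omegaPow n 0 = ContinuousAlternatingMap.constOfIsEmpty ℝ (Cn n) (Fin 0) 1 := by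
  ext v
  simp [omegaPow, elementaryForm, wedgeOne_apply]

lemma zeroDimMeasure_eq (S : Current Ω (2 * 0)) : zeroDimMeasure S = traceMeasure S := by
  rw [traceMeasure, omegaPow_zero]
  rfl

lemma IsRadonOn.integrable_testFunction {μ : Measure (Cn n)} (hμ : IsRadonOn Ω μ) (χ : 𝓓(Ω, ℝ)) :
    Integrable χ μ := by
  have := χ.integrable_bilin (ContinuousLinearMap.mul ℝ ℝ) (hμ.locallyIntegrableOn
    (f := fun _ => (1 : ℝ)) aestronglyMeasurable_const (C := 1) (by simp))
  simpa using this

lemma ofReal_traceMeasure {T : Current Ω (2 * q)} (hT : IsClosedPositive T) {χ : 𝓓(Ω, ℝ)}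
    (hχ : ∀ x, 0 ≤ χ x) : ENNReal.ofReal (T (smulForm χ (omegaPow n q))) =
      ∫⁻ x, ENNReal.ofReal (χ x) ∂traceMeasure T := by
  have h := isRepresentingMeasure_traceMeasure hT
  rw [← h.integral_eq χ]
  exact ofReal_integral_eq_lintegral_ofReal (h.isRadonOn.integrable_testFunction χ) (ae_of_all _ hχ)

lemma ofReal_ddcPowWedge_le {T : Current Ω (2 * q)} (hT : IsClosedPositive T) {u : Cn n → ℝ}
    (hu : RealPSH (Ω : Set (Cn n)) u) {M : ℝ} (hM : ∀ x ∈ Ω, |u x| ≤ M) {χ : 𝓓(Ω, ℝ)}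
    (hχ0 : ∀ x, 0 ≤ χ x) (hχ1 : ∀ x, χ x ≤ 1) :
    ENNReal.ofReal (ddcPowWedge u q T (smulForm χ (omegaPow n 0))) ≤
      mongeAmpereMeasure T u (Ω : Set (Cn n)) := by
  rw [mongeAmpereMeasure, zeroDimMeasure_eq]
  refine (ofReal_traceMeasure (IsClosedPositive.ddcPowWedge hu hM q T hT) hχ0).trans_le ?_
  rw [← lintegral_indicator_one Ω.isOpen.measurableSet]
  refine lintegral_mono fun x => ?_
  by_cases hx : x ∈ (Ω : Set (Cn n))
  · rw [Set.indicator_of_mem hx]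
    exact ENNReal.ofReal_le_one.2 (hχ1 x)
  · rw [test_eq_zero χ fun h => hx (χ.tsupport_subset h)]
    simp

/-- Neighbourhoods of the closure of a relatively compact set, with a cutoff function. -/
lemma exists_neighborhoods {D : Set (Cn n)} (hD : IsCompact D) (hDΩ : D ⊆ Ω) :
    ∃ (K E : Set (Cn n)) (r : ℝ) (χ : 𝓓(Ω, ℝ)), IsCompact K ∧ K ⊆ Ω ∧ 0 < r ∧
      (∀ x ∈ E, Metric.closedBall x (2 * r) ⊆ K) ∧ (∀ x ∈ D, Metric.closedBall x r ⊆ E) ∧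
      (∀ x, 0 ≤ χ x) ∧ (∀ x, χ x ≤ 1) ∧ (∀ x ∈ D, χ x = 1) ∧ tsupport χ ⊆ E := by
  obtain ⟨R, hR, hRΩ⟩ := hD.exists_cthickening_subset_open Ω.isOpen hDΩ
  have hr : 0 < R / 3 := by positivity
  obtain ⟨χ, h0, h1, h2⟩ := exists_cutoff (Ω := ⟨Metric.thickening (R / 3) D,
    Metric.isOpen_thickening⟩) hD (Metric.self_subset_thickening hr D)
  have hsub : tsupport χ ⊆ Metric.cthickening (R / 3) D :=
    χ.tsupport_subset.trans (Metric.thickening_subset_cthickening _ _)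
  have hKΩ : Metric.cthickening (R / 3) D ⊆ Ω :=
    (Metric.cthickening_mono (by linarith) D).trans hRΩ
  refine ⟨Metric.cthickening R D, Metric.cthickening (R / 3) D, R / 3,
    ⟨χ, χ.contDiff, χ.hasCompactSupport, hsub.trans hKΩ⟩, hD.cthickening, hRΩ, hr,
    fun x hx => ?_, fun x hx => Metric.closedBall_subset_cthickening hx _, h0, h1,
    fun x hx => h2.self_of_nhdsSet x hx, hsub⟩
  refine (Metric.closedBall_subset_cthickening hx _).trans
    ((Metric.cthickening_cthickening_subset (by positivity) hr.le D).trans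
      (Metric.cthickening_mono (by linarith) D))

end MassEstimate

/-! ### The mass estimate for bounded plurisubharmonic functions. -/

section Maximality

variable {n q : ℕ} {Ω : TopologicalSpace.Opens (Cn n)}

lemma exists_seq_nhdsGT : ∃ δ : ℕ → ℝ, (∀ l, 0 < δ l) ∧ Tendsto δ atTop (𝓝[>] 0) :=
  ⟨fun l => 1 / ((l : ℝ) + 1), fun l => by positivity, tendsto_nhdsWithin_iff.2
    ⟨tendsto_one_div_add_atTop_nhds_zero_nat, Eventually.of_forall fun l => by
      rw [Set.mem_Ioi]; positivity⟩⟩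

lemma lintegral_pow_le {T : Current Ω (2 * q)} (hT : IsClosedPositive T) {χ : 𝓓(Ω, ℝ)}
    (hχ0 : ∀ x, 0 ≤ χ x) {G : Set (Cn n)} (hG : MeasurableSet G) (hχ : ∀ x ∈ G, χ x = 1)
    {h : SmoothFn n} (hh : ∀ x, 0 ≤ h.1 x) : ∫⁻ x in G, ENNReal.ofReal (h.1 x ^ q) ∂traceMeasure T ≤
      ENNReal.ofReal (T (powForm χ h q q)) := by
  let χ' : 𝓓(Ω, ℝ) := testOf χ (fun x => h.1 x ^ q * χ x) ((h.2.pow q).mul χ.contDiff)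
    fun x hx => by simp [hx]
  have e : powForm χ h q q = smulForm χ' (omegaPow n q) := by
    ext1 x
    rw [powForm_apply]
    rfl
  have h0 : ∀ x, 0 ≤ χ' x := fun x => mul_nonneg (pow_nonneg (hh x) q) (hχ0 x)
  rw [e, ofReal_traceMeasure hT h0]
  refine (setLIntegral_congr_fun hG fun x hx => ?_).trans_le (setLIntegral_le_lintegral G _)
  change _ = ENNReal.ofReal (h.1 x ^ q * χ x)
  rw [hχ x hx, mul_one]

/-- The estimate for regularizations of `u`. -/
lemma lintegral_excess_le {T : Current Ω (2 * q)} (hq : 1 ≤ q) (hT : IsClosedPositive T)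
    {u : Cn n → ℝ} (hu : RealPSH (Ω : Set (Cn n)) u) {A : ℝ} (hA : ∀ x ∈ Ω, |u x| ≤ A)
    {G : Set (Cn n)} (hG : IsOpen G) (hGc : IsCompact (closure G))
    {v : Cn n → ℝ} (hv : UpperSemicontinuousOn v (closure G)) (hvG : RealPSH G v)
    (hvu : ∀ x ∈ frontier G, v x ≤ u x) {M : ℝ} (hM0 : 0 ≤ M) (hM : ∀ x ∈ closure G, sqNorm x ≤ M)
    {K E : Set (Cn n)} {r : ℝ} {χ : 𝓓(Ω, ℝ)} (hK : IsCompact K) (hKΩ : K ⊆ Ω) (hr : 0 < r)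
    (hEK : ∀ x ∈ E, Metric.closedBall x (2 * r) ⊆ K) (hGE : ∀ x ∈ closure G, Metric.closedBall x r ⊆ E)
    (hχ0 : ∀ x, 0 ≤ χ x) (hχ : ∀ x ∈ closure G, χ x = 1) (hχE : tsupport χ ⊆ E)
    {d ε₀ tol : ℝ} (hd : 0 < d) (hε₀ : 0 < ε₀) (hε₀r : ε₀ ≤ r) (htol : 0 < tol) :
    ∃ ε, 0 < ε ∧ ε < ε₀ ∧ Measurable (excess G (fun x => v x - q * d) (mol ε (K.indicator u))) ∧
      ∫⁻ x in G, ENNReal.ofReal (excess G (fun x => v x - q * d) (mol ε (K.indicator u)) x ^ q)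
        ∂traceMeasure T ≤ ENNReal.ofReal (q.factorial * M ^ q *
          (ddcPowWedge u q T (smulForm χ (omegaPow n 0)) + tol)) := by
  have hf := hu.bddMeas_indicator Ω.isOpen hK hKΩ
  have hKcs : HasCompactSupport (K.indicator u) := HasCompactSupport.intro hK fun x hx =>
    Set.indicator_of_notMem hx u
  have hDE : closure G ⊆ E := fun x hx => hGE x hx (Metric.mem_closedBall_self hr.le)
  have hφ : tsupport (smulForm χ (omegaPow n 0)) ⊆ E := by
    refine (closure_mono (Function.support_subset_iff'.2 fun x hx => ?_)).trans hχE
    have : χ x = 0 := by simpa using hx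
    rw [smulForm_apply, this, zero_smul]
  obtain ⟨s, h1, h2, h3⟩ := exists_regFn_approx hu hA hK hKΩ hf hGc hDE (mul_pos two_pos hr) hEK hd hφ
    hε₀ (hε₀r.trans (by linarith)) q T hT htol
  have hsub : ∀ i < q, ∀ z ∈ E, Submean (mol (s i).1 (K.indicator u)) z r := by
    intro i hi z hz
    refine Submean.mol hf (s i).1.2 fun y hy => hu.submean_indicator hKΩ hr.le ?_
    refine (Metric.closedBall_subset_closedBall' ?_).trans (hEK z hz)
    rw [dist_eq_norm, sub_sub_cancel_left, norm_neg]
    have := (h1 i hi).1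
    linarith
  let w : ℕ → Cn n → ℝ := fun i => mol (s i).1 (K.indicator u)
  -- The shift `(q - i) d` is positive for `i < q`, which gives the strict inequality on the
  -- boundary. It drops by `d` at each step, which compensates `w (i + 1) < w i + d` and makes the
  -- excesses increase with `i`.
  let vv : ℕ → Cn n → ℝ := fun i x => v x - ((q : ℝ) - i) * d
  have hws : ∀ i, ContDiff ℝ (⊤ : ℕ∞) (w i) := fun i => contDiff_mol hf (s i).1.2
  have hle : ∀ i < q, ∀ x ∈ closure G, u x ≤ w i x := by
    intro i hi x hx
    have hxK : x ∈ K := hEK x (hDE hx) (Metric.mem_closedBall_self (by positivity))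
    have := (hu.submean_indicator hKΩ hr.le ((Metric.closedBall_subset_closedBall (by linarith)).trans
      (hEK x (hDE hx)))).le_mol hf (s i).1.2 ((h1 i hi).1.le.trans hε₀r)
    rwa [Set.indicator_of_mem hxK] at this
  have hcomp : ∀ i < q, CompData G (vv i) (w i) := by
    intro i hi
    refine ⟨hG, hGc, usc_sub_continuous hv continuous_const, hvG.sub_const hG _, (hws i).continuous,
      ⟨(hws i).continuous.measurable, ?_⟩, fun x hx => ?_⟩
    · obtain ⟨B, hB⟩ := hf.bdd
      exact ⟨B, fun x => abs_mol_le hf (s i).1.2 hB⟩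
    · have a1 := hvu x hx
      have a2 := hle i hi x (frontier_subset_closure hx)
      have a3 : 0 < ((q : ℝ) - i) * d := mul_pos (sub_pos.2 (by exact_mod_cast hi)) hd
      change v x - _ < _
      linarith
  have hv0 : vv 0 = fun x => v x - q * d := by simp [vv]
  refine ⟨(s 0).1, (s 0).1.2, (h1 0 hq).1, ?_, ?_⟩
  · rw [← hv0]
    exact (hcomp 0 hq).bddMeas_excess.meas
  rw [← hv0]
  obtain ⟨δ, hδ0, hδ⟩ := exists_seq_nhdsGT
  have hGm := hG.measurableSet
  have hev : ∀ᶠ t in 𝓝[>] (0 : ℝ), 0 < t ∧ ∀ i < q,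
      (tsupport (mol t (excess G (vv i) (w i))) ⊆ G ∧ ∀ x ∈ closure G,
      LeviNonneg (hess (mol t (excess G (vv i) (w i))) x + hess (regFn hf (s i)).1 x)) := by
    refine eventually_mem_nhdsWithin.and ((Set.finite_Iio q).eventually_all.2 fun i hi => ?_)
    filter_upwards [(hcomp i hi).eventually_tsupport, (hcomp i hi).eventually_levi (hws i)
      (hasCompactSupport_mol hKcs (s i).1.2) hr (hsub i hi) hGE (h1 i hi).2] with t a1 a2
    refine ⟨a1, fun x hx => ?_⟩
    rw [hess_regFn]
    exact a2 x hx
  have hcont : ∀ t, 0 < t → ContDiff ℝ (⊤ : ℕ∞) (mol t (excess G (vv 0) (w 0))) := fun t ht =>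
    contDiff_mol (hcomp 0 hq).bddMeas_excess ht
  -- The scales in `s` stay fixed while the mollification parameter of the excess tends to zero.
  refine lintegral_le_of_tendsto (F := fun l x => ENNReal.ofReal
    ((mol (δ l) (excess G (vv 0) (w 0)) x) ^ q)) (B := fun _ => ENNReal.ofReal (q.factorial *
      M ^ q * (ddcPowWedge u q T (smulForm χ (omegaPow n 0)) + tol)))
    (fun l => ((hcont _ (hδ0 l)).continuous.measurable.pow_const q).ennreal_ofReal)
    ((ae_restrict_iff' hGm).2 (ae_of_all _ fun x hx => ?_)) ?_ tendsto_const_nhds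
  · have := ((hcomp 0 hq).tendsto_mol_excess hr (hsub 0 hq) hx (hDE (subset_closure hx))).comp hδ
    exact ENNReal.tendsto_ofReal (this.pow q)
  · filter_upwards [hδ.eventually hev] with l hl
    set t := δ l
    obtain ⟨ht, hl⟩ := hl
    -- Only the indices below `q` enter the chain estimate; zero is a filler.
    let h : ℕ → SmoothFn n := fun i => if hi : i < q then
      ⟨mol t (excess G (vv i) (w i)), contDiff_mol (hcomp i hi).bddMeas_excess ht⟩
      else ⟨fun _ => 0, contDiff_const⟩
    have hh : ∀ i < q, (h i).1 = mol t (excess G (vv i) (w i)) := fun i hi => by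
      simp only [h, dif_pos hi]
    have hnn : ∀ i < q, ∀ x, 0 ≤ (h i).1 x := fun i hi x => by
      rw [hh i hi]
      exact le_mol (hcomp i hi).bddMeas_excess ht fun y _ => excess_nonneg _ _ _ _
    have hts : ∀ i < q, tsupport (h i).1 ⊆ closure G := fun i hi => by
      rw [hh i hi]
      exact (hl i hi).1.trans subset_closure
    have key := contractPow_bound hχ0 (E := E) (fun x hx => test_eq_zero χ fun h => hx (hχE h)) hM0 q
      (T : TestForm Ω (2 * q) →ₗ[ℝ] ℝ) (hT.isClosedPosOn E) h (fun i => regFn hf (s i)) hnn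
      (fun i hi x hx => hχ x (hts i hi hx)) (fun i hi x hx => hM x (hts i hi hx))
      (fun i hi x hx => ?_) (fun i hi x hx => ?_) fun i hi x => ?_
    · rw [contractPow_apply] at key
      have e : (fun x => ENNReal.ofReal (mol t (excess G (vv 0) (w 0)) x ^ q)) =
          fun x => ENNReal.ofReal ((h 0).1 x ^ q) := by rw [hh 0 hq]
      change ∫⁻ x in G, (fun x => ENNReal.ofReal (mol t (excess G (vv 0) (w 0)) x ^ q)) x ∂_ ≤ _
      rw [e]
      refine (lintegral_pow_le hT hχ0 hGm (fun x hx => hχ x (subset_closure hx)) (hnn 0 hq)).trans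
        (ENNReal.ofReal_le_ofReal (key.trans (mul_le_mul_of_nonneg_left ?_ (by positivity))))
      have := (abs_lt.1 h3).2
      change T _ ≤ _
      linarith
    · intro a
      have a1 := hu.leviNonneg_mol Ω.isOpen hK hKΩ (hEK x hx) (s i).1.2
        (show ((s i).1 : ℝ) < 2 * r by linarith [(h1 i hi).1]) a
      have a2 := mul_nonneg (h1 i hi).2.le (leviNonneg_sqNorm x a)
      rw [hess_regFn]
      simp only [add_apply, smul_apply, smul_eq_mul] at a1 a2 ⊢
      linarith
    · rw [hh i hi]
      exact (hl i hi).2 x (hts i hi hx)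
    · rw [hh i (by omega), hh (i + 1) hi]
      refine mol_mono (hcomp i (by omega)).bddMeas_excess (hcomp _ hi).bddMeas_excess ht fun y _ => ?_
      refine Set.indicator_le_indicator' fun hy => max_le_max ?_ le_rfl
      have := h2 i hi y (subset_closure hy)
      change v y - ((q : ℝ) - i) * d - mol (s i).1 (K.indicator u) y ≤
        v y - ((q : ℝ) - (i + 1 : ℕ)) * d - mol (s (i + 1)).1 (K.indicator u) y
      push_cast
      linarith

/-- The Chern-Levine-Nirenberg type estimate for the set where `v` exceeds `u`. -/
theorem lintegral_pow_sub_le {T : Current Ω (2 * q)} (hq : 1 ≤ q) (hT : IsClosedPositive T)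
    {u : Cn n → ℝ} (hu : RealPSH (Ω : Set (Cn n)) u) {A : ℝ} (hA : ∀ x ∈ Ω, |u x| ≤ A)
    {G : Set (Cn n)} (hG : IsOpen G) (hGc : IsCompact (closure G)) (hGΩ : closure G ⊆ Ω)
    {v : Cn n → ℝ} (hv : UpperSemicontinuousOn v (closure G)) (hvG : RealPSH G v)
    (hvu : ∀ x ∈ frontier G, v x ≤ u x) {M : ℝ} (hM0 : 0 ≤ M)
    (hM : ∀ x ∈ closure G, sqNorm x ≤ M) :
    ∫⁻ x in G, ENNReal.ofReal (max (v x - u x) 0 ^ q) ∂traceMeasure T ≤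
      ENNReal.ofReal (q.factorial * M ^ q) * mongeAmpereMeasure T u (Ω : Set (Cn n)) := by
  obtain ⟨K, E, r, χ, hK, hKΩ, hr, hEK, hGE, hχ0, hχ1, hχ, hχE⟩ := exists_neighborhoods hGc hGΩ
  obtain ⟨δ, hδ0, hδ⟩ := exists_seq_nhdsGT
  have hδ' : Tendsto δ atTop (𝓝 0) := hδ.mono_right nhdsWithin_le_nhds
  -- A single null sequence serves as shift `d`, as bound for the scale and as tolerance.
  have hex := fun l => lintegral_excess_le hq hT hu hA hG hGc hv hvG hvu hM0 hM hK hKΩ hr hEK hGE hχ0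
    hχ hχE (hδ0 l) (lt_min (hδ0 l) hr) (min_le_right (δ l) r) (hδ0 l)
  choose ε hε0 hε hmeas hbound using hex
  have hεlim : Tendsto ε atTop (𝓝[>] 0) := tendsto_nhdsWithin_iff.2
    ⟨tendsto_of_tendsto_of_tendsto_of_le_of_le tendsto_const_nhds hδ' (fun l => (hε0 l).le)
      fun l => (hε l).le.trans (min_le_left _ _), Eventually.of_forall hε0⟩
  have hf := hu.bddMeas_indicator Ω.isOpen hK hKΩ
  have hb : Tendsto (fun l => ENNReal.ofReal (q.factorial * M ^ q *
      (ddcPowWedge u q T (smulForm χ (omegaPow n 0)) + δ l))) atTop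
      (𝓝 (ENNReal.ofReal (q.factorial * M ^ q * ddcPowWedge u q T (smulForm χ (omegaPow n 0))))) := by
    refine ENNReal.tendsto_ofReal (Tendsto.const_mul _ ?_)
    simpa using hδ'.const_add (ddcPowWedge u q T (smulForm χ (omegaPow n 0)))
  refine (lintegral_le_of_tendsto (fun l => ((hmeas l).pow_const q).ennreal_ofReal)
    ((ae_restrict_iff' hG.measurableSet).2 (ae_of_all _ fun x hx => ?_)) (Eventually.of_forall hbound)
    hb).trans ?_
  · have hxE : Metric.closedBall x (2 * r) ⊆ K :=
      hEK x (hGE x (subset_closure hx) (Metric.mem_closedBall_self hr.le))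
    have h2r : 0 < 2 * r := by positivity
    have h1 := (tendsto_mol hf h2r (hu.submean_indicator hKΩ h2r.le hxE)
      (hu.usc_indicator hKΩ (mem_interior_iff_mem_nhds.2
        (mem_of_superset (Metric.closedBall_mem_nhds x h2r) hxE)))).comp hεlim
    rw [Set.indicator_of_mem (hxE (Metric.mem_closedBall_self h2r.le))] at h1
    have h2 : Tendsto (fun l => v x - q * δ l) atTop (𝓝 (v x)) := by
      simpa using (hδ'.const_mul (q : ℝ)).const_sub (v x)
    refine ENNReal.tendsto_ofReal (Tendsto.pow ?_ q)
    have h3 := (h2.sub h1).max (tendsto_const_nhds (x := (0 : ℝ)))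
    refine h3.congr fun l => ?_
    rw [excess, Set.indicator_of_mem hx]
    rfl
  · rw [ENNReal.ofReal_mul (by positivity)]
    gcongr
    exact ofReal_ddcPowWedge_le hT hu hA hχ0 hχ1

end Maximality

/-! ### Passage to the limit in `k`. -/

section MainTheorem

variable {n q : ℕ} {Ω : TopologicalSpace.Opens (Cn n)}

lemma measurableSet_lt_of_usc {G : Set (Cn n)} (hG : IsOpen G) {u v : Cn n → EReal}
    (hu : UpperSemicontinuousOn u G) (hv : UpperSemicontinuousOn v G) :
    MeasurableSet {x ∈ G | u x < v x} := by
  have e : {x ∈ G | u x < v x} =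
      ⋃ c : ℚ, {x ∈ G | u x < ((c : ℝ) : EReal)} ∩ (G \ {x ∈ G | v x < ((c : ℝ) : EReal)}) := by
    ext x
    simp only [Set.mem_iUnion, Set.mem_inter_iff, Set.mem_sdiff]
    constructor
    · rintro ⟨hx, hlt⟩
      obtain ⟨c, hc1, hc2⟩ := EReal.lt_iff_exists_rat_btwn.1 hlt
      exact ⟨c, ⟨hx, hc1⟩, hx, fun h => absurd h.2 (not_lt.2 hc2.le)⟩
    · rintro ⟨c, ⟨hx, h1⟩, _, h2⟩
      exact ⟨hx, h1.trans_le (not_lt.1 fun h => h2 ⟨hx, h⟩)⟩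
  rw [e]
  exact MeasurableSet.iUnion fun c =>
    (UpperSemicontinuousOn.isOpen_sublevel hG hu _).measurableSet.inter
      (hG.measurableSet.diff (UpperSemicontinuousOn.isOpen_sublevel hG hv _).measurableSet)

/-- Above a level `a ≥ -N` the truncation is inactive, so its value is `v x`. No relation between
`N` and `N'` is needed; the truncation levels chosen for different `k` need not be ordered. -/
lemma trunc_mono_of_lt {v : Cn n → EReal} {N N' : ℕ} {x : Cn n} (hx : v x ≠ ⊤) {a : ℝ}
    (ha : -(N : ℝ) ≤ a) (h : a < trunc v N x) : trunc v N x ≤ trunc v N' x := by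
  rw [← EReal.coe_lt_coe_iff, coe_trunc hx, lt_max_iff] at h
  have h' : (a : EReal) < v x := h.resolve_right fun h => by
    rw [EReal.coe_lt_coe_iff] at h
    linarith
  rw [← EReal.coe_le_coe_iff, coe_trunc hx, coe_trunc hx]
  refine max_le (le_max_left _ _) (le_max_of_le_left ?_)
  exact (EReal.coe_le_coe_iff.2 ha).trans h'.le

/-- If the masses tend to zero, then `v` is bounded by `u` almost everywhere with respect to the
trace measure of the current. -/
theorem ae_le_of_mass_tendsto_zero (hq : 1 ≤ q) {T : Current Ω (2 * q)} (hT : IsClosedPositive T)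
    {u : Cn n → EReal} (hu : PSHOn (Ω : Set (Cn n)) u) {w : ℕ → Cn n → ℝ}
    (hw : ∀ k, PSHOn (Ω : Set (Cn n)) fun z => ((w k z : ℝ) : EReal))
    (hwb : ∀ k, ∃ M : ℝ, ∀ z ∈ Ω, |w k z| ≤ M) (hanti : ∀ z ∈ Ω, Antitone fun k => w k z)
    (hlim : ∀ z ∈ Ω, Tendsto (fun k => ((w k z : ℝ) : EReal)) atTop (𝓝 (u z)))
    (hmass : Tendsto (fun k => mongeAmpereMeasure T (w k) (Ω : Set (Cn n))) atTop (𝓝 0))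
    {G : Set (Cn n)} (hG : IsOpen G) (hGc : IsCompact (closure G)) (hGΩ : closure G ⊆ Ω)
    {v : Cn n → EReal} (hv : UpperSemicontinuousOn v (closure G)) (hvG : PSHOn G v)
    (hvu : ∀ z ∈ frontier G, v z ≤ u z) : ∀ᵐ z ∂traceMeasure T, z ∈ G → v z ≤ u z := by
  have hGΩ' : G ⊆ Ω := subset_closure.trans hGΩ
  have huw : ∀ k, ∀ z ∈ Ω, u z ≤ ((w k z : ℝ) : EReal) := fun k z hz =>
    le_of_tendsto (hlim z hz) (eventually_atTop.2 ⟨k, fun l hl =>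
      EReal.coe_le_coe_iff.2 (hanti z hz hl)⟩)
  have hvtop : ∀ z ∈ closure G, v z ≠ ⊤ := by
    intro z hz
    by_cases hzG : z ∈ G
    · exact hvG.ne_top z hzG
    · have hfr : z ∈ frontier G := by rw [hG.frontier_eq]; exact ⟨hz, hzG⟩
      exact ((hvu z hfr).trans_lt (lt_top_iff_ne_top.2 (hu.ne_top z (hGΩ hz)))).ne
  choose A hA using hwb
  have hN : ∀ k, ∃ N : ℕ, A k ≤ N := fun k => exists_nat_ge (A k)
  choose N hN using hN
  have hlow : ∀ k, ∀ z ∈ Ω, -(N k : ℝ) ≤ w k z := fun k z hz => by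
    linarith [(abs_le.1 (hA k z hz)).1, hN k]
  have hpsh : ∀ k, RealPSH (Ω : Set (Cn n)) (w k) := fun k => (hw k).realPSH_of_bounded (hA k)
  obtain ⟨M, hM0, hM⟩ : ∃ M : ℝ, 0 ≤ M ∧ ∀ x ∈ closure G, sqNorm x ≤ M := by
    obtain ⟨M, hM⟩ := hGc.bddAbove_image (f := sqNorm) contDiff_sqNorm.continuous.continuousOn
    exact ⟨max M 0, le_max_right _ _, fun x hx => (hM ⟨x, hx, rfl⟩).trans (le_max_left _ _)⟩
  -- Since `-N k ≤ w k`, truncating `v` at `-N k` preserves the inequality on the boundary.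
  have hest : ∀ k, ∫⁻ x in G, ENNReal.ofReal (max (trunc v (N k) x - w k x) 0 ^ q) ∂traceMeasure T ≤
      ENNReal.ofReal (q.factorial * M ^ q) * mongeAmpereMeasure T (w k) (Ω : Set (Cn n)) := by
    intro k
    refine lintegral_pow_sub_le hq hT (hpsh k) (hA k) hG hGc hGΩ (usc_trunc hvtop hv (N k))
      (hvG.realPSH_trunc (N k)) (fun x hx => ?_) hM0 hM
    have hxΩ := hGΩ (frontier_subset_closure hx)
    rw [← EReal.coe_le_coe_iff, coe_trunc (hvtop x (frontier_subset_closure hx))]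
    exact max_le ((hvu x hx).trans (huw k x hxΩ)) (EReal.coe_le_coe_iff.2 (hlow k x hxΩ))
  have hzero : ∀ k, ∀ᵐ z ∂traceMeasure T, z ∈ G → v z ≤ ((w k z : ℝ) : EReal) := by
    intro k
    -- The excess grows as `w l` decreases, so the integral for a fixed `k` is bounded by the masses
    -- for all later `l` and hence vanishes.
    have hmono : ∀ l, k ≤ l → ∀ x ∈ G, max (trunc v (N k) x - w k x) 0 ≤
        max (trunc v (N l) x - w l x) 0 := by
      intro l hl x hx
      by_cases hlt : w k x < trunc v (N k) x
      · refine max_le_max ?_ le_rfl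
        have h1 := trunc_mono_of_lt (N' := N l) (hvG.ne_top x hx) (hlow k x (hGΩ' hx)) hlt
        have h2 : w l x ≤ w k x := hanti x (hGΩ' hx) hl
        linarith
      · rw [max_eq_right (by linarith)]
        exact le_max_right _ _
    have h0 : ∫⁻ x in G, ENNReal.ofReal (max (trunc v (N k) x - w k x) 0 ^ q) ∂traceMeasure T = 0 := by
      refine le_antisymm (ge_of_tendsto (x := atTop) (f := fun l => ENNReal.ofReal
        (q.factorial * M ^ q) * mongeAmpereMeasure T (w l) (Ω : Set (Cn n))) ?_ ?_) zero_le
      · have := ENNReal.Tendsto.const_mul hmass (Or.inr (ENNReal.ofReal_ne_top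
          (r := q.factorial * M ^ q)))
        rwa [mul_zero] at this
      · filter_upwards [eventually_ge_atTop k] with l hl
        refine le_trans (setLIntegral_mono' hG.measurableSet fun x hx => ?_) (hest l)
        exact ENNReal.ofReal_le_ofReal (pow_le_pow_left₀ (le_max_right _ _) (hmono l hl x hx) q)
    have hm1 := (hvG.realPSH_trunc (N k)).measurable_indicator hG hG.measurableSet subset_rfl
    have hm2 := (hpsh k).measurable_indicator Ω.isOpen hG.measurableSet hGΩ'
    rw [setLIntegral_congr_fun (g := fun x => ENNReal.ofReal
      (max (G.indicator (trunc v (N k)) x - G.indicator (w k) x) 0 ^ q)) hG.measurableSet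
      (fun x hx => by simp only [Set.indicator_of_mem hx])] at h0
    have hm : Measurable fun x => ENNReal.ofReal
        (max (G.indicator (trunc v (N k)) x - G.indicator (w k) x) 0 ^ q) :=
      (((hm1.sub hm2).max measurable_const).pow_const q).ennreal_ofReal
    rw [lintegral_eq_zero_iff hm, Filter.EventuallyEq, ae_restrict_iff' hG.measurableSet] at h0
    filter_upwards [h0] with z hz hzG
    have h1 := hz hzG
    simp only [Set.indicator_of_mem hzG, Pi.zero_apply, ENNReal.ofReal_eq_zero] at h1
    have h2 : max (trunc v (N k) z - w k z) 0 = 0 :=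
      pow_eq_zero_iff (by omega) |>.1 (le_antisymm h1 (pow_nonneg (le_max_right _ _) q))
    have h3 : trunc v (N k) z ≤ w k z := by linarith [le_max_left (trunc v (N k) z - w k z) 0]
    rw [← EReal.coe_le_coe_iff, coe_trunc (hvG.ne_top z hzG)] at h3
    exact (le_max_left _ _).trans h3
  filter_upwards [ae_all_iff.2 hzero] with z hz hzG
  exact ge_of_tendsto' (hlim z (hGΩ' hzG)) fun k => hz k hzG

end MainTheorem

end Pluri
end

theorem mainTheorem2 {n q : ℕ} (hq : 1 ≤ q) (hqn : q < n)
    (Ω : TopologicalSpace.Opens (Pluri.Cn n)) (hΩ : IsConnected (Ω : Set (Pluri.Cn n)))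
    {J : Type*} (T : J → Pluri.Current Ω (2 * q))
    (hT : ∀ j, Pluri.IsClosedPositive (T j))
    (hpos : ∀ j, 0 < Pluri.traceMeasure (T j) (Ω : Set (Pluri.Cn n)))
    (hnull : ∀ E : Set (Pluri.Cn n), MeasurableSet E → E ⊆ (Ω : Set (Pluri.Cn n)) →
      (∀ j, Pluri.traceMeasure (T j) E = 0) → MeasureTheory.volume E = 0)
    (u : Pluri.Cn n → EReal) (hu : Pluri.PSHOn (Ω : Set (Pluri.Cn n)) u)
    (v : J → ℕ → Pluri.Cn n → ℝ)
    (hv : ∀ j k, Pluri.PSHOn (Ω : Set (Pluri.Cn n)) (fun z => ((v j k z : ℝ) : EReal)))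
    (hvb : ∀ j k, ∃ M : ℝ, ∀ z ∈ Ω, |v j k z| ≤ M)
    (hanti : ∀ j, ∀ z ∈ Ω, Antitone (fun k => v j k z))
    (hlim : ∀ j, ∀ z ∈ Ω, Filter.Tendsto (fun k => ((v j k z : ℝ) : EReal)) Filter.atTop (nhds (u z)))
    (hmass : ∀ j, Filter.Tendsto
      (fun k => Pluri.mongeAmpereMeasure (T j) (v j k) (Ω : Set (Pluri.Cn n)))
      Filter.atTop (nhds 0)) :
    Pluri.IsMaximalPSH (Ω : Set (Pluri.Cn n)) u := by
  refine ⟨hu, fun G hG hGc hGΩ w hw hwG hwu z hz => ?_⟩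
  have hGΩ' : G ⊆ Ω := subset_closure.trans hGΩ
  refine hwG.le_of_ae_le hG (hu.mono hGΩ') ?_ hz
  have hE := hnull {x ∈ G | u x < w x} (Pluri.measurableSet_lt_of_usc hG (hu.mono hGΩ').usc hwG.usc)
    (fun x hx => hGΩ' hx.1) fun j => by
      have h := Pluri.ae_le_of_mass_tendsto_zero hq (hT j) hu (hv j) (hvb j) (hanti j) (hlim j)
        (hmass j) hG hGc hGΩ hw hwG hwu
      rw [MeasureTheory.measure_eq_zero_iff_ae_notMem]
      filter_upwards [h] with x hx hxE
      exact absurd hxE.2 (not_lt.2 (hx hxE.1))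
  rw [MeasureTheory.measure_eq_zero_iff_ae_notMem] at hE
  filter_upwards [hE] with x hx hxG
  exact not_lt.1 fun hlt => hx ⟨hxG, hlt⟩
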